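/- **Lemma (extension lemma).** Let $n\ge 2$ and let $\Omega\subset\mathbb R^n$ be a domain (nonempty, open, connected) with compact boundary and unit outer normal $N$, and let $\delta>0$. Put $\Omega_\delta=\{x\in\Omega:\operatorname{dist}(x,\partial\Omega)<\delta\}$. There is a single linear map $\mathcal E$, depending only on $\Omega$ and $\delta$, such that the following holds for every integer $l\ge 0$ and every $0\le\alpha\le 1$ for which $\partial\Omega$ is of class $C^{l+1,\alpha}$. There is a constant $C=C(\Omega,l,\alpha,\delta)$ such that for each $u_*\in C^{l,\alpha}(\partial\Omega,\mathbb R^n)$ with $\int_{\Gamma}u_*\cdot N\,dS=0$ for every connected component $\Gamma$ of $\partial\Omega$, the vector field $u=\mathcal E(u_*)$ belongs to $C^{l,\alpha}(\overline\Omega)$ and $$\operatorname{div}u=0\ \text{ in }\Omega,\qquad u|_{\partial\Omega}=u_*,\qquad \operatorname{supp}u\subset\overline{\Omega_\delta},\qquad \|u\|_{C^{l,\alpha}(\overline\Omega)}\le C\,\|u_*\|_{C^{l,\alpha}(\partial\Omega)} .$$ In particular $\mathcal E$ is the same for all admissible $(l,\alpha)$. The equation $\operatorname{div}u=0$ holds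 in the sense of distributions, and also pointwise if $l\ge 1$. Conventions. $C^{l,\alpha}(\overline\Omega)$ consists of the $C^l$ functions on $\Omega$ whose derivatives of order at most $l$ are bounded and extend continuously to $\overline\Omega$ and whose derivatives of order $l$ have finite $\alpha$-Hölder seminorm over $\Omega$; for $\alpha=0$ it is $C^l(\overline\Omega)$, and for $\alpha=1$ the derivatives of order $l$ are Lipschitz. The norm is the sum of the suprema of the derivatives of order at most $l$ and of that seminorm. $\partial\Omega$ is of class $C^{k,\alpha}$ if it is covered by finitely many open cylinders in each of which, in suitable Cartesian coordinates $(y,t)\in\mathbb R^{n-1}\times\mathbb R$, $\Omega$ is the region $t>h(y)$ above the graph of a function $h$ that is of class $C^{k,\alpha}$ on the closed base ball of the cylinder. A function on $\partial\Omega$ is of class $C^{l,\alpha}$ if it is so in the graph coordinates of these cylinders, and its norm is the sum of its norms there; any finite family of such cylinders may be used, and $C$ may depend on the chosen family. -/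

import Mathlib

open MeasureTheory Topology
open scoped NNReal ENNReal ContDiff RealInnerProductSpace

/-- `ℝⁿ` with its Euclidean norm. -/
abbrev Euc (n : ℕ) : Type := EuclideanSpace ℝ (Fin n)

section Holder

variable {V W : Type*} [NormedAddCommGroup V] [NormedSpace ℝ V]
  [NormedAddCommGroup W] [NormedSpace ℝ W]

/-- The `C^{k,α}` norm of `f` over an open set `U`: the suprema over `U` of the derivatives of order
`0, …, k`, plus the `α`-Hölder seminorm over `U` of the derivative of order `k`; it takes the value
`∞` when one of these is infinite. For `α = 0` the seminorm is the oscillation of the `k`-th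
derivative, at most twice its supremum, so that this is then equivalent to the usual `C^k` norm. -/
noncomputable def holderNorm (k : ℕ) (α : ℝ≥0) (U : Set V) (f : V → W) : ℝ≥0∞ :=
  (∑ j ∈ Finset.range (k + 1), ⨆ x ∈ U, ENNReal.ofReal ‖iteratedFDeriv ℝ j f x‖) +
    eHolderNorm α (U.domRestrict (iteratedFDeriv ℝ k f))

/-- `f ∈ C^{k,α}(Ū)` for an open set `U`: `f` is `C^k` in `U` and continuous on `Ū`, its derivatives
in `U` of order at most `k` extend continuously to `Ū`, and its `C^{k,α}` norm is finite.
Only the values of `f` on `Ū` matter. For `α = 0` this is `C^k(Ū)` (with bounded derivatives). -/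
def HolderClass (k : ℕ) (α : ℝ≥0) (U : Set V) (f : V → W) : Prop :=
  ContDiffOn ℝ k f U ∧ ContinuousOn f (closure U) ∧
    (∀ j ≤ k, ∃ g : V → ContinuousMultilinearMap ℝ (fun _ : Fin j => V) W,
      ContinuousOn g (closure U) ∧ Set.EqOn g (iteratedFDeriv ℝ j f) U) ∧
    holderNorm k α U f < ⊤

end Holder

/-- The data of a local graph in `ℝⁿ`: Cartesian coordinates `(y, t) ∈ ℝⁿ⁻¹ × ℝ` centred at
`center` with respect to an orthonormal frame (`frame` for `y`, the unit vector `dir` for `t`),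
a function `h` of `y`, and the dimensions of the cylinder `|y| < radius`, `|t| < height`. -/
structure GraphChart (n : ℕ) where
  center : Euc n
  frame : Euc (n - 1) →ₗᵢ[ℝ] Euc n
  dir : Euc n
  norm_dir : ‖dir‖ = 1
  frame_orthogonal : ∀ y, ⟪frame y, dir⟫ = 0
  h : Euc (n - 1) → ℝ
  radius : ℝ
  radius_pos : 0 < radius
  height : ℝ
  height_pos : 0 < height

namespace GraphChart

variable {n : ℕ} (c : GraphChart n)

/-- The point with local coordinates `(y, t)`. -/
noncomputable def point (y : Euc (n - 1)) (t : ℝ) : Euc n := c.center + c.frame y + t • c.dir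

/-- The parameter ball `{|y| < radius}` in `ℝⁿ⁻¹`. -/
def base : Set (Euc (n - 1)) := Metric.ball 0 c.radius

/-- The open cylinder of the chart. -/
def cylinder : Set (Euc n) := {x | ∃ y ∈ c.base, ∃ t, |t| < c.height ∧ x = c.point y t}

/-- The graph parametrization `y ↦ (y, h y)`. -/
noncomputable def graph (y : Euc (n - 1)) : Euc n := c.point y (c.h y)

/-- `c` is a `C^{k,α}` graph chart of the boundary of `Ω`: the function `h` is of class `C^{k,α}`,
its graph stays inside the cylinder, and `Ω` is in the cylinder the part strictly above the graph
(so `∂Ω` is in the cylinder the graph itself, if `Ω` is open). -/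
def IsChart (Ω : Set (Euc n)) (k : ℕ) (α : ℝ≥0) : Prop :=
  HolderClass k α c.base c.h ∧
    (∀ y ∈ c.base, |c.h y| < c.height) ∧
    ∀ y ∈ c.base, ∀ t, |t| < c.height → (c.point y t ∈ Ω ↔ c.h y < t)

/-- A function on `∂Ω` written in the chart, as a function of `y`. -/
noncomputable def pullback (Ω : Set (Euc n)) (u : frontier Ω → Euc n) (y : Euc (n - 1)) : Euc n :=
  Function.extend Subtype.val u 0 (c.graph y)

end GraphChart

section Boundary

variable {n : ℕ}

/-- `∂Ω` is covered by the finitely many `C^{k,α}` graph charts `c i`. A compact boundary is of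
class `C^{k,α}` exactly if it has such an atlas. -/
def IsBoundaryAtlas {J : ℕ} (c : Fin J → GraphChart n) (Ω : Set (Euc n)) (k : ℕ) (α : ℝ≥0) : Prop :=
  (∀ i, (c i).IsChart Ω k α) ∧ frontier Ω ⊆ ⋃ i, (c i).cylinder

/-- `u ∈ C^{k,α}(∂Ω, ℝⁿ)`: `u` is of class `C^{k,α}` in the charts of the atlas `c`. -/
def BoundaryHolderClass {J : ℕ} (c : Fin J → GraphChart n) (Ω : Set (Euc n)) (k : ℕ) (α : ℝ≥0)
    (u : frontier Ω → Euc n) : Prop :=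
  ∀ i, HolderClass k α (c i).base ((c i).pullback Ω u)

/-- The norm of `C^{k,α}(∂Ω, ℝⁿ)` given by the atlas `c`. -/
noncomputable def boundaryHolderNorm {J : ℕ} (c : Fin J → GraphChart n) (Ω : Set (Euc n)) (k : ℕ)
    (α : ℝ≥0) (u : frontier Ω → Euc n) : ℝ≥0∞ :=
  ∑ i, holderNorm k α (c i).base ((c i).pullback Ω u)

/-- `ν` is the unit outer normal of `Ω` at the boundary point `x`: directions making an obtuse angle
with `ν` enter `Ω`, those making an acute angle leave `Ω̄`. There is at most one such `ν`,
and there is one if `∂Ω` is a `C¹` graph near `x` with `Ω` on one side. -/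
def IsUnitOuterNormal (Ω : Set (Euc n)) (x ν : Euc n) : Prop :=
  ‖ν‖ = 1 ∧
    (∀ v : Euc n, ⟪v, ν⟫ < 0 → ∀ᶠ t : ℝ in 𝓝[>] 0, x + t • v ∈ Ω) ∧
    ∀ v : Euc n, 0 < ⟪v, ν⟫ → ∀ᶠ t : ℝ in 𝓝[>] 0, x + t • v ∉ closure Ω

/-- The unit outer normal `N` of `Ω` (an arbitrary vector at points where there is none). -/
noncomputable def outerNormal (Ω : Set (Euc n)) (x : Euc n) : Euc n :=
  Classical.epsilon (IsUnitOuterNormal Ω x)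

/-- The flux `∫_Γ u · N` of boundary data through a part `Γ` of `∂Ω`, with respect to the surface
measure, which is the `(n-1)`-dimensional Hausdorff measure normalized to agree with Lebesgue
measure on hyperplanes. -/
noncomputable def boundaryFlux (Ω : Set (Euc n)) (Γ : Set (frontier Ω)) (u : frontier Ω → Euc n) :
    ℝ :=
  ∫ x in Γ, ⟪u x, outerNormal Ω x⟫ ∂μHE[n - 1]

/-- `u` has zero flux through every connected component of `∂Ω`. -/
def ZeroFlux (Ω : Set (Euc n)) (u : frontier Ω → Euc n) : Prop :=
  ∀ x : frontier Ω, boundaryFlux Ω (connectedComponent x) u = 0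

/-- The pointwise divergence `∑ᵢ ∂ᵢ uⁱ`. -/
noncomputable def divergence (u : Euc n → Euc n) (x : Euc n) : ℝ :=
  ∑ i, fderiv ℝ u x (EuclideanSpace.single i 1) i

/-- `div u = 0` in `Ω` in the sense of distributions: `∫_Ω u · ∇φ = 0` for all test functions. -/
def WeaklyDivergenceFree (Ω : Set (Euc n)) (u : Euc n → Euc n) : Prop :=
  ∀ φ : Euc n → ℝ, ContDiff ℝ ∞ φ → HasCompactSupport φ → tsupport φ ⊆ Ω →
    ∫ x in Ω, fderiv ℝ φ x (u x) = 0

/-- The points of `Ω` at distance less than `δ` from `∂Ω`. -/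
def boundaryCollar (Ω : Set (Euc n)) (δ : ℝ) : Set (Euc n) :=
  Ω ∩ Metric.thickening δ (frontier Ω)

end Boundary

/-!
The extension is explicit and local, and everything rests on a potential that loses no derivative.

*The local extension.* Near a boundary point `Ω` lies above a graph `t = h(y)`; put `s = t - h(y)`.
For data `f` supported in a small cube the flux density through the graph is
`F = f · (-Dh, 1)`, with respect to `dy`. Averaging `F` successively along the coordinate lines with
a fixed density `θ` splits it as `F = ∑ j, b_j + (∫ F) θ(y₁) ⋯ θ(y_m)`, where each `b_j` has mean
zero on the lines in direction `e_j`, so that its primitive in that direction has compact support.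
Let `a_j` be the `j`-th tangential component of `f`, let `χ` be a cutoff near `s = 0`, and let
`B_j(y, s) = χ(s) (∫ σ in 0..s, a_j (y - σ e_j) - ∫ τ ≤ 0, b_j (y + τ e_j))`.
The derivatives of `B_j` in `s` and along `e_j` involve only `a_j`, `b_j` and their line integrals:
the data are never differentiated. Hence the two-dimensional curl of `B_j` in the plane of the
graph direction `E_j` and the vertical direction is as regular as the data and `Dh`; it is
divergence-free in the sense of distributions because test functions have symmetric second
derivatives. The sum over `j` of these curls has compact support and boundary values
`f - (∫ F) w`, where `w = θ(y₁) ⋯ θ(y_m) e_t` is a fixed field of flux one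
(`extend_graph`, `weaklySolenoidal_extend`, `unifCHolder_extend`).

*One operator for all `(l, α)`.* The patches are chosen once, with `h` merely known to be `C¹`. If
some atlas of the boundary is of class `C^{l+1,α}`, then comparison of coordinates expresses `Dh`
through the derivative of the graph function of the atlas, at a point that depends on `y` through
the integral of `Dh`, so the regularity of `Dh` can be bootstrapped (`exists_coordinate_change`).
Linear operators are estimated uniformly over families of data: `UnifCHolder` says that a family of
functions has `C^{l,α}` bounds proportional to given numbers, here the norms of the boundary data.

*Gluing.* For a partition of unity `η i` on the boundary, subordinate to finitely many patches, the
extensions of `η i u` add up to a field with boundary values `u - ∑ i, c_i w_i`, where `-c_i` is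
the surface integral of `η i u` against the outer normal. That the flux in coordinates is this
surface integral follows from the area formula for `C¹` graphs, obtained by comparing Hausdorff
measures under maps of small distortion (`map_surfaceMeasure`, `integral_inner_outerNormal`).

*Transport of flux.* If the centre of one patch lies in another, both can extend the same bump of
data near that centre. The extensions differ on the boundary by a multiple of `w_1 - w_2`, since the
flux of the bump is the same in both. So `w_1 - w_2` is the boundary value of a divergence-free
field near the boundary; by connectedness this holds for any two patches centred in the same
component (`fluxEquiv_of_mem_connectedComponent`). Adding such fields replaces `w_i` by the `w` of
one patch for each component. As the fluxes `c_i` sum to zero over each component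
(`sum_weightedFlux_eq_zero`), nothing is left and the boundary values are `u`
(`gluedExtension_boundary`).

The operator is defined on continuous data and extended linearly to all functions.
-/

/-! ### Hölder bounds and their calculus -/

set_option linter.unusedSectionVars false

section HolderCalculus

variable {V V' W W₁ W₂ W₃ : Type} [NormedAddCommGroup V] [NormedSpace ℝ V]
  [NormedAddCommGroup V'] [NormedSpace ℝ V'] [NormedAddCommGroup W] [NormedSpace ℝ W]
  [NormedAddCommGroup W₁] [NormedSpace ℝ W₁] [NormedAddCommGroup W₂] [NormedSpace ℝ W₂]
  [NormedAddCommGroup W₃] [NormedSpace ℝ W₃]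
  {k : ℕ} {α : ℝ≥0} {U : Set V} {U' : Set V'} {M : ℝ}

/-- `f` is bounded by `M` on `U`, and `α`-Hölder continuous there with constant `M`. -/
structure HolderBound (α : ℝ≥0) (U : Set V) (f : V → W) (M : ℝ) : Prop where
  norm_le : ∀ x ∈ U, ‖f x‖ ≤ M
  norm_sub_le : ∀ x ∈ U, ∀ y ∈ U, ‖f x - f y‖ ≤ M * ‖x - y‖ ^ (α : ℝ)

/-- `f` is of class `C^k` on `U`, and all its derivatives of order at most `k` (not only the one of
order `k`) are bounded and `α`-Hölder continuous on `U`, with constant `M`. -/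
def CHolder (k : ℕ) (α : ℝ≥0) (U : Set V) (f : V → W) (M : ℝ) : Prop :=
  ContDiffOn ℝ k f U ∧ ∀ j ≤ k, HolderBound α U (iteratedFDeriv ℝ j f) M

namespace HolderBound

variable {f g : V → W}

theorem mono {M' : ℝ} (h : HolderBound α U f M) (hM : M ≤ M') : HolderBound α U f M' where
  norm_le x hx := (h.norm_le x hx).trans hM
  norm_sub_le x hx y hy := (h.norm_sub_le x hx y hy).trans (by gcongr)

theorem mono_set {U₁ : Set V} (h : HolderBound α U f M) (hU : U₁ ⊆ U) : HolderBound α U₁ f M where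
  norm_le x hx := h.norm_le x (hU hx)
  norm_sub_le x hx y hy := h.norm_sub_le x (hU hx) y (hU hy)

theorem congr (h : HolderBound α U f M) (hfg : Set.EqOn f g U) : HolderBound α U g M where
  norm_le x hx := hfg hx ▸ h.norm_le x hx
  norm_sub_le x hx y hy := by rw [← hfg hx, ← hfg hy]; exact h.norm_sub_le x hx y hy

theorem iff_of_norm_eq {f : V → W₁} {g : V → W₂} (h : ∀ x, ‖g x‖ = ‖f x‖)
    (h' : ∀ x y, ‖g x - g y‖ = ‖f x - f y‖) : HolderBound α U g M ↔ HolderBound α U f M := by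
  constructor <;> intro H <;> refine ⟨fun x hx => ?_, fun x hx y hy => ?_⟩
  · exact h x ▸ H.norm_le x hx
  · exact h' x y ▸ H.norm_sub_le x hx y hy
  · exact (h x).symm ▸ H.norm_le x hx
  · exact (h' x y).symm ▸ H.norm_sub_le x hx y hy

theorem add {M' : ℝ} (hf : HolderBound α U f M) (hg : HolderBound α U g M') :
    HolderBound α U (fun x => f x + g x) (M + M') where
  norm_le x hx := (norm_add_le _ _).trans (add_le_add (hf.norm_le x hx) (hg.norm_le x hx))
  norm_sub_le x hx y hy := by
    rw [add_sub_add_comm, add_mul]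
    exact (norm_add_le _ _).trans (add_le_add (hf.norm_sub_le x hx y hy) (hg.norm_sub_le x hx y hy))

theorem bilin (B : W₁ →L[ℝ] W₂ →L[ℝ] W₃) {f : V → W₁} {g : V → W₂} {M₁ M₂ : ℝ} (h₁ : 0 ≤ M₁)
    (h₂ : 0 ≤ M₂) (hf : HolderBound α U f M₁) (hg : HolderBound α U g M₂) :
    HolderBound α U (fun x => B (f x) (g x)) (2 * ‖B‖ * M₁ * M₂) where
  norm_le x hx := by
    calc ‖B (f x) (g x)‖ ≤ ‖B‖ * ‖f x‖ * ‖g x‖ := B.le_opNorm₂ _ _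
      _ ≤ ‖B‖ * M₁ * M₂ := by
        gcongr
        exacts [hf.norm_le x hx, hg.norm_le x hx]
      _ ≤ 2 * ‖B‖ * M₁ * M₂ := by
        have : 0 ≤ ‖B‖ * M₁ * M₂ := by positivity
        linarith
  norm_sub_le x hx y hy := by
    have e : B (f x) (g x) - B (f y) (g y) = B (f x - f y) (g x) + B (f y) (g x - g y) := by
      simp
    rw [e]
    calc _ ≤ ‖B (f x - f y) (g x)‖ + ‖B (f y) (g x - g y)‖ := norm_add_le _ _
      _ ≤ ‖B‖ * ‖f x - f y‖ * ‖g x‖ + ‖B‖ * ‖f y‖ * ‖g x - g y‖ :=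
        add_le_add (B.le_opNorm₂ _ _) (B.le_opNorm₂ _ _)
      _ ≤ ‖B‖ * (M₁ * ‖x - y‖ ^ (α : ℝ)) * M₂ + ‖B‖ * M₁ * (M₂ * ‖x - y‖ ^ (α : ℝ)) := by
        gcongr
        exacts [hf.norm_sub_le x hx y hy, hg.norm_le x hx, hf.norm_le y hy,
          hg.norm_sub_le x hx y hy]
      _ = _ := by ring

/-- A Lipschitz and bounded function is `α`-Hölder for every `α ≤ 1`. -/
theorem of_lipschitz (hα : α ≤ 1) (hM : 0 ≤ M) (h : ∀ x ∈ U, ‖f x‖ ≤ M)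
    (hL : ∀ x ∈ U, ∀ y ∈ U, ‖f x - f y‖ ≤ M * ‖x - y‖) : HolderBound α U f (2 * M) where
  norm_le x hx := (h x hx).trans (by linarith)
  norm_sub_le x hx y hy := by
    rcases le_total ‖x - y‖ 1 with h1 | h1
    · calc ‖f x - f y‖ ≤ M * ‖x - y‖ := hL x hx y hy
        _ ≤ (2 * M) * ‖x - y‖ ^ (α : ℝ) := by
          have : ‖x - y‖ ≤ ‖x - y‖ ^ (α : ℝ) :=
            Real.self_le_rpow_of_le_one (norm_nonneg _) h1 (by exact_mod_cast hα)
          gcongr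
          linarith
    · calc ‖f x - f y‖ ≤ ‖f x‖ + ‖f y‖ := _root_.norm_sub_le _ _
        _ ≤ (2 * M) * 1 := by linarith [h x hx, h y hy]
        _ ≤ (2 * M) * ‖x - y‖ ^ (α : ℝ) := by
          gcongr
          exact Real.one_le_rpow h1 α.2

/-- Hölder bounds on the members of a cover with positive Lebesgue number give one on the union. -/
theorem of_cover {I : Type*} {O : I → Set V} {r : ℝ} (hr : 0 < r) (hM : 0 ≤ M)
    (hO : ∀ x ∈ U, ∃ i, x ∈ O i ∧ ∀ y ∈ U, ‖x - y‖ < r → y ∈ O i)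
    (h : ∀ i, HolderBound α (O i) f M) : HolderBound α U f (M * (1 + 2 / r ^ (α : ℝ))) := by
  have hr' : 0 < r ^ (α : ℝ) := Real.rpow_pos_of_pos hr _
  have hb : ∀ x ∈ U, ‖f x‖ ≤ M := fun x hx => by
    obtain ⟨i, hi, -⟩ := hO x hx
    exact (h i).norm_le x hi
  refine ⟨fun x hx => (hb x hx).trans ?_, fun x hx y hy => ?_⟩
  · exact le_mul_of_one_le_right hM (le_add_of_nonneg_right (by positivity))
  · obtain ⟨i, hi, hi'⟩ := hO x hx
    rcases lt_or_ge ‖x - y‖ r with hxy | hxy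
    · calc _ ≤ M * ‖x - y‖ ^ (α : ℝ) := (h i).norm_sub_le x hi y (hi' y hy hxy)
        _ ≤ _ := by
          gcongr
          exact le_mul_of_one_le_right hM (le_add_of_nonneg_right (by positivity))
    · have : 1 ≤ ‖x - y‖ ^ (α : ℝ) / r ^ (α : ℝ) := by
        rw [one_le_div hr']
        exact Real.rpow_le_rpow hr.le hxy α.2
      calc ‖f x - f y‖ ≤ ‖f x‖ + ‖f y‖ := _root_.norm_sub_le _ _
        _ ≤ 2 * M * 1 := by linarith [hb x hx, hb y hy]
        _ ≤ 2 * M * (‖x - y‖ ^ (α : ℝ) / r ^ (α : ℝ)) := by gcongr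
        _ ≤ M * ‖x - y‖ ^ (α : ℝ) + 2 * M * (‖x - y‖ ^ (α : ℝ) / r ^ (α : ℝ)) :=
          le_add_of_nonneg_left (by positivity)
        _ = _ := by ring

end HolderBound

namespace CHolder

variable {f g : V → W}

theorem mono {M' : ℝ} (h : CHolder k α U f M) (hM : M ≤ M') : CHolder k α U f M' :=
  ⟨h.1, fun j hj => (h.2 j hj).mono hM⟩

theorem mono_set {U₁ : Set V} (h : CHolder k α U f M) (hU : U₁ ⊆ U) : CHolder k α U₁ f M :=
  ⟨h.1.mono hU, fun j hj => (h.2 j hj).mono_set hU⟩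

theorem of_le {l : ℕ} (h : CHolder k α U f M) (hl : l ≤ k) : CHolder l α U f M :=
  ⟨h.1.of_le (by exact_mod_cast hl), fun j hj => h.2 j (hj.trans hl)⟩

theorem congr (hU : IsOpen U) (h : CHolder k α U f M) (hfg : Set.EqOn f g U) :
    CHolder k α U g M := by
  refine ⟨h.1.congr fun x hx => (hfg hx).symm, fun j hj => (h.2 j hj).congr fun x hx => ?_⟩
  exact ((hfg.eventuallyEq_of_mem (hU.mem_nhds hx)).iteratedFDeriv ℝ j).self_of_nhds

theorem holderBound_iteratedFDeriv_zero_iff :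
    HolderBound α U (iteratedFDeriv ℝ 0 f) M ↔ HolderBound α U f M := by
  rw [iteratedFDeriv_zero_eq_comp]
  exact HolderBound.iff_of_norm_eq (fun x => LinearIsometryEquiv.norm_map _ _)
    fun x y => by
        rw [Function.comp_apply, Function.comp_apply, ← map_sub, LinearIsometryEquiv.norm_map]

theorem zero_iff : CHolder 0 α U f M ↔ ContinuousOn f U ∧ HolderBound α U f M := by
  simp [CHolder, contDiffOn_zero, holderBound_iteratedFDeriv_zero_iff]

theorem succ_iff (hU : IsOpen U) : CHolder (k + 1) α U f M ↔
    HolderBound α U f M ∧ DifferentiableOn ℝ f U ∧ CHolder k α U (fderiv ℝ f) M := by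
  have e : ∀ j, HolderBound α U (iteratedFDeriv ℝ (j + 1) f) M ↔
      HolderBound α U (iteratedFDeriv ℝ j (fderiv ℝ f)) M := fun j => by
    have : iteratedFDeriv ℝ (j + 1) f = (continuousMultilinearCurryRightEquiv' ℝ j V W).symm ∘
        iteratedFDeriv ℝ j (fderiv ℝ f) := by
      ext1 x
      exact iteratedFDeriv_succ_eq_comp_right
    rw [this]
    exact HolderBound.iff_of_norm_eq (fun x => LinearIsometryEquiv.norm_map _ _)
      fun x y => by
        have h := (continuousMultilinearCurryRightEquiv' ℝ j V W).symm.isometry.dist_eq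
          (iteratedFDeriv ℝ j (fderiv ℝ f) x) (iteratedFDeriv ℝ j (fderiv ℝ f) y)
        simp only [dist_eq_norm] at h
        exact h
  have c : ContDiffOn ℝ ((k + 1 : ℕ) : WithTop ℕ∞) f U ↔
      DifferentiableOn ℝ f U ∧ ContDiffOn ℝ k (fderiv ℝ f) U := by
    rw [Nat.cast_add, Nat.cast_one, contDiffOn_succ_iff_fderiv_of_isOpen hU]
    simp
  rw [CHolder, c, CHolder]
  constructor
  · rintro ⟨⟨h1, h2⟩, h3⟩
    exact ⟨holderBound_iteratedFDeriv_zero_iff.1 (h3 0 (Nat.zero_le _)), h1, h2,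
      fun j hj => (e j).1 (h3 (j + 1) (by omega))⟩
  · rintro ⟨h1, h2, h3, h4⟩
    refine ⟨⟨h2, h3⟩, fun j hj => ?_⟩
    cases j with
    | zero => exact holderBound_iteratedFDeriv_zero_iff.2 h1
    | succ j => exact (e j).2 (h4 j (by omega))

theorem holderBound (h : CHolder k α U f M) : HolderBound α U f M :=
  holderBound_iteratedFDeriv_zero_iff.1 (h.2 0 (Nat.zero_le _))

theorem continuousOn (h : CHolder k α U f M) : ContinuousOn f U := h.1.continuousOn

end CHolder

theorem CHolder.add (hU : IsOpen U) : ∀ {k : ℕ} {W : Type} [NormedAddCommGroup W] [NormedSpace ℝ W]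
    {f g : V → W} {M M' : ℝ}, CHolder k α U f M → CHolder k α U g M' →
    CHolder k α U (fun x => f x + g x) (M + M')
  | 0, _, _, _, _, _, _, _, hf, hg => by
    rw [zero_iff] at hf hg ⊢
    exact ⟨hf.1.add hg.1, hf.2.add hg.2⟩
  | k + 1, _, _, _, f, g, _, _, hf, hg => by
    rw [succ_iff hU] at hf hg ⊢
    refine ⟨hf.1.add hg.1, hf.2.1.add hg.2.1, (CHolder.add hU hf.2.2 hg.2.2).congr hU ?_⟩
    intro x hx
    exact (fderiv_fun_add (hf.2.1.differentiableAt (hU.mem_nhds hx))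
      (hg.2.1.differentiableAt (hU.mem_nhds hx))).symm

theorem CHolder.bilin (hU : IsOpen U) : ∀ {k : ℕ} {W₁ W₂ W₃ : Type} [NormedAddCommGroup W₁]
    [NormedSpace ℝ W₁] [NormedAddCommGroup W₂] [NormedSpace ℝ W₂] [NormedAddCommGroup W₃]
    [NormedSpace ℝ W₃] (B : W₁ →L[ℝ] W₂ →L[ℝ] W₃) {f : V → W₁} {g : V → W₂} {M₁ M₂ : ℝ},
    0 ≤ M₁ → 0 ≤ M₂ → CHolder k α U f M₁ → CHolder k α U g M₂ →
    CHolder k α U (fun x => B (f x) (g x)) (2 ^ (k + 1) * ‖B‖ * M₁ * M₂)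
  | 0, _, _, _, _, _, _, _, _, _, B, f, g, M₁, M₂, h₁, h₂, hf, hg => by
    rw [zero_iff] at hf hg ⊢
    refine ⟨(B.continuous.comp_continuousOn hf.1).clm_apply hg.1, ?_⟩
    simpa using hf.2.bilin B h₁ h₂ hg.2
  | k + 1, _, _, _, _, _, _, _, _, _, B, f, g, M₁, M₂, h₁, h₂, hf, hg => by
    have hf' := hf.of_le (Nat.le_succ k)
    have hg' := hg.of_le (Nat.le_succ k)
    rw [succ_iff hU] at hf hg ⊢
    have pos : 0 ≤ ‖B‖ * M₁ * M₂ := by positivity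
    refine ⟨(hf.1.bilin B h₁ h₂ hg.1).mono ?_, ?_, ?_⟩
    · have : (2 : ℝ) ≤ 2 ^ (k + 1 + 1) := by
        calc (2 : ℝ) = 2 ^ 1 := by norm_num
          _ ≤ 2 ^ (k + 1 + 1) := pow_le_pow_right₀ (by norm_num) (by omega)
      calc 2 * ‖B‖ * M₁ * M₂ = 2 * (‖B‖ * M₁ * M₂) := by ring
        _ ≤ 2 ^ (k + 1 + 1) * (‖B‖ * M₁ * M₂) := by gcongr
        _ = _ := by ring
    · intro x hx
      have hfx := (hf.2.1.differentiableAt (hU.mem_nhds hx)).hasFDerivAt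
      have hgx := (hg.2.1.differentiableAt (hU.mem_nhds hx)).hasFDerivAt
      exact (B.hasFDerivAt_of_bilinear hfx hgx).differentiableAt.differentiableWithinAt
    · have h1 := CHolder.bilin hU (B.precompR V) h₁ h₂ hf' hg.2.2
      have h2 := CHolder.bilin hU (B.precompL V) h₁ h₂ hf.2.2 hg'
      refine ((CHolder.add hU h1 h2).mono ?_).congr hU ?_
      · calc _ ≤ 2 ^ (k + 1) * ‖B‖ * M₁ * M₂ + 2 ^ (k + 1) * ‖B‖ * M₁ * M₂ := by
              gcongr
              exacts [B.norm_precompR_le V, B.norm_precompL_le V]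
          _ = _ := by ring
      · intro x hx
        exact (B.hasFDerivAt_of_bilinear (hf.2.1.differentiableAt (hU.mem_nhds hx)).hasFDerivAt
          (hg.2.1.differentiableAt (hU.mem_nhds hx)).hasFDerivAt).fderiv.symm

theorem CHolder.zero_fun (hM : 0 ≤ M) : CHolder k α U (fun _ : V => (0 : W)) M := by
  refine ⟨contDiffOn_const, fun j _ => ⟨fun x _ => ?_, fun x _ y _ => ?_⟩⟩
  · change ‖iteratedFDeriv ℝ j (0 : V → W) x‖ ≤ M
    simpa using hM
  · change ‖iteratedFDeriv ℝ j (0 : V → W) x - iteratedFDeriv ℝ j (0 : V → W) y‖ ≤ _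
    simpa using mul_nonneg hM (Real.rpow_nonneg (norm_nonneg _) _)

theorem CHolder.const (hU : IsOpen U) (c : W) : CHolder k α U (fun _ : V => c) ‖c‖ := by
  have h0 : HolderBound α U (fun _ : V => c) ‖c‖ :=
    ⟨fun _ _ => le_rfl, fun x _ y _ => by simpa using by positivity⟩
  cases k with
  | zero => exact CHolder.zero_iff.2 ⟨continuousOn_const, h0⟩
  | succ k =>
    refine (CHolder.succ_iff hU).2 ⟨h0, differentiableOn_const c, ?_⟩
    simp only [fderiv_fun_const]
    exact CHolder.zero_fun (norm_nonneg c)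

theorem CHolder.clm_comp (hU : IsOpen U) (L : W₁ →L[ℝ] W₂) {f : V → W₁} (hM : 0 ≤ M)
    (hf : CHolder k α U f M) : CHolder k α U (fun x => L (f x)) (2 ^ (k + 1) * ‖L‖ * M) := by
  refine (CHolder.bilin hU (ContinuousLinearMap.id ℝ (W₁ →L[ℝ] W₂)) (norm_nonneg _) hM
    (CHolder.const hU L) hf).mono ?_
  have := ContinuousLinearMap.norm_id_le (𝕜 := ℝ) (E := W₁ →L[ℝ] W₂)
  calc _ ≤ 2 ^ (k + 1) * 1 * ‖L‖ * M := by gcongr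
    _ = _ := by ring

/-- Composition with a map `ψ` that is Lipschitz, and whose derivative is of class `C^{k-1,α}`
if `k ≥ 1`; the constant depends on `ψ` only. -/
theorem CHolder.comp (hU : IsOpen U) (hU' : IsOpen U') (hα : α ≤ 1) {ψ : V → V'} {K : ℝ}
    (hK : 1 ≤ K) (hmaps : Set.MapsTo ψ U U') (hlip : ∀ x ∈ U, ∀ y ∈ U, ‖ψ x - ψ y‖ ≤ K * ‖x - y‖) :
    ∀ {k : ℕ}, (0 < k → DifferentiableOn ℝ ψ U) →
    (∀ j < k, CHolder j α U (fderiv ℝ ψ) K) →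
    ∃ C, 0 ≤ C ∧ ∀ {W : Type} [NormedAddCommGroup W] [NormedSpace ℝ W] {f : V' → W} {M : ℝ}, 0 ≤ M →
      CHolder k α U' f M → CHolder k α U (fun x => f (ψ x)) (C * M)
  := by
  have base : ∀ {W : Type} [NormedAddCommGroup W] [NormedSpace ℝ W] {f : V' → W} {M : ℝ}, 0 ≤ M →
      HolderBound α U' f M → HolderBound α U (fun x => f (ψ x)) (K * M) := by
    intro W _ _ f M hM hf
    refine ⟨fun x hx => (hf.norm_le _ (hmaps hx)).trans (le_mul_of_one_le_left hM hK),
      fun x hx y hy => (hf.norm_sub_le _ (hmaps hx) _ (hmaps hy)).trans ?_⟩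
    have h1 : ‖ψ x - ψ y‖ ^ (α : ℝ) ≤ K * ‖x - y‖ ^ (α : ℝ) := by
      calc ‖ψ x - ψ y‖ ^ (α : ℝ) ≤ (K * ‖x - y‖) ^ (α : ℝ) :=
            Real.rpow_le_rpow (norm_nonneg _) (hlip x hx y hy) α.2
        _ = K ^ (α : ℝ) * ‖x - y‖ ^ (α : ℝ) := Real.mul_rpow (by linarith) (norm_nonneg _)
        _ ≤ K * ‖x - y‖ ^ (α : ℝ) := by
          gcongr
          exact Real.rpow_le_self_of_one_le hK (by exact_mod_cast hα)
    calc M * ‖ψ x - ψ y‖ ^ (α : ℝ) ≤ M * (K * ‖x - y‖ ^ (α : ℝ)) := by gcongr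
      _ = _ := by ring
  have hψc : ContinuousOn ψ U :=
    (LipschitzOnWith.of_dist_le_mul (K := K.toNNReal) fun x hx y hy => by
      rw [dist_eq_norm, dist_eq_norm, Real.coe_toNNReal _ (by linarith)]
      exact hlip x hx y hy).continuousOn
  intro k
  induction k with
  | zero =>
    intro _ _
    refine ⟨K, by linarith, fun {W} _ _ {f M} hM hf => ?_⟩
    rw [zero_iff] at hf ⊢
    exact ⟨hf.1.comp hψc hmaps, base hM hf.2⟩
  | succ k ih =>
    intro hd hj
    obtain ⟨C, hC, ih⟩ := ih (fun _ => hd (Nat.succ_pos k)) fun j hjk => hj j (by omega)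
    refine ⟨K + 2 ^ (k + 1) * 1 * C * K, by positivity, fun {W} _ _ {f M} hM hf => ?_⟩
    rw [succ_iff hU'] at hf
    rw [succ_iff hU]
    have hψd := hd (Nat.succ_pos k)
    refine ⟨(base hM hf.1).mono ?_, hf.2.1.comp hψd hmaps, ?_⟩
    · have : 0 ≤ 2 ^ (k + 1) * 1 * C * K * M := by positivity
      linarith
    · have h1 := ih hM hf.2.2
      have h2 := CHolder.bilin hU (ContinuousLinearMap.compL ℝ V V' W) (by positivity)
        (by linarith) h1 (hj k (Nat.lt_succ_self k))
      refine (h2.mono ?_).congr hU ?_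
      · have h3 := ContinuousLinearMap.norm_compL_le ℝ V V' W
        have : 0 ≤ K * M := by positivity
        calc _ ≤ 2 ^ (k + 1) * 1 * (C * M) * K := by gcongr
          _ ≤ (K + 2 ^ (k + 1) * 1 * C * K) * M := by linarith
      · intro x hx
        exact (((hf.2.1.differentiableAt (hU'.mem_nhds (hmaps hx))).hasFDerivAt.comp x
          (hψd.differentiableAt (hU.mem_nhds hx)).hasFDerivAt).fderiv).symm

theorem CHolder.of_cover {I : Type*} {O : I → Set V} {r : ℝ} (hr : 0 < r) (hM : 0 ≤ M)
    {f : V → W} (hopen : ∀ i, IsOpen (O i))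
    (hO : ∀ x ∈ U, ∃ i, x ∈ O i ∧ ∀ y ∈ U, ‖x - y‖ < r → y ∈ O i)
    (h : ∀ i, CHolder k α (O i) f M) : CHolder k α U f (M * (1 + 2 / r ^ (α : ℝ))) := by
  refine ⟨fun x hx => ?_, fun j hj => HolderBound.of_cover hr hM hO fun i => (h i).2 j hj⟩
  obtain ⟨i, hi, -⟩ := hO x hx
  exact ((h i).1.contDiffAt ((hopen i).mem_nhds hi)).contDiffWithinAt

/-- On a convex open set a bound on the derivatives of order `j` and `j + 1` gives a Hölder bound
on the one of order `j`. -/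
theorem HolderBound.iteratedFDeriv_of_bound (hU : IsOpen U) (hconv : Convex ℝ U) (hα : α ≤ 1)
    (hM : 0 ≤ M) {f : V → W} {j : ℕ} (hf : ContDiffOn ℝ (j + 1 : ℕ) f U)
    (h0 : ∀ x ∈ U, ‖iteratedFDeriv ℝ j f x‖ ≤ M)
    (h1 : ∀ x ∈ U, ‖iteratedFDeriv ℝ (j + 1) f x‖ ≤ M) :
    HolderBound α U (iteratedFDeriv ℝ j f) (2 * M) := by
  refine HolderBound.of_lipschitz hα hM h0 fun x hx y hy => ?_
  refine hconv.norm_image_sub_le_of_norm_fderiv_le (𝕜 := ℝ) (fun z hz => ?_) (fun z hz => ?_) hy hx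
  · exact (hf.contDiffAt (hU.mem_nhds hz)).differentiableAt_iteratedFDeriv
      (by exact_mod_cast Nat.lt_succ_self j)
  · rw [norm_fderiv_iteratedFDeriv]
    exact h1 z hz

theorem exists_cholder_of_hasCompactSupport (hα : α ≤ 1) {f : V → W} (hf : ContDiff ℝ ∞ f)
    (hc : HasCompactSupport f) (k : ℕ) : ∃ M, 0 ≤ M ∧ CHolder k α Set.univ f M := by
  have hb : ∀ j : ℕ, ∃ M, ∀ x, ‖iteratedFDeriv ℝ j f x‖ ≤ M := fun j =>
    (hf.continuous_iteratedFDeriv (by exact_mod_cast le_top)).bounded_above_of_compact_support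
      (hc.iteratedFDeriv j)
  choose B hB using hb
  have hB0 : ∀ j, 0 ≤ B j := fun j => (norm_nonneg _).trans (hB j 0)
  have hle : ∀ j ∈ Finset.range (k + 2), B j ≤ ∑ i ∈ Finset.range (k + 2), B i := fun j hj =>
    Finset.single_le_sum (fun i _ => hB0 i) hj
  have h0 : 0 ≤ ∑ i ∈ Finset.range (k + 2), B i := Finset.sum_nonneg fun i _ => hB0 i
  refine ⟨2 * ∑ i ∈ Finset.range (k + 2), B i, by positivity,
    (hf.of_le (by exact_mod_cast le_top)).contDiffOn, fun j hj => ?_⟩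
  refine HolderBound.iteratedFDeriv_of_bound isOpen_univ convex_univ hα h0
    (hf.of_le (by exact_mod_cast le_top)).contDiffOn (fun x _ => (hB j x).trans ?_)
    fun x _ => (hB (j + 1) x).trans ?_
  · exact hle j (Finset.mem_range.2 (by omega))
  · exact hle (j + 1) (Finset.mem_range.2 (by omega))

theorem exists_cholder_inv (hU : IsOpen U) {a : V → ℝ} {a₀ : ℝ} (ha₀ : 0 < a₀)
    (ha : ∀ x ∈ U, a₀ ≤ |a x|) (h : CHolder k α U a M) (hM : 0 ≤ M) :
    ∃ M', 0 ≤ M' ∧ CHolder k α U (fun x => (a x)⁻¹) M' := by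
  have hne : ∀ x ∈ U, a x ≠ 0 := fun x hx h0 => by
    have := ha x hx
    rw [h0, abs_zero] at this
    linarith
  have hinv : ∀ x ∈ U, ‖(a x)⁻¹‖ ≤ a₀⁻¹ := fun x hx => by
    rw [norm_inv, Real.norm_eq_abs]
    exact inv_anti₀ ha₀ (ha x hx)
  have base : HolderBound α U (fun x => (a x)⁻¹) (a₀⁻¹ + a₀⁻¹ * a₀⁻¹ * M) := by
    refine ⟨fun x hx => (hinv x hx).trans (le_add_of_nonneg_right (by positivity)),
      fun x hx y hy => ?_⟩
    have e : (a x)⁻¹ - (a y)⁻¹ = (a x)⁻¹ * (a y)⁻¹ * (a y - a x) := by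
      have := hne x hx
      have := hne y hy
      field_simp
    rw [e, norm_mul, norm_mul]
    have h3 := h.holderBound.norm_sub_le y hy x hx
    rw [norm_sub_rev y x] at h3
    calc ‖(a x)⁻¹‖ * ‖(a y)⁻¹‖ * ‖a y - a x‖ ≤ a₀⁻¹ * a₀⁻¹ * (M * ‖x - y‖ ^ (α : ℝ)) := by
          gcongr
          exacts [hinv x hx, hinv y hy]
      _ = 0 + a₀⁻¹ * a₀⁻¹ * M * ‖x - y‖ ^ (α : ℝ) := by ring
      _ ≤ a₀⁻¹ * ‖x - y‖ ^ (α : ℝ) + a₀⁻¹ * a₀⁻¹ * M * ‖x - y‖ ^ (α : ℝ) := by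
        gcongr
        positivity
      _ = _ := by ring
  induction k with
  | zero =>
    refine ⟨_, by positivity, CHolder.zero_iff.2 ⟨h.continuousOn.inv₀ hne, base⟩⟩
  | succ k ih =>
    obtain ⟨M₁, hM₁, h₁⟩ := ih (h.of_le (Nat.le_succ k))
    rw [CHolder.succ_iff hU] at h
    have h2 := CHolder.bilin hU (ContinuousLinearMap.mul ℝ ℝ) hM₁ hM₁ h₁ h₁
    have h3 := CHolder.bilin hU (ContinuousLinearMap.lsmul ℝ ℝ : ℝ →L[ℝ] (V →L[ℝ] ℝ) →L[ℝ] _)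
      (by positivity) hM h2 h.2.2
    have h4 := CHolder.clm_comp hU (-ContinuousLinearMap.id ℝ (V →L[ℝ] ℝ)) (by positivity) h3
    refine ⟨_, ?_, (CHolder.succ_iff hU).2 ⟨base.mono (le_add_of_nonneg_right ?_), ?_,
      (h4.mono (le_add_of_nonneg_left ?_)).congr hU ?_⟩⟩
    · positivity
    · positivity
    · exact fun x hx => ((h.2.1 x hx).inv (hne x hx))
    · positivity
    · intro x hx
      have hx' := h.2.1.differentiableAt (hU.mem_nhds hx)
      have := ((hasDerivAt_inv (hne x hx)).comp_hasFDerivAt x hx'.hasFDerivAt).fderiv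
      change _ = fderiv ℝ ((fun y => y⁻¹) ∘ a) x
      rw [this]
      ext v
      simp
      left
      ring

end HolderCalculus

/-! ### Families of functions with uniform Hölder bounds -/

section UniformHolder

variable {V V' W W₁ W₂ W₃ : Type} [NormedAddCommGroup V] [NormedSpace ℝ V]
  [NormedAddCommGroup V'] [NormedSpace ℝ V'] [NormedAddCommGroup W] [NormedSpace ℝ W]
  [NormedAddCommGroup W₁] [NormedSpace ℝ W₁] [NormedAddCommGroup W₂] [NormedSpace ℝ W₂]
  [NormedAddCommGroup W₃] [NormedSpace ℝ W₃]
  {k : ℕ} {α : ℝ≥0} {U : Set V} {U' : Set V'} {M : ℝ} {ι : Type} {N : ι → ℝ}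

/-- Integration along segments of a fixed direction preserves `C^{k,α}`. -/
theorem CHolder.integral_line {k : ℕ} : ∀ {W : Type} [NormedAddCommGroup W] [NormedSpace ℝ W]
    {f : V → W} {M : ℝ} {a b : ℝ} (_ : a ≤ b) (e : V), CHolder k α Set.univ f M →
    CHolder k α Set.univ (fun y => ∫ τ in a..b, f (y + τ • e)) ((b - a) * M) := by
  have cont : ∀ {W : Type} [NormedAddCommGroup W] [NormedSpace ℝ W] {f : V → W}, Continuous f →
      ∀ (e y : V), Continuous fun τ : ℝ => f (y + τ • e) := fun hf e y => by fun_prop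
  have base : ∀ {W : Type} [NormedAddCommGroup W] [NormedSpace ℝ W] {f : V → W} {M : ℝ} {a b : ℝ}
      (_ : a ≤ b) (e : V), Continuous f → HolderBound α Set.univ f M →
      HolderBound α Set.univ (fun y => ∫ τ in a..b, f (y + τ • e)) ((b - a) * M) := by
    intro W _ _ f M a b hab e hc hf
    refine ⟨fun x _ => ?_, fun x _ y _ => ?_⟩
    · have := intervalIntegral.norm_integral_le_of_norm_le_const (a := a) (b := b)
        (f := fun τ => f (x + τ • e)) (C := M) fun τ _ => hf.norm_le _ (Set.mem_univ _)
      rwa [abs_of_nonneg (sub_nonneg.2 hab), mul_comm] at this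
    · rw [← intervalIntegral.integral_sub ((cont hc e x).intervalIntegrable _ _)
        ((cont hc e y).intervalIntegrable _ _)]
      have := intervalIntegral.norm_integral_le_of_norm_le_const (a := a) (b := b)
        (f := fun τ => f (x + τ • e) - f (y + τ • e)) (C := M * ‖x - y‖ ^ (α : ℝ)) fun τ _ => by
          have := hf.norm_sub_le (x + τ • e) (Set.mem_univ _) (y + τ • e) (Set.mem_univ _)
          rwa [add_sub_add_right_eq_sub] at this
      rw [abs_of_nonneg (sub_nonneg.2 hab)] at this
      linarith
  induction k with
  | zero =>
    intro W _ _ f M a b hab e hf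
    rw [CHolder.zero_iff, continuousOn_univ] at hf ⊢
    refine ⟨?_, base hab e hf.1 hf.2⟩
    have : Continuous (Function.uncurry fun (y : V) (τ : ℝ) => f (y + τ • e)) := by
      have := hf.1
      fun_prop
    exact intervalIntegral.continuous_parametric_intervalIntegral_of_continuous' this a b
  | succ k ih =>
    intro W _ _ f M a b hab e hf
    have hc : Continuous f := continuousOn_univ.1 hf.continuousOn
    rw [CHolder.succ_iff isOpen_univ] at hf
    have hc' : Continuous (fderiv ℝ f) := continuousOn_univ.1 hf.2.2.continuousOn
    have hd : Differentiable ℝ f := differentiableOn_univ.1 hf.2.1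
    have key : ∀ y, HasFDerivAt (fun y => ∫ τ in a..b, f (y + τ • e))
        (∫ τ in a..b, fderiv ℝ f (y + τ • e)) y := by
      intro y
      refine intervalIntegral.hasFDerivAt_integral_of_dominated_of_fderiv_le (s := Set.univ)
        (F := fun y τ => f (y + τ • e)) (F' := fun y τ => fderiv ℝ f (y + τ • e))
        (bound := fun _ => M) Filter.univ_mem ?_ ?_ ?_ ?_ ?_ ?_
      · exact Filter.Eventually.of_forall fun x => (cont hc e x).aestronglyMeasurable
      · exact (cont hc e y).intervalIntegrable _ _
      · exact (cont hc' e y).aestronglyMeasurable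
      · exact Filter.Eventually.of_forall fun τ _ x _ =>
          hf.2.2.holderBound.norm_le _ (Set.mem_univ _)
      · exact intervalIntegrable_const
      · refine Filter.Eventually.of_forall fun τ _ x _ => ?_
        have h1 : HasFDerivAt (fun x : V => x + τ • e) (ContinuousLinearMap.id ℝ V) x :=
          (hasFDerivAt_id x).add_const _
        exact (hd (x + τ • e)).hasFDerivAt.comp x h1
    refine (CHolder.succ_iff isOpen_univ).2 ⟨base hab e hc hf.1,
      fun y _ => (key y).differentiableAt.differentiableWithinAt, ?_⟩
    refine (ih hab e hf.2.2).congr isOpen_univ fun y _ => (key y).fderiv.symm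

/-- A family `F i`, `i : ι`, is uniformly of class `C^{k,α}` on `U` with respect to the weights
`N i`: the constants of `F i` are bounded by a fixed multiple of `N i`. For functions depending
linearly on a parameter this expresses a bound of the norm. -/
def UnifCHolder (k : ℕ) (α : ℝ≥0) (U : Set V) (N : ι → ℝ) (F : ι → V → W) : Prop :=
  ∃ C, 0 ≤ C ∧ ∀ i, CHolder k α U (F i) (C * N i)

namespace UnifCHolder

variable {F G : ι → V → W}

theorem of_const {f : V → W} (hM : 0 ≤ M) (h : CHolder k α U f M) :
    UnifCHolder k α U (fun _ : ι => 1) fun _ => f :=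
  ⟨M, hM, fun _ => by simpa using h⟩

theorem const (hU : IsOpen U) (c : W) : UnifCHolder k α U (fun _ : ι => 1) fun _ _ => c :=
  of_const (norm_nonneg c) (CHolder.const hU c)

theorem of_hasCompactSupport (hα : α ≤ 1) {f : V → W} (hf : ContDiff ℝ ∞ f)
    (hc : HasCompactSupport f) : UnifCHolder k α Set.univ (fun _ : ι => 1) fun _ => f := by
  obtain ⟨M, hM, h⟩ := exists_cholder_of_hasCompactSupport hα hf hc k
  exact of_const hM h

theorem mono_set {U₁ : Set V} (h : UnifCHolder k α U N F) (hU : U₁ ⊆ U) :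
    UnifCHolder k α U₁ N F :=
  let ⟨C, hC, h⟩ := h
  ⟨C, hC, fun i => (h i).mono_set hU⟩

theorem of_le {l : ℕ} (h : UnifCHolder k α U N F) (hl : l ≤ k) : UnifCHolder l α U N F :=
  let ⟨C, hC, h⟩ := h
  ⟨C, hC, fun i => (h i).of_le hl⟩

theorem congr (hU : IsOpen U) (h : UnifCHolder k α U N F) (hFG : ∀ i, Set.EqOn (F i) (G i) U) :
    UnifCHolder k α U N G :=
  let ⟨C, hC, h⟩ := h
  ⟨C, hC, fun i => (h i).congr hU (hFG i)⟩

theorem zero (hN : ∀ i, 0 ≤ N i) : UnifCHolder k α U N fun _ _ => (0 : W) :=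
  ⟨1, zero_le_one, fun i => CHolder.zero_fun (by simpa using hN i)⟩

theorem add (hU : IsOpen U) (hF : UnifCHolder k α U N F) (hG : UnifCHolder k α U N G) :
    UnifCHolder k α U N fun i x => F i x + G i x := by
  obtain ⟨C, hC, hF⟩ := hF
  obtain ⟨D, hD, hG⟩ := hG
  exact ⟨C + D, add_nonneg hC hD, fun i => by rw [add_mul]; exact (hF i).add hU (hG i)⟩

theorem bilin (hU : IsOpen U) (B : W₁ →L[ℝ] W₂ →L[ℝ] W₃) {N₁ N₂ : ι → ℝ} (h₁ : ∀ i, 0 ≤ N₁ i)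
    (h₂ : ∀ i, 0 ≤ N₂ i) {F : ι → V → W₁} {G : ι → V → W₂} (hF : UnifCHolder k α U N₁ F)
    (hG : UnifCHolder k α U N₂ G) :
    UnifCHolder k α U (fun i => N₁ i * N₂ i) fun i x => B (F i x) (G i x) := by
  obtain ⟨C, hC, hF⟩ := hF
  obtain ⟨D, hD, hG⟩ := hG
  refine ⟨2 ^ (k + 1) * ‖B‖ * C * D, by positivity, fun i => ?_⟩
  convert (hF i).bilin hU B (mul_nonneg hC (h₁ i)) (mul_nonneg hD (h₂ i)) (hG i) using 1
  ring

theorem smul (hU : IsOpen U) {N₁ N₂ : ι → ℝ} (h₁ : ∀ i, 0 ≤ N₁ i) (h₂ : ∀ i, 0 ≤ N₂ i)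
    {F : ι → V → ℝ} {G : ι → V → W} (hF : UnifCHolder k α U N₁ F) (hG : UnifCHolder k α U N₂ G) :
    UnifCHolder k α U (fun i => N₁ i * N₂ i) fun i x => F i x • G i x :=
  bilin hU (ContinuousLinearMap.lsmul ℝ ℝ : ℝ →L[ℝ] W →L[ℝ] W) h₁ h₂ hF hG

/-- Product with a fixed function. -/
theorem smul_fixed (hU : IsOpen U) (hN : ∀ i, 0 ≤ N i) {f : V → ℝ}
    (hf : UnifCHolder k α U (fun _ : ι => 1) fun _ => f) (hG : UnifCHolder k α U N G) :
    UnifCHolder k α U N fun i x => f x • G i x := by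
  simpa using smul hU (fun _ => zero_le_one) hN hf hG

theorem mul_fixed (hU : IsOpen U) (hN : ∀ i, 0 ≤ N i) {f : V → ℝ} {G : ι → V → ℝ}
    (hf : UnifCHolder k α U (fun _ : ι => 1) fun _ => f) (hG : UnifCHolder k α U N G) :
    UnifCHolder k α U N fun i x => f x * G i x :=
  smul_fixed hU hN hf hG

theorem clm_comp (hU : IsOpen U) (hN : ∀ i, 0 ≤ N i) (L : W₁ →L[ℝ] W₂) {F : ι → V → W₁}
    (hF : UnifCHolder k α U N F) : UnifCHolder k α U N fun i x => L (F i x) := by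
  obtain ⟨C, hC, hF⟩ := hF
  refine ⟨2 ^ (k + 1) * ‖L‖ * C, by positivity, fun i => ?_⟩
  rw [mul_assoc]
  exact (hF i).clm_comp hU L (mul_nonneg hC (hN i))

theorem smul_const (hU : IsOpen U) (hN : ∀ i, 0 ≤ N i) {F : ι → V → ℝ}
    (hF : UnifCHolder k α U N F) (w : W) : UnifCHolder k α U N fun i x => F i x • w :=
  clm_comp hU hN ((ContinuousLinearMap.id ℝ ℝ).smulRight w) hF

theorem neg (hU : IsOpen U) (hN : ∀ i, 0 ≤ N i) (hF : UnifCHolder k α U N F) :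
    UnifCHolder k α U N fun i x => -F i x :=
  clm_comp hU hN (-ContinuousLinearMap.id ℝ W) hF

theorem sub (hU : IsOpen U) (hN : ∀ i, 0 ≤ N i) (hF : UnifCHolder k α U N F)
    (hG : UnifCHolder k α U N G) : UnifCHolder k α U N fun i x => F i x - G i x := by
  simpa [sub_eq_add_neg] using hF.add hU (hG.neg hU hN)

theorem sum (hU : IsOpen U) (hN : ∀ i, 0 ≤ N i) {J : Type*} (s : Finset J)
    {F : J → ι → V → W} (hF : ∀ j ∈ s, UnifCHolder k α U N (F j)) :
    UnifCHolder k α U N fun i x => ∑ j ∈ s, F j i x := by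
  classical
  induction s using Finset.induction_on with
  | empty => simpa using zero hN
  | insert j s hj ih =>
    simp only [Finset.sum_insert hj]
    exact (hF j (Finset.mem_insert_self _ _)).add hU
      (ih fun i hi => hF i (Finset.mem_insert_of_mem hi))

theorem comp (hU : IsOpen U) (hU' : IsOpen U') (hα : α ≤ 1) (hN : ∀ i, 0 ≤ N i) {ψ : V → V'} {K : ℝ}
    (hmaps : Set.MapsTo ψ U U') (hlip : ∀ x ∈ U, ∀ y ∈ U, ‖ψ x - ψ y‖ ≤ K * ‖x - y‖)
    (hd : 0 < k → DifferentiableOn ℝ ψ U)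
    (hψ : ∀ j < k, UnifCHolder j α U (fun _ : Unit => 1) fun _ => fderiv ℝ ψ)
    {F : ι → V' → W} (hF : UnifCHolder k α U' N F) :
    UnifCHolder k α U N fun i x => F i (ψ x) := by
  obtain ⟨D, hD, hF⟩ := hF
  have hψ' : ∀ j : Fin k, ∃ C, 0 ≤ C ∧ CHolder j α U (fderiv ℝ ψ) C := fun j =>
    let ⟨C, hC, h⟩ := hψ j j.2
    ⟨C, hC, by simpa using h ()⟩
  choose A hA0 hA using hψ'
  have hsum : 0 ≤ ∑ j, A j := Finset.sum_nonneg fun j _ => hA0 j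
  obtain ⟨C, hC, h⟩ := CHolder.comp (α := α) hU hU' hα (ψ := ψ) (K := 1 + |K| + ∑ j, A j)
    (by linarith [abs_nonneg K]) hmaps
    (fun x hx y hy => (hlip x hx y hy).trans (by
      gcongr
      linarith [le_abs_self K])) hd
    (fun j hj => (hA ⟨j, hj⟩).mono (by
      have := Finset.single_le_sum (fun j _ => hA0 j) (Finset.mem_univ (⟨j, hj⟩ : Fin k))
      linarith [abs_nonneg K]))
  refine ⟨C * D, mul_nonneg hC hD, fun i => ?_⟩
  rw [mul_assoc]
  exact h (mul_nonneg hD (hN i)) (hF i)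

theorem comp_clm (hU : IsOpen U) (hU' : IsOpen U') (hα : α ≤ 1) (hN : ∀ i, 0 ≤ N i)
    (L : V →L[ℝ] V') (c : V') (hmaps : Set.MapsTo (fun x => L x + c) U U') {F : ι → V' → W}
    (hF : UnifCHolder k α U' N F) : UnifCHolder k α U N fun i x => F i (L x + c) := by
  refine comp hU hU' hα hN hmaps (K := ‖L‖) (fun x _ y _ => ?_) (fun _ => by fun_prop)
    (fun j _ => ?_) hF
  · rw [add_sub_add_right_eq_sub, ← map_sub]
    exact L.le_opNorm _
  · have : fderiv ℝ (fun x => L x + c) = fun _ => L := by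
      ext1 x
      rw [fderiv_add_const, L.fderiv]
    rw [this]
    exact const hU L

theorem integral_line {a b : ℝ} (hab : a ≤ b) (e : V) (hF : UnifCHolder k α Set.univ N F) :
    UnifCHolder k α Set.univ N fun i y => ∫ τ in a..b, F i (y + τ • e) := by
  obtain ⟨C, hC, hF⟩ := hF
  refine ⟨(b - a) * C, mul_nonneg (sub_nonneg.2 hab) hC, fun i => ?_⟩
  rw [mul_assoc]
  exact (hF i).integral_line hab e

theorem of_cover {I : Type} [Finite I] {O : I → Set V} {r : ℝ} (hr : 0 < r) (hN : ∀ i, 0 ≤ N i)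
    (hopen : ∀ i, IsOpen (O i))
    (hO : ∀ x ∈ U, ∃ i, x ∈ O i ∧ ∀ y ∈ U, ‖x - y‖ < r → y ∈ O i)
    (h : ∀ i, UnifCHolder k α (O i) N F) : UnifCHolder k α U N F := by
  cases nonempty_fintype I
  choose C hC h using h
  have hs : 0 ≤ ∑ i, C i := Finset.sum_nonneg fun i _ => hC i
  refine ⟨(∑ i, C i) * (1 + 2 / r ^ (α : ℝ)), by positivity, fun i => ?_⟩
  convert CHolder.of_cover hr (mul_nonneg hs (hN i)) hopen hO fun j => (h j i).mono ?_ using 1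
  · ring
  · have := hN i
    gcongr
    exact Finset.single_le_sum (fun j _ => hC j) (Finset.mem_univ j)

/-- A family that is uniformly `C^{k,α}` near each point of a compact set is so on the set. -/
theorem of_locally {K : Set V} (hK : IsCompact K) (hUK : U ⊆ K) (hN : ∀ i, 0 ≤ N i)
    (h : ∀ x ∈ K, ∃ O : Set V, IsOpen O ∧ x ∈ O ∧ UnifCHolder k α O N F) :
    UnifCHolder k α U N F := by
  choose! O hO hxO h using h
  obtain ⟨t, ht, hcov⟩ := hK.elim_nhds_subcover O fun x hx => (hO x hx).mem_nhds (hxO x hx)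
  have hcov' : K ⊆ ⋃ i : t, O i := by
    intro x hx
    obtain ⟨i, hi, hxi⟩ := Set.mem_iUnion₂.1 (hcov hx)
    exact Set.mem_iUnion.2 ⟨⟨i, hi⟩, hxi⟩
  obtain ⟨r, hr, hleb⟩ := lebesgue_number_lemma_of_metric hK (fun i : t => hO i (ht i i.2)) hcov'
  refine of_cover (I := t) hr hN (fun i => hO i (ht i i.2)) (fun x hx => ?_)
    fun i => h i (ht i i.2)
  obtain ⟨i, hi⟩ := hleb x (hUK hx)
  exact ⟨i, hi (Metric.mem_ball_self hr), fun y _ hxy => hi (by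
    rwa [Metric.mem_ball, dist_comm, dist_eq_norm])⟩

/-- Extension by zero from an open neighbourhood `O` of a compact set that carries the support. -/
theorem of_support {K O : Set V} (hK : IsCompact K) (hO : IsOpen O) (hKO : K ⊆ O)
    (hN : ∀ i, 0 ≤ N i) (hF : ∀ i, ∀ x ∉ K, F i x = 0) (h : UnifCHolder k α O N F) :
    UnifCHolder k α Set.univ N F := by
  obtain ⟨r, hr, hthick⟩ := hK.exists_thickening_subset_open hO hKO
  refine of_cover (I := Bool) (O := fun b => cond b O Kᶜ) (half_pos hr) hN ?_ (fun x _ => ?_) ?_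
  · rintro (_ | _)
    exacts [hK.isClosed.isOpen_compl, hO]
  · by_cases hx : x ∈ Metric.thickening (r / 2) K
    · refine ⟨true, hthick (Metric.thickening_mono (by linarith) K hx), fun y _ hxy => ?_⟩
      obtain ⟨z, hz, hxz⟩ := Metric.mem_thickening_iff.1 hx
      refine hthick (Metric.mem_thickening_iff.2 ⟨z, hz, ?_⟩)
      rw [← dist_eq_norm, dist_comm] at hxy
      linarith [dist_triangle y x z]
    · have hd : ∀ y, ‖x - y‖ < r / 2 → y ∈ Kᶜ := fun y hxy hy =>
        hx (Metric.mem_thickening_iff.2 ⟨y, hy, by rwa [dist_eq_norm]⟩)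
      exact ⟨false, hd x (by simpa using by linarith), fun y _ hxy => hd y hxy⟩
  · rintro (_ | _)
    · exact (zero hN).congr hK.isClosed.isOpen_compl fun i x hx => (hF i x hx).symm
    · exact h

end UnifCHolder

end UniformHolder

/-! ### Comparison with the Hölder classes of `HolderClass` -/

section HolderClass

variable {V W : Type} [NormedAddCommGroup V] [NormedSpace ℝ V] [NormedAddCommGroup W]
  [NormedSpace ℝ W] {k : ℕ} {α : ℝ≥0} {U : Set V} {f : V → W} {M : ℝ}

/-- On a convex set the norm, which has a Hölder seminorm at the top order only, controls that of
all lower orders, by the mean value inequality. This is where the factor `2` comes from. -/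
theorem HolderClass.cholder (hU : IsOpen U) (hconv : Convex ℝ U) (hα : α ≤ 1)
    (h : HolderClass k α U f) : CHolder k α U f (2 * (holderNorm k α U f).toReal) := by
  obtain ⟨hc, -, -, hfin⟩ := h
  have hsum := (ENNReal.add_lt_top.1 hfin).1
  have hhol := (ENNReal.add_lt_top.1 hfin).2
  have hb : ∀ j ≤ k, ∀ x ∈ U, ‖iteratedFDeriv ℝ j f x‖ ≤ (holderNorm k α U f).toReal := by
    intro j hj x hx
    have h1 : ENNReal.ofReal ‖iteratedFDeriv ℝ j f x‖ ≤ holderNorm k α U f := by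
      refine le_trans ?_ le_self_add
      refine le_trans ?_ (Finset.single_le_sum
        (f := fun j => ⨆ x ∈ U, ENNReal.ofReal ‖iteratedFDeriv ℝ j f x‖) (fun i _ => zero_le)
        (Finset.mem_range.2 (Nat.lt_succ_of_le hj)))
      exact le_iSup₂ (f := fun x _ => ENNReal.ofReal ‖iteratedFDeriv ℝ j f x‖) x hx
    exact (ENNReal.ofReal_le_iff_le_toReal hfin.ne).1 h1
  have hn : 0 ≤ (holderNorm k α U f).toReal := ENNReal.toReal_nonneg
  refine ⟨hc, fun j hj => ?_⟩
  rcases hj.lt_or_eq with hj' | rfl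
  · exact HolderBound.iteratedFDeriv_of_bound hU hconv hα ENNReal.toReal_nonneg
      (hc.of_le (by exact_mod_cast hj')) (hb j hj) (hb (j + 1) hj')
  · refine ⟨fun x hx => (hb j hj x hx).trans (by linarith), fun x hx y hy => ?_⟩
    have hm := eHolderNorm_lt_top.1 hhol
    have h1 := hm.holderWith.dist_le ⟨x, hx⟩ ⟨y, hy⟩
    have h2 : (nnHolderNorm α (U.domRestrict (iteratedFDeriv ℝ j f)) : ℝ) ≤
        (holderNorm j α U f).toReal := by
      rw [nnHolderNorm]
      exact ENNReal.toReal_mono hfin.ne le_add_self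
    rw [dist_eq_norm, Subtype.dist_eq, dist_eq_norm] at h1
    refine h1.trans ?_
    gcongr
    linarith

theorem CHolder.holderNorm_le (hM : 0 ≤ M) (h : CHolder k α U f M) :
    holderNorm k α U f ≤ ENNReal.ofReal ((k + 2) * M) := by
  have h1 : ∀ j ∈ Finset.range (k + 1), ⨆ x ∈ U, ENNReal.ofReal ‖iteratedFDeriv ℝ j f x‖ ≤
      ENNReal.ofReal M := fun j hj => iSup₂_le fun x hx =>
    ENNReal.ofReal_le_ofReal ((h.2 j (Nat.lt_succ_iff.1 (Finset.mem_range.1 hj))).norm_le x hx)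
  have h2 : HolderWith M.toNNReal α (U.domRestrict (iteratedFDeriv ℝ k f)) := by
    intro x y
    have := (h.2 k le_rfl).norm_sub_le x x.2 y y.2
    rw [edist_dist, edist_dist, dist_eq_norm, Subtype.dist_eq, dist_eq_norm,
      ENNReal.ofReal_rpow_of_nonneg (norm_nonneg _) α.coe_nonneg]
    change ENNReal.ofReal _ ≤ ENNReal.ofReal M * _
    rw [← ENNReal.ofReal_mul hM]
    exact ENNReal.ofReal_le_ofReal this
  calc holderNorm k α U f ≤ (∑ _j ∈ Finset.range (k + 1), ENNReal.ofReal M) + ENNReal.ofReal M :=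
        add_le_add (Finset.sum_le_sum h1) h2.eHolderNorm_le
    _ = ENNReal.ofReal ((k + 2) * M) := by
      rw [Finset.sum_const, Finset.card_range, nsmul_eq_mul,
        ENNReal.ofReal_mul (by positivity : (0 : ℝ) ≤ k + 2)]
      have : ENNReal.ofReal ((k : ℝ) + 2) = (k : ℝ≥0∞) + 2 := by
        rw [ENNReal.ofReal_add (by positivity) (by norm_num)]
        simp
      rw [this]
      push_cast
      ring

theorem CHolder.holderClass (hM : 0 ≤ M) (h : CHolder k α Set.univ f M) :
    HolderClass k α U f := by
  have hc : ContDiff ℝ k f := contDiffOn_univ.1 h.1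
  refine ⟨hc.contDiffOn, hc.continuous.continuousOn, fun j hj => ⟨iteratedFDeriv ℝ j f, ?_,
    fun _ _ => rfl⟩, ((h.mono_set (Set.subset_univ U)).holderNorm_le hM).trans_lt
      ENNReal.ofReal_lt_top⟩
  exact (hc.continuous_iteratedFDeriv (by exact_mod_cast hj)).continuousOn

end HolderClass

/-! ### Graph coordinates -/

namespace GraphChart

variable {n : ℕ} (c : GraphChart n)

/-- The linear part of the coordinate `y`. -/
noncomputable def yL : Euc n →L[ℝ] Euc (n - 1) :=
  ContinuousLinearMap.adjoint c.frame.toContinuousLinearMap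

/-- The linear part of the coordinate `t`. -/
noncomputable def tL : Euc n →L[ℝ] ℝ := innerSL ℝ c.dir

/-- The base coordinate `y` of a point. -/
noncomputable def Y (x : Euc n) : Euc (n - 1) := c.yL (x - c.center)

/-- The height coordinate `t` of a point. -/
noncomputable def T (x : Euc n) : ℝ := c.tL (x - c.center)

/-- The height `t - h y` of a point above the graph. -/
noncomputable def σ (x : Euc n) : ℝ := c.T x - c.h (c.Y x)

/-- The open neighbourhood `{|y| < r, |t - h y| < height}` of a piece of the graph. -/
def tube (r : ℝ) : Set (Euc n) := {x | ‖c.Y x‖ < r ∧ |c.σ x| < c.height}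

@[simp] theorem yL_frame (y : Euc (n - 1)) : c.yL (c.frame y) = y := by
  refine ext_inner_left ℝ fun z => ?_
  rw [yL, ContinuousLinearMap.adjoint_inner_right]
  exact c.frame.inner_map_map z y

@[simp] theorem yL_dir : c.yL c.dir = 0 := by
  refine ext_inner_left ℝ fun z => ?_
  rw [yL, ContinuousLinearMap.adjoint_inner_right, inner_zero_right]
  exact c.frame_orthogonal z

@[simp] theorem tL_frame (y : Euc (n - 1)) : c.tL (c.frame y) = 0 := by
  rw [tL, innerSL_apply_apply, real_inner_comm]
  exact c.frame_orthogonal y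

@[simp] theorem tL_dir : c.tL c.dir = 1 := by
  rw [tL, innerSL_apply_apply, real_inner_self_eq_norm_sq, c.norm_dir, one_pow]

theorem frame_add_dir (hn : 1 ≤ n) (x : Euc n) : c.frame (c.yL x) + c.tL x • c.dir = x := by
  let A : (Euc (n - 1) × ℝ) →ₗ[ℝ] Euc n :=
    c.frame.toLinearMap.coprod (LinearMap.toSpanSingleton ℝ _ c.dir)
  have hA : ∀ z, A z = c.frame z.1 + z.2 • c.dir := fun z => by simp [A]
  have hinj : Function.Injective A := by
    intro z w hzw
    rw [hA, hA] at hzw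
    have h1 := congrArg c.yL hzw
    have h2 := congrArg c.tL hzw
    simp only [map_add, map_smul, yL_frame, yL_dir, tL_frame, tL_dir, smul_zero, add_zero,
      smul_eq_mul, mul_one, zero_add] at h1 h2
    exact Prod.ext h1 h2
  have hdim : Module.finrank ℝ (Euc (n - 1) × ℝ) = Module.finrank ℝ (Euc n) := by
    simp
    omega
  obtain ⟨z, hz⟩ := (LinearMap.injective_iff_surjective_of_finrank_eq_finrank hdim).1 hinj x
  rw [hA] at hz
  rw [← hz]
  simp

theorem point_Y_T (hn : 1 ≤ n) (x : Euc n) : c.point (c.Y x) (c.T x) = x := by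
  rw [point, add_assoc, Y, T, c.frame_add_dir hn]
  abel

@[simp] theorem Y_point (y : Euc (n - 1)) (t : ℝ) : c.Y (c.point y t) = y := by
  rw [Y, point, add_assoc, add_sub_cancel_left]
  simp

@[simp] theorem T_point (y : Euc (n - 1)) (t : ℝ) : c.T (c.point y t) = t := by
  rw [T, point, add_assoc, add_sub_cancel_left]
  simp

@[simp] theorem Y_graph (y : Euc (n - 1)) : c.Y (c.graph y) = y := c.Y_point _ _

@[simp] theorem T_graph (y : Euc (n - 1)) : c.T (c.graph y) = c.h y := c.T_point _ _

@[simp] theorem σ_graph (y : Euc (n - 1)) : c.σ (c.graph y) = 0 := by simp [σ]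

theorem point_Y_σ (hn : 1 ≤ n) (x : Euc n) : c.point (c.Y x) (c.h (c.Y x) + c.σ x) = x := by
  rw [σ, add_sub_cancel]
  exact c.point_Y_T hn x

theorem graph_Y (hn : 1 ≤ n) {x : Euc n} (hx : c.σ x = 0) : c.graph (c.Y x) = x := by
  conv_rhs => rw [← c.point_Y_σ hn x, hx, add_zero]
  rfl

theorem Y_add (x v : Euc n) : c.Y (x + v) = c.Y x + c.yL v := by
  rw [Y, Y, add_sub_right_comm, map_add]

theorem T_add (x v : Euc n) : c.T (x + v) = c.T x + c.tL v := by
  rw [T, T, add_sub_right_comm, map_add]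

theorem continuous_Y : Continuous c.Y := by unfold Y; fun_prop

theorem continuous_T : Continuous c.T := by unfold T; fun_prop

theorem hasFDerivAt_Y (x : Euc n) : HasFDerivAt c.Y c.yL x := by
  have e : c.Y = fun x => c.yL x - c.yL c.center := by
    ext1 x
    rw [Y, map_sub]
  rw [e]
  exact c.yL.hasFDerivAt.sub_const _

theorem hasFDerivAt_T (x : Euc n) : HasFDerivAt c.T c.tL x := by
  have e : c.T = fun x => c.tL x - c.tL c.center := by
    ext1 x
    rw [T, map_sub]
  rw [e]
  exact c.tL.hasFDerivAt.sub_const _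

theorem norm_yL_le (x : Euc n) : ‖c.yL x‖ ≤ ‖x‖ := by
  have h1 : ‖c.yL‖ ≤ 1 := by
    rw [yL, LinearIsometryEquiv.norm_map]
    exact c.frame.norm_toContinuousLinearMap_le
  exact (c.yL.le_opNorm x).trans (mul_le_of_le_one_left (norm_nonneg _) h1)

theorem norm_tL_le (x : Euc n) : |c.tL x| ≤ ‖x‖ := by
  have := abs_real_inner_le_norm c.dir x
  rwa [c.norm_dir, one_mul] at this

theorem mem_cylinder_iff (hn : 1 ≤ n) {x : Euc n} :
    x ∈ c.cylinder ↔ c.Y x ∈ c.base ∧ |c.T x| < c.height := by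
  constructor
  · rintro ⟨y, hy, t, ht, rfl⟩
    simpa using ⟨hy, ht⟩
  · rintro ⟨h1, h2⟩
    exact ⟨c.Y x, h1, c.T x, h2, (c.point_Y_T hn x).symm⟩

theorem isOpen_cylinder (hn : 1 ≤ n) : IsOpen c.cylinder := by
  have : c.cylinder = c.Y ⁻¹' c.base ∩ {x | |c.T x| < c.height} := by
    ext x
    exact c.mem_cylinder_iff hn
  rw [this]
  exact (Metric.isOpen_ball.preimage c.continuous_Y).inter
    (isOpen_lt c.continuous_T.abs continuous_const)

theorem isOpen_tube {r : ℝ} (hc : ContinuousOn c.h (Metric.ball 0 r)) : IsOpen (c.tube r) := by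
  have h1 : IsOpen (c.Y ⁻¹' Metric.ball 0 r) := Metric.isOpen_ball.preimage c.continuous_Y
  have h2 : ContinuousOn (fun x => |c.σ x|) (c.Y ⁻¹' Metric.ball 0 r) := by
    unfold σ
    exact (c.continuous_T.continuousOn.sub (hc.comp c.continuous_Y.continuousOn
      fun x hx => hx)).abs
  have := h2.isOpen_inter_preimage h1 (isOpen_Iio (a := c.height))
  convert this using 1
  ext x
  simp [tube]

theorem le_T_of_mem_closure {Ω : Set (Euc n)} {x : Euc n} (hx : x ∈ closure Ω)
    (hc : ContinuousAt c.h (c.Y x)) (h : ∀ᶠ z in 𝓝 x, z ∈ Ω → c.h (c.Y z) < c.T z) :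
    c.h (c.Y x) ≤ c.T x := by
  by_contra! hlt
  have h1 : ContinuousAt (fun z => c.h (c.Y z)) x :=
    ContinuousAt.comp (f := c.Y) hc c.continuous_Y.continuousAt
  have h2 : ∀ᶠ z in 𝓝 x, c.T z < c.h (c.Y z) := c.continuous_T.continuousAt.eventually_lt h1 hlt
  obtain ⟨z, ⟨hz1, hz2⟩, hz⟩ := mem_closure_iff_nhds.1 hx _ (h.and h2)
  exact lt_asymm (hz1 hz) hz2

theorem IsChart.T_eq {Ω : Set (Euc n)} (hn : 1 ≤ n) (hΩ : IsOpen Ω) {c : GraphChart n} {k : ℕ}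
    {α : ℝ≥0} (hc : c.IsChart Ω k α) {x : Euc n} (hx : x ∈ frontier Ω) (hxc : x ∈ c.cylinder) :
    c.T x = c.h (c.Y x) := by
  have hxΩ : x ∉ Ω := by
    rw [hΩ.frontier_eq] at hx
    exact hx.2
  have hmem := (c.mem_cylinder_iff hn).1 hxc
  refine le_antisymm ?_ (c.le_T_of_mem_closure (frontier_subset_closure hx) ?_ ?_)
  · have := hc.2.2 _ hmem.1 _ hmem.2
    rw [c.point_Y_T hn] at this
    exact not_lt.1 fun hlt => hxΩ (this.2 hlt)
  · exact hc.1.1.continuousOn.continuousAt (Metric.isOpen_ball.mem_nhds hmem.1)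
  · filter_upwards [(c.isOpen_cylinder hn).mem_nhds hxc] with z hz hzΩ
    have hz' := (c.mem_cylinder_iff hn).1 hz
    have := hc.2.2 _ hz'.1 _ hz'.2
    rw [c.point_Y_T hn] at this
    exact this.1 hzΩ

/-- `c` describes `∂Ω` near `p ∈ ∂Ω` as a `C¹` graph through the origin of its coordinates. Unlike
for `IsChart`, the neighbourhood is the tube `{|y| < 2 radius, |t - h y| < height}` around the
graph; its height is small compared to its radius and to a given `δ`. -/
structure IsPatch (c : GraphChart n) (Ω : Set (Euc n)) (δ : ℝ) (p : Euc n) : Prop where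
  center_eq : c.center = p
  h_zero : c.h 0 = 0
  contDiffOn : ContDiffOn ℝ 1 c.h (Metric.ball 0 (2 * c.radius))
  mem_iff : ∀ y ∈ Metric.ball 0 (2 * c.radius), ∀ s, |s| < c.height →
    (c.point y (c.h y + s) ∈ Ω ↔ 0 < s)
  height_le : c.height ≤ c.radius / (4 * n)
  height_lt : c.height < δ

/-- Patches are obtained by moving the origin of a chart to `p` and shrinking its cylinder. -/
theorem IsChart.exists_isPatch {Ω : Set (Euc n)} (hn : 1 ≤ n) (hΩ : IsOpen Ω) {c : GraphChart n}
    {k : ℕ} {α : ℝ≥0} (hc : c.IsChart Ω (k + 1) α) {p : Euc n} (hp : p ∈ frontier Ω)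
    (hpc : p ∈ c.cylinder) {δ : ℝ} (hδ : 0 < δ) : ∃ c' : GraphChart n, c'.IsPatch Ω δ p := by
  have hT := hc.T_eq hn hΩ hp hpc
  obtain ⟨hY, hTh⟩ := (c.mem_cylinder_iff hn).1 hpc
  set y₀ := c.Y p with hy₀
  have hcont : ContinuousOn c.h c.base := hc.1.1.continuousOn
  have hnear : ∀ᶠ y in 𝓝 y₀, y ∈ c.base ∧ |c.h y| < (c.height + |c.h y₀|) / 2 := by
    refine Filter.Eventually.and (Metric.isOpen_ball.mem_nhds hY) ?_
    have h1 := (hcont.continuousAt (Metric.isOpen_ball.mem_nhds hY)).abs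
    have h2 := hc.2.1 y₀ hY
    exact h1.eventually_lt continuousAt_const (by linarith)
  obtain ⟨r, hr, hball⟩ := Metric.eventually_nhds_iff_ball.1 hnear
  have hgap : 0 < (c.height - |c.h y₀|) / 2 := by linarith [hc.2.1 y₀ hY]
  have hn' : (0 : ℝ) < n := by exact_mod_cast hn
  have hmaps : Set.MapsTo (fun y => y₀ + y) (Metric.ball 0 r) (Metric.ball y₀ r) := fun y hy => by
    simpa [Metric.mem_ball, dist_eq_norm] using hy
  let ε := min (min ((c.height - |c.h y₀|) / 2) (r / 2 / (4 * n))) (δ / 2)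
  have hε : 0 < ε := by positivity
  have hpt : ∀ y t, p + c.frame y + (c.h (y₀ + y) - c.h y₀ + t) • c.dir =
      c.point (y₀ + y) (c.h (y₀ + y) + t) := fun y t => by
    conv_lhs => rw [← c.point_Y_T hn p, ← hy₀, hT]
    simp only [point, map_add, add_smul, sub_smul]
    abel
  refine ⟨{ center := p, frame := c.frame, dir := c.dir, norm_dir := c.norm_dir
            frame_orthogonal := c.frame_orthogonal, h := fun y => c.h (y₀ + y) - c.h y₀
            radius := r / 2, radius_pos := half_pos hr, height := ε, height_pos := hε },
    rfl, by simp, ?_, ?_, ?_, ?_⟩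
  · simp only [mul_div_cancel₀ r (two_ne_zero : (2 : ℝ) ≠ 0)]
    have h1 : ContDiffOn ℝ 1 c.h c.base := hc.1.1.of_le (by exact_mod_cast Nat.le_add_left 1 k)
    refine (h1.comp (contDiff_const.add contDiff_id).contDiffOn fun y hy =>
      (hball _ (hmaps hy)).1).sub contDiffOn_const
  · simp only [mul_div_cancel₀ r (two_ne_zero : (2 : ℝ) ≠ 0)]
    intro y hy s hs
    obtain ⟨h1, h2⟩ := hball _ (hmaps hy)
    have h3 : |c.h (y₀ + y) + s| < c.height := by
      have : ε ≤ (c.height - |c.h y₀|) / 2 := (min_le_left _ _).trans (min_le_left _ _)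
      linarith [abs_add_le (c.h (y₀ + y)) s]
    have := hc.2.2 _ h1 _ h3
    rw [← hpt] at this
    simpa [point] using this
  · exact (min_le_left _ _).trans (min_le_right _ _)
  · exact (min_le_right _ _).trans_lt (by linarith)

namespace IsPatch

variable {c} {Ω : Set (Euc n)} {δ : ℝ} {p : Euc n}

theorem continuousOn (hc : c.IsPatch Ω δ p) : ContinuousOn c.h (Metric.ball 0 (2 * c.radius)) :=
  hc.contDiffOn.continuousOn

theorem differentiableAt (hc : c.IsPatch Ω δ p) {y : Euc (n - 1)} (hy : ‖y‖ < 2 * c.radius) :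
    DifferentiableAt ℝ c.h y :=
  (hc.contDiffOn.contDiffAt (Metric.isOpen_ball.mem_nhds (by simpa using hy))).differentiableAt
    (by norm_num)

theorem isOpen_tube (hc : c.IsPatch Ω δ p) {r : ℝ} (hr : r ≤ 2 * c.radius) : IsOpen (c.tube r) :=
  c.isOpen_tube (hc.continuousOn.mono (Metric.ball_subset_ball hr))

theorem mem_iff_of_mem_tube (hc : c.IsPatch Ω δ p) (hn : 1 ≤ n) {x : Euc n}
    (hx : x ∈ c.tube (2 * c.radius)) : x ∈ Ω ↔ 0 < c.σ x := by
  have := hc.mem_iff (c.Y x) (by simpa using hx.1) (c.σ x) hx.2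
  rwa [c.point_Y_σ hn] at this

theorem σ_eq_zero (hc : c.IsPatch Ω δ p) (hn : 1 ≤ n) (hΩ : IsOpen Ω) {x : Euc n}
    (hx : x ∈ c.tube (2 * c.radius)) (hxf : x ∈ frontier Ω) : c.σ x = 0 := by
  have hxΩ : x ∉ Ω := by
    rw [hΩ.frontier_eq] at hxf
    exact hxf.2
  rw [hc.mem_iff_of_mem_tube hn hx, not_lt] at hxΩ
  refine le_antisymm hxΩ (sub_nonneg.2 (c.le_T_of_mem_closure (frontier_subset_closure hxf) ?_ ?_))
  · exact hc.continuousOn.continuousAt (Metric.isOpen_ball.mem_nhds (by simpa using hx.1))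
  · filter_upwards [(hc.isOpen_tube le_rfl).mem_nhds hx] with z hz hzΩ
    exact sub_pos.1 ((hc.mem_iff_of_mem_tube hn hz).1 hzΩ)

theorem graph_mem_tube {y : Euc (n - 1)} {r : ℝ} (hy : ‖y‖ < r) : c.graph y ∈ c.tube r := by
  simpa [tube, c.height_pos] using hy

theorem graph_mem_frontier (hc : c.IsPatch Ω δ p) (hn : 1 ≤ n) (hΩ : IsOpen Ω) {y : Euc (n - 1)}
    (hy : ‖y‖ < 2 * c.radius) : c.graph y ∈ frontier Ω := by
  rw [hΩ.frontier_eq]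
  constructor
  · have h1 : Filter.Tendsto (fun s : ℝ => c.point y (c.h y + s)) (𝓝[>] 0) (𝓝 (c.graph y)) := by
      have : Continuous fun s : ℝ => c.point y (c.h y + s) := by unfold point; fun_prop
      have := this.tendsto 0
      simp only [add_zero] at this
      exact this.mono_left nhdsWithin_le_nhds
    refine mem_closure_of_tendsto h1 ?_
    filter_upwards [Ioo_mem_nhdsGT c.height_pos] with s hs
    exact (hc.mem_iff y (by simpa using hy) s (by rw [abs_of_pos hs.1]; exact hs.2)).2 hs.1
  · have := hc.mem_iff_of_mem_tube hn (graph_mem_tube hy)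
    simp [this]

theorem Y_center (hc : c.IsPatch Ω δ p) : c.Y p = 0 := by simp [Y, ← hc.center_eq]

theorem graph_zero (hc : c.IsPatch Ω δ p) : c.graph 0 = p := by
  simp [graph, point, hc.h_zero, hc.center_eq]

theorem hasFDerivAt_graph (hc : c.IsPatch Ω δ p) {y : Euc (n - 1)} (hy : ‖y‖ < 2 * c.radius) :
    HasFDerivAt c.graph (c.frame.toContinuousLinearMap + (fderiv ℝ c.h y).smulRight c.dir) y := by
  have h1 := (hc.differentiableAt hy).hasFDerivAt.smul_const c.dir
  have h2 := (c.frame.toContinuousLinearMap.hasFDerivAt (x := y)).const_add c.center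
  exact h2.add h1

theorem continuousOn_graph (hc : c.IsPatch Ω δ p) :
    ContinuousOn c.graph (Metric.ball 0 (2 * c.radius)) := fun y hy =>
  (hc.hasFDerivAt_graph (by simpa using hy)).continuousAt.continuousWithinAt

end IsPatch

end GraphChart

/-! ### Regularity of the boundary does not depend on the coordinates -/

namespace GraphChart.IsPatch

variable {n : ℕ} {c : GraphChart n} {Ω : Set (Euc n)} {δ : ℝ} {p : Euc n}

/-- The change from the coordinate of a patch to that of a `C^{l+1,α}` chart. Differentiating the
equation of the boundary expresses `Dh` of the patch rationally through that of the chart, at the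
image point `e.Y (c.graph y)`. The latter map is as regular as the integral of `Dh`, so that the
regularity of `Dh` follows by induction on its order, starting from `C¹`. -/
theorem exists_coordinate_change (hc : c.IsPatch Ω δ p) (hn : 1 ≤ n) (hΩ : IsOpen Ω) {l : ℕ}
    {α : ℝ≥0} (hα : α ≤ 1) {e : GraphChart n} (he : e.IsChart Ω (l + 1) α) {y₀ : Euc (n - 1)}
    (hy₀ : ‖y₀‖ < 2 * c.radius) (hcyl : c.graph y₀ ∈ e.cylinder) :
    ∃ O : Set (Euc (n - 1)), IsOpen O ∧ y₀ ∈ O ∧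
      UnifCHolder l α O (fun _ : Unit => 1) (fun _ => fderiv ℝ c.h) ∧
      (∀ y ∈ O, e.Y (c.graph y) ∈ e.base ∧ e.graph (e.Y (c.graph y)) = c.graph y) ∧
      ∀ {ι : Type} {N : ι → ℝ} {F : ι → Euc (n - 1) → Euc n}, (∀ i, 0 ≤ N i) →
        UnifCHolder l α e.base N F → UnifCHolder l α O N fun i y => F i (e.Y (c.graph y)) := by
  have hB2 : IsOpen (Metric.ball (0 : Euc (n - 1)) (2 * c.radius)) := Metric.isOpen_ball
  have hy₀' : y₀ ∈ Metric.ball (0 : Euc (n - 1)) (2 * c.radius) := by simpa using hy₀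
  have hbase : IsOpen e.base := Metric.isOpen_ball
  -- the derivative of the graph function of `e`
  obtain ⟨hH0, hHd, hH⟩ := (CHolder.succ_iff hbase).1
    (he.1.cholder hbase (convex_ball _ _) hα)
  set ψ : Euc (n - 1) → Euc (n - 1) := fun y => e.Y (c.graph y) with hψ
  have hgc : ContinuousAt c.graph y₀ := hc.continuousOn_graph.continuousAt (hB2.mem_nhds hy₀')
  have hψc : ContinuousAt ψ y₀ := e.continuous_Y.continuousAt.comp hgc
  have hcyl_ev : ∀ᶠ y in 𝓝 y₀, c.graph y ∈ e.cylinder :=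
    hgc ((e.isOpen_cylinder hn).mem_nhds hcyl)
  let A : (Euc (n - 1) →L[ℝ] ℝ) →L[ℝ] ℝ := ContinuousLinearMap.apply ℝ ℝ (e.yL c.dir)
  let Bm : (Euc (n - 1) →L[ℝ] ℝ) →L[ℝ] (Euc (n - 1) →L[ℝ] ℝ) :=
    (ContinuousLinearMap.compL ℝ _ _ ℝ).flip (e.yL ∘L c.frame.toContinuousLinearMap)
  let a : Euc (n - 1) → ℝ := fun z => e.tL c.dir - A (fderiv ℝ e.h z)
  let b : Euc (n - 1) → (Euc (n - 1) →L[ℝ] ℝ) := fun z =>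
    Bm (fderiv ℝ e.h z) - e.tL ∘L c.frame.toContinuousLinearMap
  have hbv : ∀ z v, b z v = fderiv ℝ e.h z (e.yL (c.frame v)) - e.tL (c.frame v) := fun z v => rfl
  have hav : ∀ z, a z = e.tL c.dir - fderiv ℝ e.h z (e.yL c.dir) := fun z => rfl
  have hψder : ∀ y, ‖y‖ < 2 * c.radius → HasFDerivAt ψ
      (e.yL ∘L (c.frame.toContinuousLinearMap + (fderiv ℝ c.h y).smulRight c.dir)) y :=
    fun y hy => e.yL.hasFDerivAt.comp y ((hc.hasFDerivAt_graph hy).sub_const e.center)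
  -- differentiating `e.h (ψ y) = e.T (c.graph y)` along the graph
  have hrel : ∀ᶠ y in 𝓝 y₀, ∀ v, fderiv ℝ c.h y v * a (ψ y) = b (ψ y) v := by
    have hid : ∀ᶠ y in 𝓝 y₀, e.h (ψ y) - e.T (c.graph y) = 0 := by
      filter_upwards [hcyl_ev, hB2.mem_nhds hy₀'] with y h1 h2
      rw [he.T_eq hn hΩ (hc.graph_mem_frontier hn hΩ (by simpa using h2)) h1, sub_self]
    filter_upwards [hid.eventually_nhds, hcyl_ev, hB2.mem_nhds hy₀'] with y h0 h1 h2 v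
    have hyn : ‖y‖ < 2 * c.radius := by simpa using h2
    have hYb : ψ y ∈ e.base := ((e.mem_cylinder_iff hn).1 h1).1
    have d1 := ((hHd.differentiableAt (hbase.mem_nhds hYb)).hasFDerivAt.comp y (hψder y hyn)).sub
      (e.tL.hasFDerivAt.comp y ((hc.hasFDerivAt_graph hyn).sub_const e.center))
    have d2 : HasFDerivAt (fun y => e.h (ψ y) - e.T (c.graph y))
        (0 : Euc (n - 1) →L[ℝ] ℝ) y := (hasFDerivAt_const (0 : ℝ) y).congr_of_eventuallyEq h0
    have d3 := congrArg (fun L : Euc (n - 1) →L[ℝ] ℝ => L v) (d1.unique d2)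
    simp only [sub_apply, ContinuousLinearMap.comp_apply,
      add_apply, ContinuousLinearMap.smulRight_apply, map_add, map_smul,
      zero_apply, smul_eq_mul, LinearIsometry.coe_toContinuousLinearMap] at d3
    rw [hav, hbv]
    linarith
  -- `a` does not vanish, as `e.dir` would otherwise be tangent to the graph of `e`
  have ha0 : a (ψ y₀) ≠ 0 := by
    intro h0
    have hz := hrel.self_of_nhds
    rw [h0] at hz
    simp only [mul_zero] at hz
    have h1 := c.frame_add_dir hn e.dir
    have h2 := hz (c.yL e.dir)
    rw [hbv] at h2
    rw [hav] at h0
    have h3 : e.tL e.dir - fderiv ℝ e.h (ψ y₀) (e.yL e.dir) = 0 := by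
      conv_lhs => rw [← h1]
      simp only [map_add, map_smul, smul_eq_mul]
      linear_combination c.tL e.dir * h0 + h2
    simp at h3
  have hac : ContinuousAt (fun y => a (ψ y)) y₀ := by
    have h1 : ContinuousAt (fderiv ℝ e.h) (ψ y₀) :=
      hH.continuousOn.continuousAt (hbase.mem_nhds ((e.mem_cylinder_iff hn).1 hcyl).1)
    have h2 : ContinuousAt (fun y => fderiv ℝ e.h (ψ y)) y₀ := ContinuousAt.comp h1 hψc
    exact continuousAt_const.sub (A.continuous.continuousAt.comp h2)
  have hDc : ContinuousAt (fderiv ℝ c.h) y₀ :=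
    (hc.contDiffOn.contDiffAt (hB2.mem_nhds hy₀')).continuousAt_fderiv (by norm_num)
  have hall : ∀ᶠ y in 𝓝 y₀, c.graph y ∈ e.cylinder ∧
      y ∈ Metric.ball (0 : Euc (n - 1)) (2 * c.radius) ∧
      (∀ v, fderiv ℝ c.h y v * a (ψ y) = b (ψ y) v) ∧ |a (ψ y₀)| / 2 < |a (ψ y)| ∧
      ‖fderiv ℝ c.h y‖ < ‖fderiv ℝ c.h y₀‖ + 1 := by
    refine hcyl_ev.and (Filter.Eventually.and (hB2.mem_nhds hy₀') (hrel.and ?_))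
    have : 0 < |a (ψ y₀)| := abs_pos.2 ha0
    exact (continuousAt_const.eventually_lt hac.abs (by linarith)).and
      (hDc.norm.eventually_lt continuousAt_const (by linarith))
  obtain ⟨η, hη, hall⟩ := Metric.eventually_nhds_iff_ball.1 hall
  set O := Metric.ball y₀ η with hOdef
  have hO : IsOpen O := Metric.isOpen_ball
  have hψmaps : Set.MapsTo ψ O e.base := fun y hy => ((e.mem_cylinder_iff hn).1 (hall y hy).1).1
  have hψd : DifferentiableOn ℝ ψ O := fun y hy =>
    (hψder y (by simpa using (hall y hy).2.1)).differentiableAt.differentiableWithinAt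
  set K := 1 + (‖fderiv ℝ c.h y₀‖ + 1)
  have hψfd : ∀ y ∈ O, fderiv ℝ ψ y =
      e.yL ∘L c.frame.toContinuousLinearMap + (fderiv ℝ c.h y).smulRight (e.yL c.dir) := by
    intro y hy
    rw [(hψder y (by simpa using (hall y hy).2.1)).fderiv]
    ext1 v
    simp
  have hψlip : ∀ y ∈ O, ∀ z ∈ O, ‖ψ y - ψ z‖ ≤ K * ‖y - z‖ := by
    intro y hy z hz
    refine (convex_ball y₀ η).norm_image_sub_le_of_norm_fderiv_le (𝕜 := ℝ)
      (fun w hw => (hψd w hw).differentiableAt (hO.mem_nhds hw)) (fun w hw => ?_) hz hy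
    rw [hψfd w hw]
    refine ContinuousLinearMap.opNorm_le_bound _ (by positivity) fun v => ?_
    have h1 : ‖e.yL (c.frame v)‖ ≤ ‖v‖ := (e.norm_yL_le _).trans (c.frame.norm_map v).le
    have h2 : ‖e.yL c.dir‖ ≤ 1 := (e.norm_yL_le _).trans c.norm_dir.le
    have h3 : ‖fderiv ℝ c.h w v‖ ≤ (‖fderiv ℝ c.h y₀‖ + 1) * ‖v‖ :=
      (ContinuousLinearMap.le_opNorm _ _).trans (by
        gcongr
        exact (hall w hw).2.2.2.2.le)
    calc _ ≤ ‖e.yL (c.frame v)‖ + ‖fderiv ℝ c.h w v‖ * ‖e.yL c.dir‖ := by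
          refine (norm_add_le _ _).trans ?_
          simp [norm_smul]
      _ ≤ ‖v‖ + (‖fderiv ℝ c.h y₀‖ + 1) * ‖v‖ * 1 := by gcongr
      _ = K * ‖v‖ := by ring
  have hcomp : ∀ {j : ℕ}, j ≤ l →
      (∀ i < j, UnifCHolder i α O (fun _ : Unit => 1) fun _ => fderiv ℝ c.h) →
      ∀ {ι W : Type} [NormedAddCommGroup W] [NormedSpace ℝ W] {N : ι → ℝ}
        {F : ι → Euc (n - 1) → W}, (∀ i, 0 ≤ N i) →
        UnifCHolder j α e.base N F → UnifCHolder j α O N fun i y => F i (ψ y) := by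
    intro j _ hj ι W _ _ N F hN hF
    refine UnifCHolder.comp hO hbase hα hN hψmaps hψlip (fun _ => hψd) (fun i hi => ?_) hF
    have h1 := ((hj i hi).clm_comp hO (fun _ => zero_le_one)
      ((ContinuousLinearMap.smulRightL ℝ (Euc (n - 1)) (Euc (n - 1))).flip (e.yL c.dir)))
    exact ((UnifCHolder.const hO (e.yL ∘L c.frame.toContinuousLinearMap)).add hO h1).congr hO
      fun _ y hy => (hψfd y hy).symm
  have hHu : UnifCHolder l α e.base (fun _ : Unit => 1) fun _ => fderiv ℝ e.h :=
    UnifCHolder.of_const (by positivity) hH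
  have hboot : ∀ j, j ≤ l → UnifCHolder j α O (fun _ : Unit => 1) fun _ => fderiv ℝ c.h := by
    intro j
    induction j using Nat.strong_induction_on with
    | _ j ih =>
      intro hjl
      have hpos : ∀ _ : Unit, (0 : ℝ) ≤ 1 := fun _ => zero_le_one
      have h1 := hcomp hjl (fun i hi => ih i hi (hi.le.trans hjl)) hpos (hHu.of_le hjl)
      have h2 := (UnifCHolder.const hO (e.tL c.dir)).sub hO hpos (h1.clm_comp hO hpos A)
      have h3 := (h1.clm_comp hO hpos Bm).sub hO hpos
        (UnifCHolder.const hO (e.tL ∘L c.frame.toContinuousLinearMap))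
      obtain ⟨Ca, hCa, h4⟩ := h2
      obtain ⟨M', hM', h5⟩ := exists_cholder_inv (a := fun y => a (ψ y)) hO
        (by have := abs_pos.2 ha0; positivity) (fun y hy => (hall y hy).2.2.2.1.le)
        (h4 ()) (by simpa using hCa)
      refine (UnifCHolder.smul_fixed hO hpos (UnifCHolder.of_const hM' h5) h3).congr hO ?_
      intro _ y hy
      have hne : a (ψ y) ≠ 0 := fun h0 => by
        have := (hall y hy).2.2.2.1
        rw [h0, abs_zero] at this
        linarith [abs_nonneg (a (ψ y₀))]
      ext v
      have h6 : _ = b (ψ y) v := (hall y hy).2.2.1 v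
      change (a (ψ y))⁻¹ * b (ψ y) v = _
      rw [← h6]
      field_simp
  refine ⟨O, hO, Metric.mem_ball_self hη, hboot l le_rfl, fun y hy => ⟨hψmaps hy, ?_⟩,
    fun hN hF => hcomp le_rfl (fun i hi => hboot i hi.le) hN hF⟩
  have hyf := hc.graph_mem_frontier hn hΩ (by simpa using (hall y hy).2.1)
  refine e.graph_Y hn ?_
  rw [σ, he.T_eq hn hΩ hyf (hall y hy).1, sub_self]

variable {l J : ℕ} {α : ℝ≥0} {e : Fin J → GraphChart n}

/-- The graph function of a patch, chosen only to be `C¹`, is as regular as any atlas permits. -/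
theorem unifCHolder_fderiv (hc : c.IsPatch Ω δ p) (hn : 1 ≤ n) (hΩ : IsOpen Ω) (hα : α ≤ 1)
    (he : IsBoundaryAtlas e Ω (l + 1) α) :
    UnifCHolder l α (Metric.ball 0 c.radius) (fun _ : Unit => 1) fun _ => fderiv ℝ c.h := by
  refine UnifCHolder.of_locally (isCompact_closedBall 0 c.radius) Metric.ball_subset_closedBall
    (fun _ => zero_le_one) fun y hy => ?_
  have hy' : ‖y‖ < 2 * c.radius := by
    have : ‖y‖ ≤ c.radius := by simpa using hy
    linarith [c.radius_pos]
  obtain ⟨i, hi⟩ := Set.mem_iUnion.1 (he.2 (hc.graph_mem_frontier hn hΩ hy'))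
  obtain ⟨O, h1, h2, h3, -⟩ := hc.exists_coordinate_change hn hΩ hα (he.1 i) hy' hi
  exact ⟨O, h1, h2, h3⟩

/-- Boundary data in the coordinate of a patch, bounded by their norm with respect to any atlas. -/
theorem unifCHolder_boundary (hc : c.IsPatch Ω δ p) (hn : 1 ≤ n) (hΩ : IsOpen Ω) (hα : α ≤ 1)
    (he : IsBoundaryAtlas e Ω (l + 1) α) :
    UnifCHolder l α (Metric.ball 0 c.radius)
      (fun u : {u // BoundaryHolderClass e Ω l α u} => (boundaryHolderNorm e Ω l α u.1).toReal)
      fun u => c.pullback Ω u.1 := by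
  refine UnifCHolder.of_locally (isCompact_closedBall 0 c.radius) Metric.ball_subset_closedBall
    (fun _ => ENNReal.toReal_nonneg) fun y hy => ?_
  have hy' : ‖y‖ < 2 * c.radius := by
    have : ‖y‖ ≤ c.radius := by simpa using hy
    linarith [c.radius_pos]
  obtain ⟨i, hi⟩ := Set.mem_iUnion.1 (he.2 (hc.graph_mem_frontier hn hΩ hy'))
  obtain ⟨O, h1, h2, -, h3, h4⟩ := hc.exists_coordinate_change hn hΩ hα (he.1 i) hy' hi
  refine ⟨O, h1, h2, ?_⟩
  have h5 : UnifCHolder l α (e i).base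
      (fun u : {u // BoundaryHolderClass e Ω l α u} => (boundaryHolderNorm e Ω l α u.1).toReal)
      fun u => (e i).pullback Ω u.1 := by
    refine ⟨2, by norm_num, fun u => ?_⟩
    refine ((u.2 i).cholder Metric.isOpen_ball (convex_ball _ _) hα).mono ?_
    refine mul_le_mul_of_nonneg_left (ENNReal.toReal_mono ?_ ?_) zero_le_two
    · exact (ENNReal.sum_lt_top.2 fun j _ => (u.2 j).2.2.2).ne
    · exact Finset.single_le_sum
        (f := fun j => holderNorm l α (e j).base ((e j).pullback Ω u.1))
        (fun _ _ => zero_le) (Finset.mem_univ i)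
  refine (h4 (fun _ => ENNReal.toReal_nonneg) h5).congr h1 fun u z hz => ?_
  simp only [pullback]
  rw [(h3 z hz).2]

end GraphChart.IsPatch

/-! ### Inverting the divergence on a cube -/

section LineOperators

variable {m : ℕ}

/-- The `j`-th unit vector. -/
noncomputable abbrev unitVec (j : Fin m) : Euc m := EuclideanSpace.single j 1

theorem add_smul_unitVec_apply (y : Euc m) (τ : ℝ) (j k : Fin m) :
    (y + τ • unitVec j) k = if k = j then y k + τ else y k := by
  split_ifs with h <;> simp [unitVec, h]

/-- The function `y ↦ ∫ τ in a..b, f (y + τ e_j)`, depending linearly on `f`. -/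
noncomputable def lineIntegral (a b : ℝ) (j : Fin m) : C(Euc m, ℝ) →ₗ[ℝ] C(Euc m, ℝ) where
  toFun f := ⟨fun y => ∫ τ in a..b, f (y + τ • unitVec j),
    intervalIntegral.continuous_parametric_intervalIntegral_of_continuous'
      (by fun_prop : Continuous (Function.uncurry fun (y : Euc m) (τ : ℝ) =>
        f (y + τ • unitVec j))) a b⟩
  map_add' f g := by
    ext y
    exact intervalIntegral.integral_add
      (Continuous.intervalIntegrable (by fun_prop) _ _)
      (Continuous.intervalIntegrable (by fun_prop) _ _)
  map_smul' r f := by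
    ext y
    exact intervalIntegral.integral_const_mul _ _

theorem lineIntegral_apply (a b : ℝ) (j : Fin m) (f : C(Euc m, ℝ)) (y : Euc m) :
    lineIntegral a b j f y = ∫ τ in a..b, f (y + τ • unitVec j) := rfl

/-- `f` vanishes outside the open cube `{|y_k| < R}`. -/
def SupportedInCube {E : Type*} [Zero E] (R : ℝ) (f : Euc m → E) : Prop :=
  ∀ y, (∃ k, R ≤ |y k|) → f y = 0

/-- `θ` is a smooth function with integral `1`, supported in `[-R, R]`. -/
structure IsUnitBump (R : ℝ) (θ : C(ℝ, ℝ)) : Prop where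
  contDiff : ContDiff ℝ ∞ θ
  integral_eq : ∫ t, θ t = 1
  eq_zero : ∀ t, R ≤ |t| → θ t = 0

theorem exists_isUnitBump {R : ℝ} (hR : 0 < R) : ∃ θ, IsUnitBump R θ := by
  let b : ContDiffBump (0 : ℝ) := ⟨R / 2, R, half_pos hR, half_lt_self hR⟩
  refine ⟨⟨b.normed volume, b.continuous_normed⟩, b.contDiff_normed, b.integral_normed,
    fun t ht => ?_⟩
  by_contra h
  have : t ∈ Function.support (b.normed volume) := h
  rw [b.support_normed_eq, mem_ball_zero_iff, Real.norm_eq_abs] at this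
  linarith [show b.rOut = R from rfl]

/-- The mass of `f` on each line in direction `e_j`, redistributed along that line with density `θ`.
Only functions supported in the cube of half side `R` are relevant, for which the line integral is
the one over the whole line. -/
noncomputable def lineAverage (R : ℝ) (θ : C(ℝ, ℝ)) (j : Fin m) :
    C(Euc m, ℝ) →ₗ[ℝ] C(Euc m, ℝ) where
  toFun f := ⟨fun y => θ (y j) * lineIntegral (-(2 * R)) (2 * R) j f y, by fun_prop⟩
  map_add' f g := by
    ext y
    simp [mul_add]
  map_smul' r f := by
    ext y
    simp
    ring

/-- The result of averaging `f` successively along the first `k` coordinate directions. -/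
noncomputable def iterAverage (R : ℝ) (θ : C(ℝ, ℝ)) : ℕ → C(Euc m, ℝ) →ₗ[ℝ] C(Euc m, ℝ)
  | 0 => LinearMap.id
  | k + 1 => if h : k < m then lineAverage R θ ⟨k, h⟩ ∘ₗ iterAverage R θ k else iterAverage R θ k

/-- The part of `f` removed by the average along `e_j`; it has mean zero on the lines in
direction `e_j`. -/
noncomputable def averageDefect (R : ℝ) (θ : C(ℝ, ℝ)) (j : Fin m) :
    C(Euc m, ℝ) →ₗ[ℝ] C(Euc m, ℝ) :=
  iterAverage R θ j - iterAverage R θ (j + 1)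

variable {R : ℝ} {θ : C(ℝ, ℝ)}

theorem lineAverage_apply (j : Fin m) (f : C(Euc m, ℝ)) (y : Euc m) :
    lineAverage R θ j f y = θ (y j) * ∫ τ in (-(2 * R))..(2 * R), f (y + τ • unitVec j) := rfl

theorem iterAverage_succ (j : Fin m) (f : C(Euc m, ℝ)) :
    iterAverage R θ (j + 1) f = lineAverage R θ j (iterAverage R θ j f) := by
  simp [iterAverage]

/-- The defects telescope. -/
theorem sum_averageDefect (f : C(Euc m, ℝ)) (y : Euc m) :
    ∑ j, averageDefect R θ j f y = f y - iterAverage R θ m f y := by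
  have := Finset.sum_range_sub' (fun k => iterAverage R θ k f y) m
  rw [← Fin.sum_univ_eq_sum_range (fun k => iterAverage R θ k f y - iterAverage R θ (k + 1) f y)]
    at this
  simpa [averageDefect, iterAverage] using this

theorem SupportedInCube.lineAverage {f : C(Euc m, ℝ)} (hθ : IsUnitBump R θ)
    (hf : SupportedInCube R f) (j : Fin m) : SupportedInCube R (lineAverage R θ j f) := by
  rintro y ⟨k, hk⟩
  rw [lineAverage_apply]
  by_cases hkj : k = j
  · rw [← hkj, hθ.eq_zero _ hk, zero_mul]
  · have : ∀ τ : ℝ, f (y + τ • unitVec j) = 0 := fun τ => hf _ ⟨k, by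
      rwa [add_smul_unitVec_apply, if_neg hkj]⟩
    simp [this]

theorem SupportedInCube.iterAverage {f : C(Euc m, ℝ)} (hθ : IsUnitBump R θ)
    (hf : SupportedInCube R f) (k : ℕ) : SupportedInCube R (iterAverage R θ k f) := by
  induction k with
  | zero => simpa [_root_.iterAverage] using hf
  | succ k ih =>
    by_cases h : k < m
    · have := iterAverage_succ (R := R) (θ := θ) ⟨k, h⟩ f
      simp only at this
      rw [this]
      exact ih.lineAverage hθ _
    · simpa [_root_.iterAverage, h] using ih

theorem SupportedInCube.averageDefect {f : C(Euc m, ℝ)} (hθ : IsUnitBump R θ)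
    (hf : SupportedInCube R f) (j : Fin m) : SupportedInCube R (averageDefect R θ j f) :=
  fun y hy => by
    simp [_root_.averageDefect, hf.iterAverage hθ j y hy, hf.iterAverage hθ (j + 1) y hy]

theorem SupportedInCube.intervalIntegral_eq {f : C(Euc m, ℝ)} (hf : SupportedInCube R f)
    (j : Fin m) {y : Euc m} {a b : ℝ} (ha : y j + a < -R) (hb : R ≤ y j + b) :
    ∫ τ in a..b, f (y + τ • unitVec j) = ∫ τ : ℝ, f (y + τ • unitVec j) := by
  refine intervalIntegral.integral_eq_integral_of_support_subset fun τ hτ => ?_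
  by_contra h
  refine hτ (hf _ ⟨j, ?_⟩)
  rw [add_smul_unitVec_apply, if_pos rfl, le_abs']
  rw [Set.mem_Ioc, not_and_or, not_lt, not_le] at h
  rcases h with h | h
  · left; linarith
  · right; linarith

theorem lineAverage_eq_integral (hθ : IsUnitBump R θ) {f : C(Euc m, ℝ)} (hf : SupportedInCube R f)
    (j : Fin m) (y : Euc m) :
    lineAverage R θ j f y = θ (y j) * ∫ τ : ℝ, f (y + τ • unitVec j) := by
  rw [lineAverage_apply]
  rcases le_or_gt R |y j| with h | h
  · rw [hθ.eq_zero _ h, zero_mul, zero_mul]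
  · rw [abs_lt] at h
    rw [hf.intervalIntegral_eq j (by linarith) (by linarith)]

/-- The average leaves the integrals over the lines unchanged. -/
theorem integral_line_lineAverage (hθ : IsUnitBump R θ) {f : C(Euc m, ℝ)}
    (hf : SupportedInCube R f) (j : Fin m) (y : Euc m) :
    ∫ τ : ℝ, lineAverage R θ j f (y + τ • unitVec j) = ∫ τ : ℝ, f (y + τ • unitVec j) := by
  have h1 : ∀ τ : ℝ, lineAverage R θ j f (y + τ • unitVec j) =
      θ (y j + τ) * ∫ τ : ℝ, f (y + τ • unitVec j) := fun τ => by
    rw [lineAverage_eq_integral hθ hf, add_smul_unitVec_apply, if_pos rfl]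
    congr 1
    have : ∀ τ' : ℝ, y + τ • unitVec j + τ' • unitVec j = y + (τ + τ') • unitVec j := fun τ' => by
      rw [add_smul, add_assoc]
    simp only [this]
    exact integral_add_left_eq_self (fun τ => f (y + τ • unitVec j)) τ
  simp only [h1]
  rw [integral_mul_const, integral_add_left_eq_self (fun τ => θ τ) (y j), hθ.integral_eq, one_mul]

/-- Integrability of the averaging kernel against `f`, as a function of the two variables. -/
theorem integrable_bump_mul (hθ : IsUnitBump R θ) {f : C(Euc m, ℝ)}
    (hf : SupportedInCube R f) (j : Fin m) :
    Integrable (fun z : Euc m × ℝ => θ (z.1 j) * f (z.1 + z.2 • unitVec j)) := by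
  refine Continuous.integrable_of_hasCompactSupport (by fun_prop) ?_
  have hK : IsCompact (((EuclideanSpace.equiv (Fin m) ℝ).symm ''
      (Set.univ.pi fun _ => Set.Icc (-R) R)) ×ˢ Set.Icc (-(2 * R)) (2 * R)) :=
    ((isCompact_univ_pi fun _ => isCompact_Icc).image
      (EuclideanSpace.equiv (Fin m) ℝ).symm.continuous).prod isCompact_Icc
  refine HasCompactSupport.intro hK fun z hz => ?_
  by_contra hne
  obtain ⟨h1, h2⟩ := mul_ne_zero_iff.1 hne
  have h1' : |z.1 j| < R := not_le.1 fun h => h1 (hθ.eq_zero _ h)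
  have h2' : ∀ k, |(z.1 + z.2 • unitVec j) k| < R := fun k => not_le.1 fun h => h2 (hf _ ⟨k, h⟩)
  refine hz ⟨⟨fun k => z.1 k, fun k _ => ?_, ?_⟩, ?_⟩
  · by_cases hkj : k = j
    · rw [hkj]
      exact ⟨(abs_lt.1 h1').1.le, (abs_lt.1 h1').2.le⟩
    · have := h2' k
      rw [add_smul_unitVec_apply, if_neg hkj] at this
      exact ⟨(abs_lt.1 this).1.le, (abs_lt.1 this).2.le⟩
  · ext k
    simp
  · have := h2' j
    rw [add_smul_unitVec_apply, if_pos rfl] at this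
    rw [abs_lt] at this h1'
    exact ⟨by linarith, by linarith⟩

theorem integral_lineAverage (hθ : IsUnitBump R θ) {f : C(Euc m, ℝ)} (hf : SupportedInCube R f)
    (j : Fin m) : ∫ y, lineAverage R θ j f y = ∫ y, f y := by
  have hint := integrable_bump_mul hθ hf j
  calc ∫ y, lineAverage R θ j f y
      = ∫ y, ∫ τ : ℝ, θ (y j) * f (y + τ • unitVec j) := by
        refine integral_congr_ae (Filter.Eventually.of_forall fun y => ?_)
        simp only [lineAverage_eq_integral hθ hf, integral_const_mul]
    _ = ∫ τ : ℝ, ∫ y : Euc m, θ (y j) * f (y + τ • unitVec j) := integral_integral_swap hint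
    _ = ∫ τ : ℝ, ∫ y : Euc m, θ (y j - τ) * f y := by
        refine integral_congr_ae (Filter.Eventually.of_forall fun τ => ?_)
        have := integral_add_right_eq_self (μ := (volume : Measure (Euc m)))
          (fun y : Euc m => θ (y j - τ) * f y) (τ • unitVec j)
        simp only
        rw [← this]
        simp
    _ = ∫ y : Euc m, ∫ τ : ℝ, θ (y j - τ) * f y := by
        refine (integral_integral_swap ?_).symm
        have e : (fun z : Euc m × ℝ => θ (z.1 j - z.2) * f z.1) =
            (fun z : Euc m × ℝ => θ (z.1 j) * f (z.1 + z.2 • unitVec j)) ∘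
              fun z => (z.1 - z.2 • unitVec j, z.2) := by
          ext z
          simp
        have hmp : MeasurePreserving (fun z : Euc m × ℝ => (z.1 - z.2 • unitVec j, z.2)) := by
          have h1 : MeasurePreserving (fun z : ℝ × Euc m => (z.1, z.2 - z.1 • unitVec j))
              (volume.prod volume) (volume.prod volume) :=
            MeasurePreserving.skew_product (MeasurePreserving.id _)
              (g := fun (τ : ℝ) (y : Euc m) => y - τ • unitVec j) (by fun_prop)
              (Filter.Eventually.of_forall fun τ =>
                (measurePreserving_sub_right volume (τ • unitVec j)).map_eq)
          exact (Measure.measurePreserving_swap.comp h1).comp Measure.measurePreserving_swap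
        change Integrable (fun z : Euc m × ℝ => θ (z.1 j - z.2) * f z.1) (volume.prod volume)
        rw [e]
        exact hmp.integrable_comp_of_integrable hint
    _ = ∫ y, f y := by
        refine integral_congr_ae (Filter.Eventually.of_forall fun y => ?_)
        simp only [integral_mul_const]
        rw [integral_sub_left_eq_self (fun t => θ t) volume (y j), hθ.integral_eq, one_mul]

/-- The product density `∏ θ(y_k)`. -/
noncomputable def cubeDensity (θ : C(ℝ, ℝ)) (y : Euc m) : ℝ := ∏ k, θ (y k)

theorem integral_cubeDensity (hθ : IsUnitBump R θ) : ∫ y : Euc m, cubeDensity θ y = 1 := by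
  have h1 := (PiLp.volume_preserving_toLp (Fin m)).integral_comp
    (MeasurableEquiv.toLp 2 (Fin m → ℝ)).measurableEmbedding (cubeDensity (m := m) θ)
  rw [← h1]
  have h2 := integral_fintype_prod_volume_eq_prod (𝕜 := ℝ) (fun (_ : Fin m) t => θ t)
  simp only [hθ.integral_eq, Finset.prod_const_one] at h2
  exact h2

/-- After `k` steps the average has the form `θ(y₁) ⋯ θ(y_k) q(y)` with `q` independent of
`y₁, …, y_k`. -/
theorem exists_iterAverage_eq (hθ : IsUnitBump R θ) {f : C(Euc m, ℝ)} (hf : SupportedInCube R f)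
    {k : ℕ} (hk : k ≤ m) : ∃ q : Euc m → ℝ,
      (∀ y, iterAverage R θ k f y = (∏ i : Fin m with i.1 < k, θ (y i)) * q y) ∧
      ∀ (i : Fin m), i.1 < k → ∀ (y : Euc m) (τ : ℝ), q (y + τ • unitVec i) = q y := by
  induction k with
  | zero => exact ⟨f, fun y => by simp [iterAverage], fun i hi => absurd hi (Nat.not_lt_zero _)⟩
  | succ k ih =>
    obtain ⟨q, hq, hinv⟩ := ih (Nat.le_of_succ_le hk)
    set j : Fin m := ⟨k, hk⟩ with hj
    refine ⟨fun y => ∫ τ : ℝ, q (y + τ • unitVec j), fun y => ?_, fun i hi y σ => ?_⟩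
    · have h1 := iterAverage_succ (R := R) (θ := θ) j f
      simp only [hj] at h1
      rw [h1, lineAverage_eq_integral hθ (hf.iterAverage hθ k)]
      have h2 : ∀ τ : ℝ, ∏ i : Fin m with i.1 < k, θ ((y + τ • unitVec j) i) =
          ∏ i : Fin m with i.1 < k, θ (y i) := fun τ => by
        refine Finset.prod_congr rfl fun i hi => ?_
        rw [add_smul_unitVec_apply, if_neg]
        rintro rfl
        simp [hj] at hi
      have h3 : ({i : Fin m | i.1 < k + 1} : Finset (Fin m)) =
          insert j ({i : Fin m | i.1 < k} : Finset (Fin m)) := by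
        ext i
        simp [hj, Fin.ext_iff]
        omega
      simp only [hq, ← hj, h2]
      rw [integral_const_mul, h3, Finset.prod_insert (by simp [hj])]
      ring
    · rcases Nat.lt_succ_iff_lt_or_eq.1 hi with h | h
      · have : ∀ τ : ℝ, y + σ • unitVec i + τ • unitVec j = y + τ • unitVec j + σ • unitVec i :=
          fun τ => add_right_comm _ _ _
        simp only [this, hinv i h]
      · have hij : i = j := Fin.ext h
        have : ∀ τ : ℝ, y + σ • unitVec i + τ • unitVec j = y + (σ + τ) • unitVec j := fun τ => by
          rw [hij, add_smul, add_assoc]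
        simp only [this]
        exact integral_add_left_eq_self (fun τ => q (y + τ • unitVec j)) σ

/-- The full average of `f` depends on `f` through its integral only. -/
theorem iterAverage_eq (hθ : IsUnitBump R θ) {f : C(Euc m, ℝ)} (hf : SupportedInCube R f)
    (y : Euc m) : iterAverage R θ m f y = (∫ z, f z) * cubeDensity θ y := by
  obtain ⟨q, hq, hinv⟩ := exists_iterAverage_eq hθ hf le_rfl
  have hconst : ∀ y, q y = q 0 := by
    intro y
    have : ∀ s : Finset (Fin m), q (∑ i ∈ s, y i • unitVec i) = q 0 := by
      intro s
      induction s using Finset.induction_on with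
      | empty => simp
      | insert i s hi ih => rw [Finset.sum_insert hi, add_comm, hinv i i.2, ih]
    rw [← this Finset.univ]
    congr 1
    ext k
    simp [unitVec, Pi.single_apply]
  have h1 : ∀ y, iterAverage R θ m f y = cubeDensity θ y * q 0 := fun y => by
    rw [hq, hconst, cubeDensity]
    congr 2
    ext i
    simp
  have h2 : ∀ k ≤ m, ∫ y, iterAverage R θ k f y = ∫ y, f y := by
    intro k
    induction k with
    | zero => exact fun _ => rfl
    | succ k ih =>
      intro hk
      have := iterAverage_succ (R := R) (θ := θ) ⟨k, hk⟩ f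
      simp only at this
      rw [this, integral_lineAverage hθ (hf.iterAverage hθ k), ih (Nat.le_of_succ_le hk)]
  have h3 := h2 m le_rfl
  simp only [h1, integral_mul_const, integral_cubeDensity hθ, one_mul] at h3
  rw [h1, h3, mul_comm]

/-- The primitive of a defect in its own direction is supported in the cube, as long as the lower
limit is beyond the cube. -/
theorem lineIntegral_averageDefect_eq_zero (hθ : IsUnitBump R θ) {f : C(Euc m, ℝ)}
    (hf : SupportedInCube R f) (j : Fin m) {L : ℝ} (hL : 0 ≤ L) {y : Euc m} (hy : y j - L < -R)
    (hk : ∃ k, R ≤ |y k|) : lineIntegral (-L) 0 j (averageDefect R θ j f) y = 0 := by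
  rw [lineIntegral_apply]
  have hs := hf.averageDefect hθ j
  obtain ⟨k, hk⟩ := hk
  by_cases hkj : k = j
  · subst hkj
    rcases le_abs'.1 hk with h | h
    · rw [intervalIntegral.integral_congr (g := fun _ => 0)]
      · simp
      · intro τ hτ
        rw [Set.uIcc_of_le (by linarith)] at hτ
        refine hs _ ⟨k, ?_⟩
        rw [add_smul_unitVec_apply, if_pos rfl, le_abs']
        left
        linarith [hτ.2]
    · rw [hs.intervalIntegral_eq k (by linarith) (by linarith)]
      have hi : ∀ {F : C(Euc m, ℝ)}, SupportedInCube R F →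
          Integrable fun τ : ℝ => F (y + τ • unitVec k) := fun {F} hF => by
        refine Continuous.integrable_of_hasCompactSupport (by fun_prop)
          (HasCompactSupport.intro (isCompact_Icc (a := -R - y k) (b := R - y k)) fun τ hτ => ?_)
        refine hF _ ⟨k, ?_⟩
        rw [add_smul_unitVec_apply, if_pos rfl, le_abs']
        rw [Set.mem_Icc, not_and_or, not_le, not_le] at hτ
        rcases hτ with h | h
        · left; linarith
        · right; linarith
      have e : ∀ τ : ℝ, averageDefect R θ k f (y + τ • unitVec k) =
          iterAverage R θ k f (y + τ • unitVec k) -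
            lineAverage R θ k (iterAverage R θ k f) (y + τ • unitVec k) := fun τ => by
        rw [averageDefect, LinearMap.sub_apply, iterAverage_succ]
        rfl
      have hs' := hf.iterAverage hθ (R := R) k
      simp only [e]
      rw [integral_sub (hi hs') (hi (hs'.lineAverage hθ k)), integral_line_lineAverage hθ hs',
        sub_self]
  · have : ∀ τ : ℝ, averageDefect R θ j f (y + τ • unitVec j) = 0 := fun τ => hs _ ⟨k, by
      rwa [add_smul_unitVec_apply, if_neg hkj]⟩
    simp [this]

/-- Fundamental theorem of calculus for the line primitives. -/
theorem hasDerivAt_lineIntegral (L : ℝ) (j : Fin m) (f : C(Euc m, ℝ)) (y : Euc m) (τ : ℝ) :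
    HasDerivAt (fun τ : ℝ => lineIntegral (-L) 0 j f (y + τ • unitVec j))
      (f (y + τ • unitVec j) - f (y + (τ - L) • unitVec j)) τ := by
  have hc : Continuous fun s : ℝ => f (y + s • unitVec j) := by fun_prop
  have e : (fun τ : ℝ => lineIntegral (-L) 0 j f (y + τ • unitVec j)) =
      fun τ => (∫ s in (0 : ℝ)..τ, f (y + s • unitVec j)) -
        ∫ s in (0 : ℝ)..(τ - L), f (y + s • unitVec j) := by
    ext τ
    rw [lineIntegral_apply]
    have : ∀ s : ℝ, y + τ • unitVec j + s • unitVec j = y + (s + τ) • unitVec j := fun s => by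
      rw [add_assoc, ← add_smul, add_comm τ s]
    simp only [this]
    rw [intervalIntegral.integral_comp_add_right (fun s => f (y + s • unitVec j)) τ,
      intervalIntegral.integral_interval_sub_left (hc.intervalIntegrable _ _)
        (hc.intervalIntegrable _ _), zero_add, neg_add_eq_sub]
  rw [e]
  have h1 := intervalIntegral.integral_hasDerivAt_right (hc.intervalIntegrable 0 τ)
    (hc.stronglyMeasurableAtFilter _ _) hc.continuousAt
  have h2 := intervalIntegral.integral_hasDerivAt_right (hc.intervalIntegrable 0 (τ - L))
    (hc.stronglyMeasurableAtFilter _ _) hc.continuousAt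
  exact h1.sub ((h2.comp_sub_const τ L))

variable {l : ℕ} {α : ℝ≥0} {ι : Type} {N : ι → ℝ} {F : ι → C(Euc m, ℝ)}

theorem UnifCHolder.lineIntegral {a b : ℝ} (hab : a ≤ b) (j : Fin m)
    (hF : UnifCHolder l α Set.univ N fun i => ⇑(F i)) :
    UnifCHolder l α Set.univ N fun i => ⇑(lineIntegral a b j (F i)) :=
  hF.integral_line hab (unitVec j)

theorem UnifCHolder.lineAverage (hR : 0 ≤ R) (hα : α ≤ 1) (hN : ∀ i, 0 ≤ N i)
    (hθ : IsUnitBump R θ) (j : Fin m) (hF : UnifCHolder l α Set.univ N fun i => ⇑(F i)) :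
    UnifCHolder l α Set.univ N fun i => ⇑(lineAverage R θ j (F i)) := by
  have hc : HasCompactSupport θ := HasCompactSupport.intro (isCompact_Icc (a := -R) (b := R))
    fun t ht => hθ.eq_zero t (by
      rw [le_abs']
      rw [Set.mem_Icc, not_and_or, not_le, not_le] at ht
      exact ht.imp le_of_lt le_of_lt)
  have h1 : UnifCHolder l α Set.univ (fun _ : ι => 1) fun _ => ⇑θ :=
    UnifCHolder.of_hasCompactSupport hα hθ.contDiff hc
  have h2 := h1.comp_clm isOpen_univ isOpen_univ hα (fun _ => zero_le_one)
    (EuclideanSpace.proj j : Euc m →L[ℝ] ℝ) 0 (Set.mapsTo_univ _ _)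
  simp only [add_zero] at h2
  exact UnifCHolder.mul_fixed isOpen_univ hN h2 (hF.lineIntegral (by linarith) j)

theorem UnifCHolder.iterAverage (hR : 0 ≤ R) (hα : α ≤ 1) (hN : ∀ i, 0 ≤ N i)
    (hθ : IsUnitBump R θ) (k : ℕ) (hF : UnifCHolder l α Set.univ N fun i => ⇑(F i)) :
    UnifCHolder l α Set.univ N fun i => ⇑(iterAverage R θ k (F i)) := by
  induction k with
  | zero => simpa [_root_.iterAverage] using hF
  | succ k ih =>
    by_cases h : k < m
    · have e : ∀ i, _root_.iterAverage R θ (k + 1) (F i) =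
          _root_.lineAverage R θ ⟨k, h⟩ (_root_.iterAverage R θ k (F i)) := fun i =>
        iterAverage_succ ⟨k, h⟩ (F i)
      simp only [e]
      exact ih.lineAverage hR hα hN hθ _
    · simpa [_root_.iterAverage, h] using ih

theorem UnifCHolder.averageDefect (hR : 0 ≤ R) (hα : α ≤ 1) (hN : ∀ i, 0 ≤ N i)
    (hθ : IsUnitBump R θ) (j : Fin m) (hF : UnifCHolder l α Set.univ N fun i => ⇑(F i)) :
    UnifCHolder l α Set.univ N fun i => ⇑(averageDefect R θ j (F i)) :=
  (hF.iterAverage hR hα hN hθ j).sub isOpen_univ hN (hF.iterAverage hR hα hN hθ (j + 1))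

end LineOperators

/-! ### The potentials in flattened coordinates -/

section Potential

variable {m : ℕ} (L : ℝ) (χ : ℝ → ℝ) (j : Fin m) (a b : C(Euc m, ℝ))

/-- The potential `A(y, s) = χ(s) (∫ σ in 0..s, a (y - σ e_j) - ∫ τ ≤ 0, b (y + τ e_j))`, where the
first integral is written as a difference of two values of the line primitive of `a`. -/
noncomputable def potential (y : Euc m) (s : ℝ) : ℝ :=
  χ s * (lineIntegral (-L) 0 j a y - lineIntegral (-L) 0 j a (y - s • unitVec j) -
    lineIntegral (-L) 0 j b y)

/-- The derivative of the potential in `s`. -/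
noncomputable def potentialS (y : Euc m) (s : ℝ) : ℝ :=
  deriv χ s * (lineIntegral (-L) 0 j a y - lineIntegral (-L) 0 j a (y - s • unitVec j) -
    lineIntegral (-L) 0 j b y) + χ s * a (y - s • unitVec j)

/-- The derivative of the potential in direction `e_j`. -/
noncomputable def potentialJ (y : Euc m) (s : ℝ) : ℝ :=
  χ s * (a y - a (y - s • unitVec j) - b y)

/-- `χ` is a smooth cutoff function, equal to `1` near `0` and supported in `|s| ≤ ε / 3`. -/
structure IsHeightCutoff (ε : ℝ) (χ : ℝ → ℝ) : Prop where
  contDiff : ContDiff ℝ ∞ χ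
  eventually_eq_one : χ =ᶠ[𝓝 0] fun _ => 1
  eq_zero : ∀ s, ε / 3 ≤ |s| → χ s = 0

theorem exists_isHeightCutoff {ε : ℝ} (hε : 0 < ε) : ∃ χ, IsHeightCutoff ε χ := by
  let b : ContDiffBump (0 : ℝ) := ⟨ε / 6, ε / 3, by linarith, by linarith⟩
  refine ⟨b, b.contDiff, b.eventuallyEq_one, fun s hs => ?_⟩
  exact b.zero_of_le_dist (by simpa using hs)

variable {L χ j a b} {R ε : ℝ}

theorem IsHeightCutoff.hasCompactSupport (hχ : IsHeightCutoff ε χ) : HasCompactSupport χ :=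
  HasCompactSupport.intro (isCompact_Icc (a := -(ε / 3)) (b := ε / 3)) fun t ht => hχ.eq_zero t (by
    rw [le_abs']
    rw [Set.mem_Icc, not_and_or, not_le, not_le] at ht
    exact ht.imp le_of_lt le_of_lt)

theorem IsHeightCutoff.deriv_eq_zero (hχ : IsHeightCutoff ε χ) {s : ℝ} (hs : ε / 3 < |s|) :
    deriv χ s = 0 := by
  have : χ =ᶠ[𝓝 s] fun _ => 0 := by
    filter_upwards [(isOpen_lt continuous_const continuous_abs).mem_nhds hs] with t ht
    exact hχ.eq_zero t (le_of_lt ht)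
  rw [this.deriv_eq, deriv_const]

theorem IsHeightCutoff.deriv_zero (hχ : IsHeightCutoff ε χ) : deriv χ 0 = 0 := by
  rw [hχ.eventually_eq_one.deriv_eq, deriv_const]

theorem IsHeightCutoff.continuous_deriv (hχ : IsHeightCutoff ε χ) : Continuous (deriv χ) :=
  hχ.contDiff.continuous_deriv (by norm_cast)

theorem potentialS_zero (hχ : IsHeightCutoff ε χ) (y : Euc m) :
    potentialS L χ j a b y 0 = a y := by
  simp [potentialS, hχ.deriv_zero, hχ.eventually_eq_one.self_of_nhds]

theorem potentialJ_zero (hχ : IsHeightCutoff ε χ) (y : Euc m) :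
    potentialJ χ j a b y 0 = -b y := by
  simp [potentialJ, hχ.eventually_eq_one.self_of_nhds]

/-- The derivative of the potential along a curve `τ ↦ (y + q τ e_j, s(τ))`. No derivative of `a` or
`b` occurs, as both are integrated along `e_j`. -/
theorem hasDerivAt_potential (hχ : IsHeightCutoff ε χ) (ha : SupportedInCube R a)
    (hb : SupportedInCube R b) {y : Euc m} {q : ℝ} {s : ℝ → ℝ} {s' : ℝ} (hs : HasDerivAt s s' 0)
    (h1 : y j - L ≤ -R) (h2 : y j - s 0 - L ≤ -R) :
    HasDerivAt (fun τ => potential L χ j a b (y + (q * τ) • unitVec j) (s τ))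
      (q * potentialJ χ j a b y (s 0) + s' * potentialS L χ j a b y (s 0)) 0 := by
  have hχ' : HasDerivAt χ (deriv χ (s 0)) (s 0) :=
    ((hχ.contDiff.differentiable (by norm_num)) (s 0)).hasDerivAt
  have hmul : HasDerivAt (fun τ : ℝ => q * τ) q 0 := by
    simpa using (hasDerivAt_id (0 : ℝ)).const_mul q
  have far : ∀ {F : C(Euc m, ℝ)}, SupportedInCube R F → ∀ {t : ℝ}, y j + t ≤ -R →
      F (y + t • unitVec j) = 0 := fun hF t ht => hF _ ⟨j, by
    rw [add_smul_unitVec_apply, if_pos rfl, le_abs']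
    exact Or.inl ht⟩
  have d1 : ∀ {F : C(Euc m, ℝ)}, SupportedInCube R F → HasDerivAt
      (fun τ : ℝ => lineIntegral (-L) 0 j F (y + (q * τ) • unitVec j)) (F y * q) 0 := by
    intro F hF
    have h := hasDerivAt_lineIntegral L j F y (q * 0)
    have h0 : F (y + (q * 0 - L) • unitVec j) = 0 := far hF (by linarith)
    rw [h0, mul_zero, zero_smul, add_zero, sub_zero] at h
    have h' := HasDerivAt.comp (h₂ := fun τ : ℝ => lineIntegral (-L) 0 j F (y + τ • unitVec j))
      (0 : ℝ) (by simpa using h) hmul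
    exact h'
  have d2 : HasDerivAt
      (fun τ : ℝ => lineIntegral (-L) 0 j a (y + (q * τ) • unitVec j - s τ • unitVec j))
      (a (y - s 0 • unitVec j) * (q - s')) 0 := by
    have h := hasDerivAt_lineIntegral L j a y (q * 0 - s 0)
    have h0 : a (y + (q * 0 - s 0 - L) • unitVec j) = 0 := far ha (by linarith)
    rw [h0, sub_zero] at h
    have h' := HasDerivAt.comp (h₂ := fun τ : ℝ => lineIntegral (-L) 0 j a (y + τ • unitVec j))
      (0 : ℝ) h (hmul.sub hs)
    have e : y + (q * 0 - s 0) • unitVec j = y - s 0 • unitVec j := by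
      rw [mul_zero, zero_sub, neg_smul, sub_eq_add_neg]
    rw [e] at h'
    refine h'.congr_of_eventuallyEq (Filter.Eventually.of_forall fun τ => ?_)
    simp only [Function.comp, sub_smul, add_sub_assoc, Pi.sub_apply]
  have d3 := (HasDerivAt.comp (0 : ℝ) hχ' hs).mul (((d1 ha).sub d2).sub (d1 hb))
  refine d3.congr_deriv ?_
  simp [potentialJ, potentialS]
  ring

theorem continuous_potential (hχ : IsHeightCutoff ε χ) :
    Continuous fun z : Euc m × ℝ => potential L χ j a b z.1 z.2 := by
  have := hχ.contDiff.continuous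
  unfold potential
  fun_prop

theorem continuous_potentialS (hχ : IsHeightCutoff ε χ) :
    Continuous fun z : Euc m × ℝ => potentialS L χ j a b z.1 z.2 := by
  have := hχ.contDiff.continuous
  have := hχ.continuous_deriv
  unfold potentialS
  fun_prop

theorem continuous_potentialJ (hχ : IsHeightCutoff ε χ) :
    Continuous fun z : Euc m × ℝ => potentialJ χ j a b z.1 z.2 := by
  have := hχ.contDiff.continuous
  unfold potentialJ
  fun_prop

/-- The integral of `a` over the segment from `y - s e_j` to `y` vanishes away from its support. -/
theorem primitive_sub_eq_zero (ha : SupportedInCube R a) {y : Euc m} {s : ℝ} (hs : |s| ≤ R)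
    (hL : 0 ≤ L) (hyL : y j - L < -(2 * R)) (hk : ∃ k, 2 * R ≤ |y k|) :
    lineIntegral (-L) 0 j a y - lineIntegral (-L) 0 j a (y - s • unitVec j) = 0 := by
  have hR : 0 ≤ R := (abs_nonneg s).trans hs
  obtain ⟨k, hk⟩ := hk
  rw [abs_le] at hs
  have e : y - s • unitVec j = y + (-s) • unitVec j := by rw [neg_smul, sub_eq_add_neg]
  by_cases hkj : k = j
  · subst hkj
    rcases le_abs'.1 hk with h | h
    · have far : ∀ t : ℝ, |t| ≤ R → lineIntegral (-L) 0 k a (y + t • unitVec k) = 0 := by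
        intro t ht
        rw [abs_le] at ht
        rw [lineIntegral_apply, intervalIntegral.integral_congr (g := fun _ => 0)]
        · simp
        · intro τ hτ
          rw [Set.uIcc_of_le (by linarith)] at hτ
          refine ha _ ⟨k, ?_⟩
          rw [add_smul_unitVec_apply, if_pos rfl, add_smul_unitVec_apply, if_pos rfl, le_abs']
          left
          linarith [hτ.2]
      have h0 := far 0 (by simpa using hR)
      rw [zero_smul, add_zero] at h0
      rw [e, h0, far (-s) (by rw [abs_neg, abs_le]; exact hs), sub_self]
    · have hy' : (y + (-s) • unitVec k) k = y k - s := by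
        rw [add_smul_unitVec_apply, if_pos rfl]
        ring
      rw [e, lineIntegral_apply, lineIntegral_apply, ha.intervalIntegral_eq k (by linarith)
        (by linarith), ha.intervalIntegral_eq k (by rw [hy']; linarith) (by rw [hy']; linarith)]
      have : ∀ τ : ℝ, y + (-s) • unitVec k + τ • unitVec k = y + (-s + τ) • unitVec k := fun τ => by
        rw [add_smul, add_assoc]
      simp only [this]
      rw [integral_add_left_eq_self (fun τ => a (y + τ • unitVec k)) (-s), sub_self]
  · have far : ∀ t : ℝ, lineIntegral (-L) 0 j a (y + t • unitVec j) = 0 := by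
      intro t
      rw [lineIntegral_apply]
      have : ∀ τ : ℝ, a (y + t • unitVec j + τ • unitVec j) = 0 := fun τ => ha _ ⟨k, by
        rw [add_smul_unitVec_apply, if_neg hkj, add_smul_unitVec_apply, if_neg hkj]
        linarith⟩
      simp [this]
    have h0 := far 0
    rw [zero_smul, add_zero] at h0
    rw [e, h0, far, sub_self]

/-- The potential and its two derivatives vanish outside `{|y_k| < 2 R, |s| < ε / 2}`. -/
theorem potential_eq_zero (hχ : IsHeightCutoff ε χ) (hε : 0 < ε) (ha : SupportedInCube R a)
    (hb : SupportedInCube R b) (hεR : ε ≤ R) {y : Euc m} {s : ℝ} (hL : 0 ≤ L)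
    (hyL : y j - L < -(2 * R))
    (hb' : (∃ k, R ≤ |y k|) → lineIntegral (-L) 0 j b y = 0)
    (h : (∃ k, 2 * R ≤ |y k|) ∨ ε / 2 ≤ |s|) :
    potential L χ j a b y s = 0 ∧ potentialS L χ j a b y s = 0 ∧ potentialJ χ j a b y s = 0 := by
  have hR : 0 < R := hε.trans_le hεR
  rcases le_or_gt (ε / 2) |s| with hs | hs
  · have h1 : χ s = 0 := hχ.eq_zero s (by linarith)
    have h2 : deriv χ s = 0 := hχ.deriv_eq_zero (by linarith)
    simp [potential, potentialS, potentialJ, h1, h2]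
  · have hk := h.resolve_right (not_le.2 hs)
    have hk' : ∃ k, R ≤ |y k| := hk.imp fun k h => by linarith
    have h1 := primitive_sub_eq_zero ha (j := j) (L := L) (y := y) (s := s) (by linarith) hL hyL hk
    have h2 := hb' hk'
    have h3 : a (y - s • unitVec j) = 0 := by
      obtain ⟨k, hk⟩ := hk
      refine ha _ ⟨k, ?_⟩
      have e : y - s • unitVec j = y + (-s) • unitVec j := by rw [neg_smul, sub_eq_add_neg]
      rw [e, add_smul_unitVec_apply]
      split_ifs
      · have := abs_sub_abs_le_abs_sub (y k) s
        rw [← sub_eq_add_neg]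
        linarith
      · linarith
    simp [potential, potentialS, potentialJ, h1, h2, h3, ha y hk', hb y hk']

end Potential

/-! ### The divergence-free extension on a patch -/

namespace GraphChart

variable {n : ℕ} (c : GraphChart n)

/-- The half side of the cube that carries the data. -/
noncomputable def cubeRadius : ℝ := c.radius / (4 * n)

/-- The auxiliary functions used on a patch: the density `θ`, the cutoff `χ` in the height, and a
continuous extension of the slope `Dh` from the ball `{|y| < radius}` to the whole space. -/
structure Cutoffs where
  θ : C(ℝ, ℝ)
  isUnitBump : IsUnitBump c.cubeRadius θ
  χ : ℝ → ℝ
  isHeightCutoff : IsHeightCutoff c.height χ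
  slope : C(Euc (n - 1), Euc (n - 1) →L[ℝ] ℝ)
  slope_eq : ∀ y, ‖y‖ < c.radius → slope y = fderiv ℝ c.h y

theorem cubeRadius_pos (hn : 1 ≤ n) : 0 < c.cubeRadius := by
  have := c.radius_pos
  have : (0 : ℝ) < n := by exact_mod_cast hn
  unfold cubeRadius
  positivity

theorem cubeRadius_le (hn : 1 ≤ n) : c.cubeRadius ≤ c.radius / 4 := by
  have := c.radius_pos
  have : (1 : ℝ) ≤ n := by exact_mod_cast hn
  unfold cubeRadius
  gcongr
  linarith

theorem IsPatch.nonempty_cutoffs {c : GraphChart n} {Ω : Set (Euc n)} {δ : ℝ} {p : Euc n}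
    (hc : c.IsPatch Ω δ p) (hn : 1 ≤ n) : Nonempty c.Cutoffs := by
  obtain ⟨θ, hθ⟩ := exists_isUnitBump (c.cubeRadius_pos hn)
  obtain ⟨χ, hχ⟩ := exists_isHeightCutoff c.height_pos
  have hr := c.radius_pos
  let b : ContDiffBump (0 : Euc (n - 1)) := ⟨c.radius, 3 / 2 * c.radius, hr, by linarith⟩
  have hcont : Continuous fun y => b y • fderiv ℝ c.h y := by
    rw [continuous_iff_continuousAt]
    intro y
    by_cases hy : ‖y‖ < 2 * c.radius
    · have hy' : y ∈ Metric.ball (0 : Euc (n - 1)) (2 * c.radius) := by simpa using hy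
      exact b.continuous.continuousAt.smul ((hc.contDiffOn.contDiffAt
        (Metric.isOpen_ball.mem_nhds hy')).continuousAt_fderiv (by norm_num))
    · have : (fun y => b y • fderiv ℝ c.h y) =ᶠ[𝓝 y] fun _ => 0 := by
        have : 3 / 2 * c.radius < ‖y‖ := by linarith
        filter_upwards [(isOpen_lt continuous_const continuous_norm).mem_nhds this] with z hz
        rw [b.zero_of_le_dist (by simpa using (le_of_lt hz)), zero_smul]
      exact continuousAt_const.congr this.symm
  exact ⟨⟨θ, hθ, χ, hχ, ⟨_, hcont⟩, fun y hy => by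
    simp [b.one_of_mem_closedBall (show y ∈ Metric.closedBall 0 c.radius by simpa using hy.le)]⟩⟩

theorem norm_lt_radius (hn : 1 ≤ n) {y : Euc (n - 1)} (hy : ∀ k, |y k| ≤ 2 * c.cubeRadius) :
    ‖y‖ < c.radius := by
  have hr := c.radius_pos
  have hn' : (1 : ℝ) ≤ n := by exact_mod_cast hn
  have h1 : ‖y‖ ^ 2 ≤ (c.radius / 2) ^ 2 := by
    rw [EuclideanSpace.norm_sq_eq]
    calc ∑ k, ‖y k‖ ^ 2 ≤ ∑ _k : Fin (n - 1), (2 * c.cubeRadius) ^ 2 := by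
          refine Finset.sum_le_sum fun k _ => ?_
          exact pow_le_pow_left₀ (norm_nonneg _) (hy k) 2
      _ = (n - 1 : ℕ) * (2 * c.cubeRadius) ^ 2 := by simp
      _ ≤ (n * n) * (2 * c.cubeRadius) ^ 2 := by
        gcongr
        have : ((n - 1 : ℕ) : ℝ) ≤ n := by exact_mod_cast Nat.sub_le n 1
        nlinarith
      _ = (c.radius / 2) ^ 2 := by
        unfold cubeRadius
        field_simp
        ring
  have h2 := (pow_le_pow_iff_left₀ (norm_nonneg y) (by positivity) two_ne_zero).1 h1
  linarith

/-- The compact subset `{|y_k| ≤ 2 cubeRadius, |t - h y| ≤ height / 2}` of the tube that carries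
the extended fields. -/
def core : Set (Euc n) :=
  {x | (∀ k, |c.Y x k| ≤ 2 * c.cubeRadius) ∧ |c.σ x| ≤ c.height / 2}

theorem core_subset_tube (hn : 1 ≤ n) : c.core ⊆ c.tube c.radius := fun x hx =>
  ⟨c.norm_lt_radius hn hx.1, by linarith [hx.2, c.height_pos]⟩

theorem IsPatch.isCompact_core {c : GraphChart n} {Ω : Set (Euc n)} {δ : ℝ} {p : Euc n}
    (hc : c.IsPatch Ω δ p) (hn : 1 ≤ n) : IsCompact c.core := by
  set R := c.cubeRadius
  let Q : Set (Euc (n - 1)) := (EuclideanSpace.equiv (Fin (n - 1)) ℝ).symm ''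
    (Set.univ.pi fun _ => Set.Icc (-(2 * R)) (2 * R))
  have hQ : IsCompact Q := (isCompact_univ_pi fun _ => isCompact_Icc).image
    (EuclideanSpace.equiv (Fin (n - 1)) ℝ).symm.continuous
  have hQmem : ∀ y : Euc (n - 1), y ∈ Q ↔ ∀ k, |y k| ≤ 2 * R := by
    intro y
    constructor
    · rintro ⟨z, hz, rfl⟩ k
      exact abs_le.2 (hz k (Set.mem_univ k))
    · intro h
      exact ⟨fun k => y k, fun k _ => abs_le.1 (h k), by ext k; simp⟩
  have hcont : ContinuousOn (fun z : Euc (n - 1) × ℝ => c.point z.1 (c.h z.1 + z.2))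
      (Q ×ˢ Set.Icc (-(c.height / 2)) (c.height / 2)) := by
    have h1 : ContinuousOn (fun z : Euc (n - 1) × ℝ => c.h z.1)
        (Q ×ˢ Set.Icc (-(c.height / 2)) (c.height / 2)) := by
      refine hc.continuousOn.comp continuousOn_fst fun z hz => ?_
      have := c.norm_lt_radius hn ((hQmem _).1 hz.1)
      simp only [mem_ball_zero_iff]
      linarith [c.radius_pos]
    unfold point
    fun_prop
  convert (hQ.prod isCompact_Icc).image_of_continuousOn hcont using 1
  ext x
  constructor
  · intro hx
    exact ⟨(c.Y x, c.σ x), ⟨(hQmem _).2 hx.1, abs_le.1 hx.2⟩, c.point_Y_σ hn x⟩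
  · rintro ⟨z, ⟨h1, h2⟩, rfl⟩
    refine ⟨?_, ?_⟩
    · simpa using (hQmem _).1 h1
    · simpa [σ] using abs_le.2 h2

variable {c} (κ : c.Cutoffs)

namespace Cutoffs

/-- The `j`-th tangential coordinate of data given on the graph. -/
noncomputable def tangential (c : GraphChart n) (j : Fin (n - 1)) :
    C(Euc (n - 1), Euc n) →ₗ[ℝ] C(Euc (n - 1), ℝ) where
  toFun f := ⟨fun y => c.yL (f y) j, by fun_prop⟩
  map_add' f g := by ext y; simp
  map_smul' r f := by ext y; simp

/-- The flux density `f · (-Dh, 1)` of data given on the graph, through the graph into `Ω`, with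
respect to Lebesgue measure in `y`. -/
noncomputable def fluxDensity : C(Euc (n - 1), Euc n) →ₗ[ℝ] C(Euc (n - 1), ℝ) where
  toFun f := ⟨fun y => c.tL (f y) - κ.slope y (c.yL (f y)), by fun_prop⟩
  map_add' f g := by
    ext y
    simp
    ring
  map_smul' r f := by
    ext y
    simp
    ring

/-- The part of the flux density that is to be compensated in direction `e_j`. -/
noncomputable def defect (j : Fin (n - 1)) : C(Euc (n - 1), Euc n) →ₗ[ℝ] C(Euc (n - 1), ℝ) :=
  averageDefect c.cubeRadius κ.θ j ∘ₗ κ.fluxDensity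

/-- The `s`-derivative of the `j`-th potential, as a function on `ℝⁿ`. -/
noncomputable def fieldS (f : C(Euc (n - 1), Euc n)) (j : Fin (n - 1)) (x : Euc n) : ℝ :=
  potentialS (2 * c.radius) κ.χ j (tangential c j f) (κ.defect j f) (c.Y x) (c.σ x)

/-- The `e_j`-derivative of the `j`-th potential in flattened coordinates, as a function on `ℝⁿ`. -/
noncomputable def fieldJ (f : C(Euc (n - 1), Euc n)) (j : Fin (n - 1)) (x : Euc n) : ℝ :=
  potentialJ κ.χ j (tangential c j f) (κ.defect j f) (c.Y x) (c.σ x)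

open Classical in
/-- The extension of data `f` given on the graph (in the coordinate `y`) to a divergence-free field
on `ℝⁿ`: the sum over `j` of the fields `(∂_t B) E_j - (∂_j B) dir`, where `E_j` and `dir` are the
coordinate directions and `B` is the `j`-th potential, extended by zero outside the tube. -/
noncomputable def extend (f : C(Euc (n - 1), Euc n)) (x : Euc n) : Euc n :=
  if x ∈ c.tube c.radius then
    ∑ j, (κ.fieldS f j x • c.frame (unitVec j) -
      (κ.fieldJ f j x - κ.slope (c.Y x) (unitVec j) * κ.fieldS f j x) • c.dir)
  else 0

/-- The flux of data given on the graph. -/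
noncomputable def flux (f : C(Euc (n - 1), Euc n)) : ℝ := ∫ y, κ.fluxDensity f y

/-- The boundary field `θ(y₁) ⋯ θ(yₘ) dir` of flux one. -/
noncomputable def unitFlux (y : Euc (n - 1)) : Euc n := cubeDensity κ.θ y • c.dir

open Classical in
/-- The boundary field of flux one, as a function on `ℝⁿ` of which only the values on the graph
matter. -/
noncomputable def unitFluxField (x : Euc n) : Euc n :=
  if x ∈ c.tube c.radius then κ.unitFlux (c.Y x) else 0

variable {κ} {f g : C(Euc (n - 1), Euc n)}

theorem fluxDensity_apply (f : C(Euc (n - 1), Euc n)) (y : Euc (n - 1)) :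
    κ.fluxDensity f y = c.tL (f y) - κ.slope y (c.yL (f y)) := rfl

theorem supported_tangential (hf : SupportedInCube c.cubeRadius f) (j : Fin (n - 1)) :
    SupportedInCube c.cubeRadius (tangential c j f) := fun y hy => by
  simp [tangential, hf y hy]

theorem supported_fluxDensity (hf : SupportedInCube c.cubeRadius f) :
    SupportedInCube c.cubeRadius (κ.fluxDensity f) := fun y hy => by
  simp [fluxDensity_apply, hf y hy]

theorem supported_defect (hf : SupportedInCube c.cubeRadius f) (j : Fin (n - 1)) :
    SupportedInCube c.cubeRadius (κ.defect j f) :=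
  (supported_fluxDensity hf).averageDefect κ.isUnitBump j

theorem extend_of_mem {x : Euc n} (hx : x ∈ c.tube c.radius) : κ.extend f x =
    ∑ j, (κ.fieldS f j x • c.frame (unitVec j) -
      (κ.fieldJ f j x - κ.slope (c.Y x) (unitVec j) * κ.fieldS f j x) • c.dir) := if_pos hx

theorem extend_add (f g : C(Euc (n - 1), Euc n)) :
    κ.extend (f + g) = κ.extend f + κ.extend g := by
  ext1 x
  by_cases hx : x ∈ c.tube c.radius
  · simp only [Pi.add_apply, extend_of_mem hx, ← Finset.sum_add_distrib]
    refine Finset.sum_congr rfl fun j _ => ?_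
    simp only [fieldS, fieldJ, potentialS, potentialJ, map_add, ContinuousMap.add_apply]
    module
  · simp [extend, hx]

theorem extend_smul (r : ℝ) (f : C(Euc (n - 1), Euc n)) : κ.extend (r • f) = r • κ.extend f := by
  ext1 x
  by_cases hx : x ∈ c.tube c.radius
  · simp only [Pi.smul_apply, extend_of_mem hx, Finset.smul_sum]
    refine Finset.sum_congr rfl fun j _ => ?_
    simp only [fieldS, fieldJ, potentialS, potentialJ, map_smul, ContinuousMap.smul_apply,
      smul_eq_mul]
    module
  · simp [extend, hx]

theorem flux_add (hf : SupportedInCube c.cubeRadius f) (hg : SupportedInCube c.cubeRadius g) :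
    κ.flux (f + g) = κ.flux f + κ.flux g := by
  have hi : ∀ {f : C(Euc (n - 1), Euc n)}, SupportedInCube c.cubeRadius f →
      Integrable (κ.fluxDensity f) := fun {f} hf => by
    refine (κ.fluxDensity f).continuous.integrable_of_hasCompactSupport (HasCompactSupport.intro
      ((isCompact_univ_pi fun _ => isCompact_Icc (a := -c.cubeRadius) (b := c.cubeRadius)).image
        (EuclideanSpace.equiv (Fin (n - 1)) ℝ).symm.continuous) fun y hy => ?_)
    refine supported_fluxDensity hf y ?_
    by_contra! h
    exact hy ⟨fun k => y k, fun k _ => ⟨(abs_lt.1 (h k)).1.le, (abs_lt.1 (h k)).2.le⟩,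
      by ext k; simp⟩
  simp only [flux, map_add, ContinuousMap.add_apply]
  exact integral_add (hi hf) (hi hg)

theorem flux_smul (r : ℝ) (f : C(Euc (n - 1), Euc n)) : κ.flux (r • f) = r * κ.flux f := by
  simp only [flux, map_smul, ContinuousMap.smul_apply, smul_eq_mul]
  exact integral_const_mul _ _

/-- The boundary values of the extension: the data, up to a multiple of the field of unit flux. -/
theorem extend_graph (hn : 1 ≤ n) (hf : SupportedInCube c.cubeRadius f) {y : Euc (n - 1)}
    (hy : ‖y‖ < c.radius) : κ.extend f (c.graph y) = f y - κ.flux f • κ.unitFlux y := by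
  have hmem : c.graph y ∈ c.tube c.radius := by simpa [tube, c.height_pos] using hy
  rw [extend_of_mem hmem]
  simp only [fieldS, fieldJ, Y_graph, σ_graph, potentialS_zero κ.isHeightCutoff,
    potentialJ_zero κ.isHeightCutoff]
  have hsum : c.yL (f y) = ∑ j, tangential c j f y • unitVec j := by
    ext k
    simp [tangential, unitVec, Pi.single_apply]
  have h1 : ∑ j, tangential c j f y • c.frame (unitVec j) = c.frame (c.yL (f y)) := by
    rw [hsum]
    simp only [map_sum, map_smul]
  have h2 : ∑ j, κ.slope y (unitVec j) * tangential c j f y = κ.slope y (c.yL (f y)) := by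
    rw [hsum]
    simp only [map_sum, map_smul, smul_eq_mul, mul_comm]
  have h3 : ∑ j, κ.defect j f y = κ.fluxDensity f y - κ.flux f * cubeDensity κ.θ y := by
    have := sum_averageDefect (R := c.cubeRadius) (θ := κ.θ) (κ.fluxDensity f) y
    rw [iterAverage_eq κ.isUnitBump (supported_fluxDensity hf)] at this
    exact this
  rw [Finset.sum_sub_distrib, ← Finset.sum_smul, h1, Finset.sum_sub_distrib, h2,
    Finset.sum_neg_distrib, h3, fluxDensity_apply, unitFlux, smul_smul]
  conv_rhs => rw [← c.frame_add_dir hn (f y)]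
  module

/-- The assumptions of `potential_eq_zero` and `hasDerivAt_potential` hold in the tube. -/
theorem apply_sub_lt (hn : 1 ≤ n) {y : Euc (n - 1)} (hy : ‖y‖ < c.radius) (j : Fin (n - 1)) :
    y j - 2 * c.radius < -(2 * c.cubeRadius) := by
  have h1 := (le_abs_self _).trans (PiLp.norm_apply_le y j)
  linarith [c.cubeRadius_le hn, c.radius_pos]

end Cutoffs

end GraphChart

namespace GraphChart.IsPatch

open Cutoffs

variable {n : ℕ} {c : GraphChart n} {Ω : Set (Euc n)} {δ : ℝ} {p : Euc n} {κ : c.Cutoffs}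
  {f : C(Euc (n - 1), Euc n)}

theorem potential_eq_zero_of_notMem_core (hc : c.IsPatch Ω δ p) (hn : 1 ≤ n)
    (hf : SupportedInCube c.cubeRadius f) {x : Euc n} (hx : x ∈ c.tube c.radius)
    (hxK : x ∉ c.core) (j : Fin (n - 1)) :
    potential (2 * c.radius) κ.χ j (tangential c j f) (κ.defect j f) (c.Y x) (c.σ x) = 0 ∧
      κ.fieldS f j x = 0 ∧ κ.fieldJ f j x = 0 := by
  have hr := c.radius_pos
  have hR := c.cubeRadius_pos hn
  refine potential_eq_zero κ.isHeightCutoff c.height_pos (supported_tangential hf j)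
    (supported_defect hf j) hc.height_le (by linarith) (apply_sub_lt hn hx.1 j) (fun hk => ?_) ?_
  · exact lineIntegral_averageDefect_eq_zero κ.isUnitBump (supported_fluxDensity hf) j (by linarith)
      (by linarith [apply_sub_lt hn hx.1 j]) hk
  · by_contra! h
    exact hxK ⟨fun k => (h.1 k).le, h.2.le⟩

theorem extend_eq_zero (hc : c.IsPatch Ω δ p) (hn : 1 ≤ n)
    (hf : SupportedInCube c.cubeRadius f) {x : Euc n} (hxK : x ∉ c.core) : κ.extend f x = 0 := by
  by_cases hx : x ∈ c.tube c.radius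
  · rw [extend_of_mem hx]
    refine Finset.sum_eq_zero fun j _ => ?_
    obtain ⟨-, h1, h2⟩ := hc.potential_eq_zero_of_notMem_core (κ := κ) hn hf hx hxK j
    simp [h1, h2]
  · simp [Cutoffs.extend, hx]

variable {l J : ℕ} {α : ℝ≥0} {e : Fin J → GraphChart n} {ι : Type} {N : ι → ℝ}
  {F : ι → C(Euc (n - 1), Euc n)}

theorem unifCHolder_comp_Y (hα : α ≤ 1) {W : Type} [NormedAddCommGroup W] [NormedSpace ℝ W]
    (hc : c.IsPatch Ω δ p) (hN : ∀ i, 0 ≤ N i) {G : ι → Euc (n - 1) → W}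
    (hG : UnifCHolder l α (Metric.ball 0 c.radius) N G) :
    UnifCHolder l α (c.tube c.radius) N fun i x => G i (c.Y x) := by
  have hO : IsOpen (c.tube c.radius) := hc.isOpen_tube (by linarith [c.radius_pos])
  have e : ∀ x, c.Y x = c.yL x + -c.yL c.center := fun x => by
    rw [Y, map_sub, sub_eq_add_neg]
  simp only [e]
  refine UnifCHolder.comp_clm hO Metric.isOpen_ball hα hN c.yL _ (fun x hx => ?_) hG
  change c.yL x + -c.yL c.center ∈ _
  rw [← e]
  simpa using hx.1

/-- The maps `x ↦ A (Y x) + σ x v`, through which the extension depends on the data, have the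
regularity of the boundary; composition with them preserves the class `C^{l,α}`. -/
theorem unifCHolder_comp_flatten (hc : c.IsPatch Ω δ p) (hn : 1 ≤ n) (hΩ : IsOpen Ω) (hα : α ≤ 1)
    (he : IsBoundaryAtlas e Ω (l + 1) α) {V W : Type} [NormedAddCommGroup V] [NormedSpace ℝ V]
    [NormedAddCommGroup W] [NormedSpace ℝ W] (hN : ∀ i, 0 ≤ N i) (A : Euc (n - 1) →L[ℝ] V) (v : V)
    {G : ι → V → W} (hG : UnifCHolder l α Set.univ N G) :
    UnifCHolder l α (c.tube c.radius) N fun i x => G i (A (c.Y x) + c.σ x • v) := by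
  have hr := c.radius_pos
  have hO : IsOpen (c.tube c.radius) := hc.isOpen_tube (by linarith)
  have hD := hc.unifCHolder_fderiv hn hΩ hα he
  have hσd : ∀ x ∈ c.tube c.radius, HasFDerivAt (fun x => A (c.Y x) + c.σ x • v)
      (A ∘L c.yL + (c.tL - (fderiv ℝ c.h (c.Y x)) ∘L c.yL).smulRight v) x := by
    intro x hx
    have hY := c.hasFDerivAt_Y x
    have hT := c.hasFDerivAt_T x
    have hh := (hc.differentiableAt (y := c.Y x) (by linarith [hx.1])).hasFDerivAt
    exact (A.hasFDerivAt.comp x hY).add ((hT.sub (hh.comp x hY)).smul_const v)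
  have hlip : ∃ K, ∀ x ∈ c.tube c.radius, ∀ x' ∈ c.tube c.radius,
      ‖(A (c.Y x) + c.σ x • v) - (A (c.Y x') + c.σ x' • v)‖ ≤ K * ‖x - x'‖ := by
    obtain ⟨C, hC, hD⟩ := hD
    have hb := (hD ()).holderBound.norm_le
    refine ⟨‖A‖ + (1 + C) * ‖v‖, fun x hx x' hx' => ?_⟩
    have h1 : ‖c.Y x - c.Y x'‖ ≤ ‖x - x'‖ := by
      have := c.norm_yL_le (x - x')
      rwa [Y, Y, ← map_sub, sub_sub_sub_cancel_right]
    have h2 : ‖c.T x - c.T x'‖ ≤ ‖x - x'‖ := by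
      have := c.norm_tL_le (x - x')
      rwa [T, T, ← map_sub, sub_sub_sub_cancel_right]
    have h3 : ‖c.h (c.Y x) - c.h (c.Y x')‖ ≤ C * ‖c.Y x - c.Y x'‖ := by
      refine (convex_ball (0 : Euc (n - 1)) c.radius).norm_image_sub_le_of_norm_fderiv_le (𝕜 := ℝ)
        (fun w hw => hc.differentiableAt ?_) (fun w hw => by simpa using hb w hw)
        (by simpa using hx'.1) (by simpa using hx.1)
      have : ‖w‖ < c.radius := by simpa using hw
      linarith
    have h4 : ‖c.σ x - c.σ x'‖ ≤ (1 + C) * ‖x - x'‖ := by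
      have : c.σ x - c.σ x' = (c.T x - c.T x') - (c.h (c.Y x) - c.h (c.Y x')) := by
        rw [σ, σ]
        ring
      rw [this]
      calc _ ≤ ‖c.T x - c.T x'‖ + ‖c.h (c.Y x) - c.h (c.Y x')‖ := norm_sub_le _ _
        _ ≤ ‖x - x'‖ + C * ‖x - x'‖ := add_le_add h2 (h3.trans (by gcongr))
        _ = _ := by ring
    have : (A (c.Y x) + c.σ x • v) - (A (c.Y x') + c.σ x' • v) =
        A (c.Y x - c.Y x') + (c.σ x - c.σ x') • v := by
      rw [map_sub, sub_smul]
      abel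
    rw [this]
    calc _ ≤ ‖A (c.Y x - c.Y x')‖ + ‖(c.σ x - c.σ x') • v‖ := norm_add_le _ _
      _ ≤ ‖A‖ * ‖x - x'‖ + ((1 + C) * ‖x - x'‖) * ‖v‖ := by
        rw [norm_smul]
        gcongr
        exact (A.le_opNorm _).trans (by gcongr)
      _ = _ := by ring
  obtain ⟨K, hK⟩ := hlip
  refine UnifCHolder.comp hO isOpen_univ hα hN (Set.mapsTo_univ _ _) hK
    (fun _ x hx => (hσd x hx).differentiableAt.differentiableWithinAt) (fun j hj => ?_) hG
  have h1 : UnifCHolder j α (c.tube c.radius) (fun _ : Unit => 1)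
      fun _ x => fderiv ℝ c.h (c.Y x) :=
    hc.unifCHolder_comp_Y hα (fun _ => zero_le_one) (hD.of_le hj.le)
  have pos : ∀ _ : Unit, (0 : ℝ) ≤ 1 := fun _ => zero_le_one
  have h2 := h1.clm_comp hO pos
    ((ContinuousLinearMap.compL ℝ (Euc n) (Euc (n - 1)) ℝ).flip c.yL)
  have h3 := ((UnifCHolder.const hO c.tL).sub hO pos h2).clm_comp hO pos
    ((ContinuousLinearMap.smulRightL ℝ (Euc n) V).flip v)
  exact ((UnifCHolder.const hO (A ∘L c.yL)).add hO h3).congr hO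
    fun _ x hx => (hσd x hx).fderiv.symm

/-- The extension is as regular as the data, without loss of a derivative: its coefficients involve
only the data, their line integrals, and `Dh`. -/
theorem unifCHolder_extend (hc : c.IsPatch Ω δ p) (hn : 1 ≤ n) (hΩ : IsOpen Ω) (hα : α ≤ 1)
    (he : IsBoundaryAtlas e Ω (l + 1) α) (hN : ∀ i, 0 ≤ N i)
    (hsupp : ∀ i, SupportedInCube c.cubeRadius (F i))
    (hF : UnifCHolder l α Set.univ N fun i => ⇑(F i)) :
    UnifCHolder l α Set.univ N fun i => κ.extend (F i) := by
  have hr := c.radius_pos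
  have hO : IsOpen (c.tube c.radius) := hc.isOpen_tube (by linarith)
  have hR := c.cubeRadius_pos hn
  refine UnifCHolder.of_support (hc.isCompact_core hn) hO (c.core_subset_tube hn) hN
    (fun i x hx => hc.extend_eq_zero hn (hsupp i) hx) ?_
  have hslope : ∀ (ι : Type), UnifCHolder l α (Metric.ball 0 c.radius) (fun _ : ι => 1)
      fun _ => ⇑κ.slope := fun ι => by
    obtain ⟨C, hC, hD⟩ := hc.unifCHolder_fderiv hn hΩ hα he
    refine UnifCHolder.of_const hC (CHolder.congr Metric.isOpen_ball (by simpa using hD ()) ?_)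
    exact fun y hy => (κ.slope_eq y (by simpa using hy)).symm
  have hslopeY : ∀ j : Fin (n - 1), UnifCHolder l α (c.tube c.radius) (fun _ : ι => 1)
      fun _ x => κ.slope (c.Y x) (unitVec j) := fun j =>
    (hc.unifCHolder_comp_Y hα (fun _ => zero_le_one) (hslope ι)).clm_comp hO (fun _ => zero_le_one)
      (ContinuousLinearMap.apply ℝ ℝ (unitVec j))
  have htan : ∀ j : Fin (n - 1), UnifCHolder l α Set.univ N fun i => ⇑(tangential c j (F i)) :=
    fun j => hF.clm_comp isOpen_univ hN ((EuclideanSpace.proj j : Euc (n - 1) →L[ℝ] ℝ) ∘L c.yL)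
  have hflux : UnifCHolder l α Set.univ N fun i => ⇑(κ.fluxDensity (F i)) := by
    refine UnifCHolder.of_support (O := Metric.ball 0 c.radius)
      (K := Metric.closedBall 0 (c.radius / 2)) (isCompact_closedBall _ _) Metric.isOpen_ball
      (Metric.closedBall_subset_ball (by linarith)) hN (fun i y hy => ?_) ?_
    · refine supported_fluxDensity (hsupp i) y ?_
      by_contra! h
      refine hy ?_
      rw [mem_closedBall_zero_iff]
      have h1 : ‖(2 : ℝ) • y‖ < c.radius := c.norm_lt_radius hn fun k => by
        simp only [PiLp.smul_apply, smul_eq_mul, abs_mul, abs_two]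
        linarith [h k]
      rw [norm_smul, Real.norm_eq_abs, abs_two] at h1
      linarith
    · have hF' := hF.mono_set (Set.subset_univ (Metric.ball (0 : Euc (n - 1)) c.radius))
      have h1 := hF'.clm_comp Metric.isOpen_ball hN c.tL
      have h2 := hF'.clm_comp Metric.isOpen_ball hN c.yL
      have h3 := UnifCHolder.bilin Metric.isOpen_ball
        (ContinuousLinearMap.id ℝ (Euc (n - 1) →L[ℝ] ℝ)) (fun _ => zero_le_one) hN (hslope ι) h2
      simp only [one_mul] at h3
      exact h1.sub Metric.isOpen_ball hN h3
  have hdef : ∀ j : Fin (n - 1), UnifCHolder l α Set.univ N fun i => ⇑(κ.defect j (F i)) :=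
    fun j => hflux.averageDefect hR.le hα hN κ.isUnitBump j
  -- the building blocks of the potentials
  have hpt : ∀ {G : ι → C(Euc (n - 1), ℝ)}, UnifCHolder l α Set.univ N (fun i => ⇑(G i)) →
      UnifCHolder l α (c.tube c.radius) N fun i x => G i (c.Y x) := fun hG =>
    hc.unifCHolder_comp_Y hα hN (hG.mono_set (Set.subset_univ _))
  have hsh : ∀ (j : Fin (n - 1)) {G : ι → C(Euc (n - 1), ℝ)},
      UnifCHolder l α Set.univ N (fun i => ⇑(G i)) →
      UnifCHolder l α (c.tube c.radius) N fun i x => G i (c.Y x - c.σ x • unitVec j) := by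
    intro j G hG
    refine (hc.unifCHolder_comp_flatten hn hΩ hα he hN (ContinuousLinearMap.id ℝ _)
      (-unitVec j) hG).congr hO fun i x _ => ?_
    simp [sub_eq_add_neg]
  have hχ : ∀ {q : ℝ → ℝ}, ContDiff ℝ ∞ q → HasCompactSupport q →
      UnifCHolder l α (c.tube c.radius) (fun _ : ι => 1) fun _ x => q (c.σ x) := by
    intro q hq hq'
    refine (hc.unifCHolder_comp_flatten hn hΩ hα he (fun _ => zero_le_one) 0 (1 : ℝ)
      (UnifCHolder.of_hasCompactSupport hα hq hq')).congr hO fun i x _ => ?_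
    simp
  have hχ0 := hχ κ.isHeightCutoff.contDiff κ.isHeightCutoff.hasCompactSupport
  have hχ1 := hχ (q := deriv κ.χ) (by
    have := κ.isHeightCutoff.contDiff
    exact ((contDiff_infty_iff_deriv (𝕜 := ℝ)).1 this).2)
    κ.isHeightCutoff.hasCompactSupport.deriv
  have hS : ∀ j, UnifCHolder l α (c.tube c.radius) N fun i x => κ.fieldS (F i) j x := by
    intro j
    have hI := (htan j).lineIntegral (a := -(2 * c.radius)) (b := 0) (by linarith) j
    have hI' := (hdef j).lineIntegral (a := -(2 * c.radius)) (b := 0) (by linarith) j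
    have h1 := ((hpt hI).sub hO hN (hsh j hI)).sub hO hN (hpt hI')
    exact (UnifCHolder.mul_fixed hO hN hχ1 h1).add hO
      (UnifCHolder.mul_fixed hO hN hχ0 (hsh j (htan j)))
  have hJ : ∀ j, UnifCHolder l α (c.tube c.radius) N fun i x => κ.fieldJ (F i) j x := fun j =>
    UnifCHolder.mul_fixed hO hN hχ0
      (((hpt (htan j)).sub hO hN (hsh j (htan j))).sub hO hN (hpt (hdef j)))
  have hsum := UnifCHolder.sum hO hN Finset.univ fun j _ =>
    ((hS j).smul_const hO hN (c.frame (unitVec j))).sub hO hN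
      (((hJ j).sub hO hN (UnifCHolder.mul_fixed hO hN (hslopeY j) (hS j))).smul_const hO hN c.dir)
  exact hsum.congr hO fun i x hx => (extend_of_mem hx).symm

end GraphChart.IsPatch

/-! ### Weakly divergence-free fields -/

section Solenoidal

variable {n : ℕ}

/-- `v` is a continuous field on `ℝⁿ` which is divergence-free in the sense of distributions. -/
def WeaklySolenoidal (v : Euc n → Euc n) : Prop :=
  Continuous v ∧ ∀ φ : Euc n → ℝ, ContDiff ℝ ∞ φ → HasCompactSupport φ →
    ∫ x, fderiv ℝ φ x (v x) = 0

theorem integrable_fderiv_apply {φ : Euc n → ℝ} (hφ : ContDiff ℝ ∞ φ) (hφc : HasCompactSupport φ)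
    {v : Euc n → Euc n} (hv : Continuous v) : Integrable fun x => fderiv ℝ φ x (v x) := by
  refine Continuous.integrable_of_hasCompactSupport
    ((hφ.continuous_fderiv (by simp)).clm_apply hv) ?_
  refine (hφc.fderiv (𝕜 := ℝ)).mono' fun x hx => subset_tsupport _ fun h => hx ?_
  simp [h]

theorem WeaklySolenoidal.add {v w : Euc n → Euc n} (hv : WeaklySolenoidal v)
    (hw : WeaklySolenoidal w) : WeaklySolenoidal (v + w) := by
  refine ⟨hv.1.add hw.1, fun φ hφ hφc => ?_⟩
  simp only [Pi.add_apply, map_add]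
  rw [integral_add (integrable_fderiv_apply hφ hφc hv.1) (integrable_fderiv_apply hφ hφc hw.1),
    hv.2 φ hφ hφc, hw.2 φ hφ hφc, add_zero]

theorem WeaklySolenoidal.smul {v : Euc n → Euc n} (hv : WeaklySolenoidal v) (r : ℝ) :
    WeaklySolenoidal (r • v) := by
  refine ⟨hv.1.const_smul r, fun φ hφ hφc => ?_⟩
  simp only [Pi.smul_apply, map_smul, smul_eq_mul]
  rw [integral_const_mul, hv.2 φ hφ hφc, mul_zero]

theorem WeaklySolenoidal.zero : WeaklySolenoidal (0 : Euc n → Euc n) :=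
  ⟨continuous_const, fun φ _ _ => by simp⟩

theorem WeaklySolenoidal.sum {ι : Type*} {s : Finset ι} {v : ι → Euc n → Euc n}
    (h : ∀ i ∈ s, WeaklySolenoidal (v i)) : WeaklySolenoidal (∑ i ∈ s, v i) := by
  classical
  induction s using Finset.induction_on with
  | empty => simpa using WeaklySolenoidal.zero
  | insert i s hi ih =>
    rw [Finset.sum_insert hi]
    exact (h i (Finset.mem_insert_self _ _)).add (ih fun j hj => h j (Finset.mem_insert_of_mem hj))

theorem WeaklySolenoidal.weaklyDivergenceFree {v : Euc n → Euc n} (hv : WeaklySolenoidal v)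
    (Ω : Set (Euc n)) : WeaklyDivergenceFree Ω v := by
  intro φ hφ hφc hφΩ
  rw [setIntegral_eq_integral_of_forall_compl_eq_zero fun x hx => ?_]
  · exact hv.2 φ hφ hφc
  · have : fderiv ℝ φ x = 0 := by
      by_contra h
      exact hx (hφΩ (support_fderiv_subset ℝ h))
    simp [this]

/-- For a `C¹` field the divergence vanishes pointwise. -/
theorem WeaklySolenoidal.divergence_eq_zero {v : Euc n → Euc n} (hv : WeaklySolenoidal v)
    (hd : ContDiff ℝ 1 v) (x : Euc n) : divergence v x = 0 := by
  have hcont : Continuous (divergence v) := by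
    have := hd.continuous_fderiv (by norm_num)
    unfold divergence
    fun_prop
  have hcomp : ∀ i, Differentiable ℝ fun x => v x i := fun i x => by
    have := (hd.differentiable (by norm_num)) x
    exact (EuclideanSpace.proj i : Euc n →L[ℝ] ℝ).differentiableAt.comp x this
  have hcompd : ∀ i x w, fderiv ℝ (fun x => v x i) x w = fderiv ℝ v x w i := fun i x w => by
    have h1 := (hd.differentiable (by norm_num) x).hasFDerivAt
    have h2 := ((EuclideanSpace.proj i : Euc n →L[ℝ] ℝ).hasFDerivAt.comp x h1).fderiv
    change fderiv ℝ ((EuclideanSpace.proj i : Euc n →L[ℝ] ℝ) ∘ v) x w = _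
    rw [h2]
    rfl
  have key : ∀ φ : Euc n → ℝ, ContDiff ℝ ∞ φ → HasCompactSupport φ →
      ∫ x, φ x • divergence v x = 0 := by
    intro φ hφ hφc
    have hφd : ∀ w : Euc n, Continuous fun x => fderiv ℝ φ x w := fun w =>
      (hφ.continuous_fderiv (by simp)).clm_apply continuous_const
    have hφdc : ∀ w : Euc n, HasCompactSupport fun x => fderiv ℝ φ x w := fun w =>
      (hφc.fderiv (𝕜 := ℝ)).mono' fun x hx => subset_tsupport _ fun h => hx (by simp [h])
    have hvd : ∀ i, Continuous fun x => fderiv ℝ (fun x => v x i) x (EuclideanSpace.single i 1) := by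
      intro i
      simp only [hcompd]
      have := hd.continuous_fderiv (by norm_num)
      fun_prop
    have hvi : ∀ i, Continuous fun x => v x i := fun i => (hcomp i).continuous
    have hpart : ∀ i, ∫ x, φ x * fderiv ℝ (fun x => v x i) x (EuclideanSpace.single i 1) =
        -∫ x, fderiv ℝ φ x (EuclideanSpace.single i 1) * v x i := fun i =>
      integral_mul_fderiv_eq_neg_fderiv_mul_of_integrable
        (((hφd _).mul (hvi i)).integrable_of_hasCompactSupport (hφdc _).mul_right)
        ((hφ.continuous.mul (hvd i)).integrable_of_hasCompactSupport hφc.mul_right)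
        ((hφ.continuous.mul (hvi i)).integrable_of_hasCompactSupport hφc.mul_right)
        (fun x _ => hφ.differentiable (by simp) x) (fun x _ => hcomp i x)
    have h1 : ∀ x, fderiv ℝ φ x (v x) =
        ∑ i, fderiv ℝ φ x (EuclideanSpace.single i 1) * v x i := by
      intro x
      have : v x = ∑ i, v x i • EuclideanSpace.single i (1 : ℝ) := by
        ext k
        simp [Pi.single_apply]
      conv_lhs => rw [this]
      simp only [map_sum, map_smul, smul_eq_mul, mul_comm]
    have h2 := hv.2 φ hφ hφc
    simp only [h1] at h2
    have hi1 : ∀ i, Integrable fun x => fderiv ℝ φ x (EuclideanSpace.single i 1) * v x i :=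
      fun i => ((hφd _).mul (hvi i)).integrable_of_hasCompactSupport (hφdc _).mul_right
    have hi2 : ∀ i, Integrable fun x =>
        φ x * fderiv ℝ (fun x => v x i) x (EuclideanSpace.single i 1) :=
      fun i => (hφ.continuous.mul (hvd i)).integrable_of_hasCompactSupport hφc.mul_right
    rw [integral_finsetSum _ fun i _ => hi1 i] at h2
    simp only [divergence, smul_eq_mul, Finset.mul_sum]
    simp only [← hcompd]
    rw [integral_finsetSum _ fun i _ => hi2 i]
    simp only [hpart, Finset.sum_neg_distrib, h2, neg_zero]
  have hae := ae_eq_zero_of_integral_contDiff_smul_eq_zero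
    (hcont.locallyIntegrable (μ := volume)) key
  exact congrFun (hcont.ae_eq_iff_eq volume continuous_const |>.1 hae) x

/-- The two-dimensional curl of a potential `B` with continuous derivatives in the directions `d`
and `e` is divergence-free. No derivatives of `B` in other directions are needed. -/
theorem weaklySolenoidal_of_potential {B Bd Be : Euc n → ℝ} {d e : Euc n} (hB : Continuous B)
    (hBd : Continuous Bd) (hBe : Continuous Be) (h1 : ∀ x, HasLineDerivAt ℝ B (Bd x) x d)
    (h2 : ∀ x, HasLineDerivAt ℝ B (Be x) x e) :
    WeaklySolenoidal fun x => Bd x • e - Be x • d := by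
  refine ⟨by fun_prop, fun φ hφ hφc => ?_⟩
  have hd2 : ContDiff ℝ ∞ (fderiv ℝ φ) := ((contDiff_infty_iff_fderiv (𝕜 := ℝ)).1 hφ).2
  have hφd : ∀ w : Euc n, Continuous fun x => fderiv ℝ φ x w := fun w =>
    (hφ.continuous_fderiv (by simp)).clm_apply continuous_const
  have hφdc : ∀ w : Euc n, HasCompactSupport fun x => fderiv ℝ φ x w := fun w =>
    (hφc.fderiv (𝕜 := ℝ)).mono' fun x hx => subset_tsupport _ fun h => hx (by simp [h])
  have hφ2 : ∀ w w' : Euc n, Continuous fun x => fderiv ℝ (fderiv ℝ φ) x w w' := fun w w' =>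
    ((hd2.continuous_fderiv (by simp)).clm_apply continuous_const).clm_apply continuous_const
  have hφ2c : ∀ w w' : Euc n, HasCompactSupport fun x => fderiv ℝ (fderiv ℝ φ) x w w' :=
    fun w w' => ((hφc.fderiv (𝕜 := ℝ)).fderiv (𝕜 := ℝ)).mono' fun x hx =>
      subset_tsupport _ fun h => hx (by simp [h])
  have parts : ∀ {w w' : Euc n} {Bw : Euc n → ℝ}, Continuous Bw →
      (∀ x, HasLineDerivAt ℝ B (Bw x) x w) →
      ∫ x, B x * fderiv ℝ (fderiv ℝ φ) x w w' = -∫ x, Bw x * fderiv ℝ φ x w' := by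
    intro w w' Bw hBw hw
    refine integral_bilinear_hasLineDerivAt_right_eq_neg_left_of_integrable (v := w)
      (B := ContinuousLinearMap.mul ℝ ℝ) (f := B) (f' := Bw) (g := fun x => fderiv ℝ φ x w')
      (g' := fun x => fderiv ℝ (fderiv ℝ φ) x w w') ?_ ?_ ?_ (fun x _ => hw x) (fun x _ => ?_)
    · exact (hBw.mul (hφd w')).integrable_of_hasCompactSupport (hφdc w').mul_left
    · exact (hB.mul (hφ2 w w')).integrable_of_hasCompactSupport (hφ2c w w').mul_left
    · exact (hB.mul (hφd w')).integrable_of_hasCompactSupport (hφdc w').mul_left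
    · have := (hd2.differentiable (by simp) x).hasFDerivAt.clm_apply (hasFDerivAt_const w' x)
      simpa using this.hasLineDerivAt w
  have hsym : ∀ x, fderiv ℝ (fderiv ℝ φ) x d e = fderiv ℝ (fderiv ℝ φ) x e d := fun x =>
    ((contDiff_infty.1 hφ 2).contDiffAt.isSymmSndFDerivAt (by simp)).eq d e
  have p1 := parts (w' := e) hBd h1
  have p2 := parts (w' := d) hBe h2
  simp only [hsym] at p1
  simp only [map_sub, map_smul, smul_eq_mul]
  have hi1 : Integrable fun x => Bd x * fderiv ℝ φ x e :=
    (hBd.mul (hφd e)).integrable_of_hasCompactSupport (hφdc e).mul_left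
  have hi2 : Integrable fun x => Be x * fderiv ℝ φ x d :=
    (hBe.mul (hφd d)).integrable_of_hasCompactSupport (hφdc d).mul_left
  rw [integral_sub hi1 hi2]
  linarith

theorem continuous_of_continuousOn_of_eq_zero {V W : Type*} [TopologicalSpace V]
    [TopologicalSpace W] [Zero W] {G : V → W} {K O : Set V} (hK : IsClosed K) (hO : IsOpen O)
    (hKO : K ⊆ O) (hG : ContinuousOn G O) (h0 : ∀ x ∉ K, G x = 0) : Continuous G := by
  rw [continuous_iff_continuousAt]
  intro x
  by_cases hx : x ∈ K
  · exact hG.continuousAt (hO.mem_nhds (hKO hx))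
  · refine continuousAt_const.congr (f := fun _ => (0 : W)) ?_
    filter_upwards [hK.isOpen_compl.mem_nhds hx] with z hz
    exact (h0 z hz).symm

end Solenoidal

namespace GraphChart.IsPatch

open Cutoffs

variable {n : ℕ} {c : GraphChart n} {Ω : Set (Euc n)} {δ : ℝ} {p : Euc n} {κ : c.Cutoffs}
  {f : C(Euc (n - 1), Euc n)}

theorem continuousOn_σ (hc : c.IsPatch Ω δ p) : ContinuousOn c.σ (c.tube c.radius) := by
  unfold σ
  refine c.continuous_T.continuousOn.sub (hc.continuousOn.comp c.continuous_Y.continuousOn ?_)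
  intro x hx
  have := hx.1
  simp only [mem_ball_zero_iff]
  linarith [c.radius_pos]

/-- The extension is divergence-free up to the boundary and across it: it is a sum of
two-dimensional curls. -/
theorem weaklySolenoidal_extend (hc : c.IsPatch Ω δ p) (hn : 1 ≤ n)
    (hf : SupportedInCube c.cubeRadius f) : WeaklySolenoidal (κ.extend f) := by
  have hr := c.radius_pos
  have hO : IsOpen (c.tube c.radius) := hc.isOpen_tube (by linarith)
  have hK : IsClosed c.core := (hc.isCompact_core hn).isClosed
  have hKO := c.core_subset_tube hn
  let B : Fin (n - 1) → Euc n → ℝ := fun j => (c.tube c.radius).indicator fun x =>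
    potential (2 * c.radius) κ.χ j (tangential c j f) (κ.defect j f) (c.Y x) (c.σ x)
  let Bd : Fin (n - 1) → Euc n → ℝ := fun j => (c.tube c.radius).indicator (κ.fieldS f j)
  let Be : Fin (n - 1) → Euc n → ℝ := fun j => (c.tube c.radius).indicator fun x =>
    κ.fieldJ f j x - κ.slope (c.Y x) (unitVec j) * κ.fieldS f j x
  have hvan : ∀ j x, x ∉ c.core → B j x = 0 ∧ Bd j x = 0 ∧ Be j x = 0 := by
    intro j x hxK
    by_cases hx : x ∈ c.tube c.radius
    · obtain ⟨h0, h1, h2⟩ := hc.potential_eq_zero_of_notMem_core (κ := κ) hn hf hx hxK j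
      simp [B, Bd, Be, hx, h0, h1, h2]
    · simp [B, Bd, Be, hx]
  have hpair : ContinuousOn (fun x => (c.Y x, c.σ x)) (c.tube c.radius) :=
    c.continuous_Y.continuousOn.prodMk hc.continuousOn_σ
  have hcS : ∀ j, ContinuousOn (κ.fieldS f j) (c.tube c.radius) := fun j =>
    (continuous_potentialS κ.isHeightCutoff).comp_continuousOn hpair
  have hcJ : ∀ j, ContinuousOn (κ.fieldJ f j) (c.tube c.radius) := fun j =>
    (continuous_potentialJ κ.isHeightCutoff).comp_continuousOn hpair
  have hcB : ∀ j, Continuous (B j) := fun j => by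
    refine continuous_of_continuousOn_of_eq_zero hK hO hKO (ContinuousOn.congr (f := fun x =>
      potential (2 * c.radius) κ.χ j (tangential c j f) (κ.defect j f) (c.Y x) (c.σ x)) ?_
      fun x hx => Set.indicator_of_mem hx _) fun x hx => (hvan j x hx).1
    exact (continuous_potential κ.isHeightCutoff).comp_continuousOn hpair
  have hcBd : ∀ j, Continuous (Bd j) := fun j =>
    continuous_of_continuousOn_of_eq_zero hK hO hKO ((hcS j).congr
      fun x hx => Set.indicator_of_mem hx _) fun x hx => (hvan j x hx).2.1
  have hcBe : ∀ j, Continuous (Be j) := fun j => by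
    refine continuous_of_continuousOn_of_eq_zero hK hO hKO (ContinuousOn.congr (f := fun x =>
      κ.fieldJ f j x - κ.slope (c.Y x) (unitVec j) * κ.fieldS f j x) ?_
      fun x hx => Set.indicator_of_mem hx _) fun x hx => (hvan j x hx).2.2
    have : Continuous fun x => κ.slope (c.Y x) (unitVec j) :=
      (κ.slope.continuous.comp c.continuous_Y).clm_apply continuous_const
    exact (hcJ j).sub (this.continuousOn.mul (hcS j))
  -- outside the core everything vanishes identically near the point
  have hline0 : ∀ j x, x ∉ c.core → ∀ w, HasLineDerivAt ℝ (B j) 0 x w := by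
    intro j x hx w
    have h1 : Filter.Tendsto (fun t : ℝ => x + t • w) (𝓝 0) (𝓝 x) := by
      have : Continuous fun t : ℝ => x + t • w := by fun_prop
      simpa using this.tendsto 0
    refine (hasDerivAt_const (0 : ℝ) (0 : ℝ)).congr_of_eventuallyEq ?_
    filter_upwards [h1 (hK.isOpen_compl.mem_nhds hx)] with t ht
    exact (hvan j _ ht).1
  have hin : ∀ x ∈ c.tube c.radius, ∀ w : Euc n, ∀ᶠ t : ℝ in 𝓝 0, x + t • w ∈ c.tube c.radius := by
    intro x hx w
    have : Continuous fun t : ℝ => x + t • w := by fun_prop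
    have h1 := this.tendsto 0
    simp only [zero_smul, add_zero] at h1
    exact h1 (hO.mem_nhds hx)
  have hbound : ∀ x ∈ c.tube c.radius, ∀ j : Fin (n - 1), c.Y x j - 2 * c.radius ≤ -c.cubeRadius ∧
      c.Y x j - c.σ x - 2 * c.radius ≤ -c.cubeRadius := by
    intro x hx j
    have h1 := apply_sub_lt hn hx.1 j
    have h2 := (abs_lt.1 hx.2).1
    have h3 : c.height ≤ c.cubeRadius := hc.height_le
    have h4 := c.cubeRadius_pos hn
    constructor <;> linarith
  have hlined : ∀ j x, HasLineDerivAt ℝ (B j) (Bd j x) x c.dir := by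
    intro j x
    by_cases hxK : x ∈ c.core
    · have hx := hKO hxK
      have hs : HasDerivAt (fun t : ℝ => c.σ x + t) 1 0 := by
        simpa using (hasDerivAt_id (0 : ℝ)).const_add (c.σ x)
      have h := hasDerivAt_potential (L := 2 * c.radius) (q := 0) (y := c.Y x) κ.isHeightCutoff
        (supported_tangential hf j) (supported_defect (κ := κ) hf j) hs (hbound x hx j).1
        (by simpa using (hbound x hx j).2)
      have hval : Bd j x = κ.fieldS f j x := Set.indicator_of_mem hx _
      rw [hval]
      refine HasDerivAt.congr_of_eventuallyEq (by simpa [Cutoffs.fieldS] using h) ?_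
      filter_upwards [hin x hx c.dir] with t ht
      have e1 : c.Y (x + t • c.dir) = c.Y x := by simp [Y_add]
      have e2 : c.σ (x + t • c.dir) = c.σ x + t := by
        rw [σ, e1, T_add, σ]
        simp
        ring
      simp only [B]
      rw [Set.indicator_of_mem ht, e1, e2]
    · rw [(hvan j x hxK).2.1]
      exact hline0 j x hxK _
  have hlinee : ∀ j x, HasLineDerivAt ℝ (B j) (Be j x) x (c.frame (unitVec j)) := by
    intro j x
    by_cases hxK : x ∈ c.core
    · have hx := hKO hxK
      have hd := (hc.differentiableAt (y := c.Y x) (by linarith [hx.1])).hasFDerivAt.hasLineDerivAt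
        (unitVec j)
      have hs : HasDerivAt (fun t : ℝ => c.T x - c.h (c.Y x + t • unitVec j))
          (-(fderiv ℝ c.h (c.Y x) (unitVec j))) 0 := by
        exact HasDerivAt.const_sub (c.T x) hd
      have hs0 : c.T x - c.h (c.Y x + (0 : ℝ) • unitVec j) = c.σ x := by simp [σ]
      have h := hasDerivAt_potential (L := 2 * c.radius) (q := 1) (y := c.Y x) κ.isHeightCutoff
        (supported_tangential hf j) (supported_defect (κ := κ) hf j) hs (hbound x hx j).1
        (by rw [hs0]; exact (hbound x hx j).2)
      rw [hs0] at h
      have hval : Be j x = 1 * κ.fieldJ f j x +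
          -(fderiv ℝ c.h (c.Y x) (unitVec j)) * κ.fieldS f j x := by
        simp only [Be]
        rw [Set.indicator_of_mem hx, κ.slope_eq _ hx.1]
        ring
      rw [hval]
      refine HasDerivAt.congr_of_eventuallyEq h ?_
      filter_upwards [hin x hx (c.frame (unitVec j))] with t ht
      have e1 : c.Y (x + t • c.frame (unitVec j)) = c.Y x + (1 * t) • unitVec j := by
        simp [Y_add]
      have e2 : c.σ (x + t • c.frame (unitVec j)) =
          c.T x - c.h (c.Y x + t • unitVec j) := by
        rw [σ, e1, T_add]
        simp
      simp only [B]
      rw [Set.indicator_of_mem ht, e1, e2]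
    · rw [(hvan j x hxK).2.2]
      exact hline0 j x hxK _
  have hsum : κ.extend f = ∑ j, fun x => Bd j x • c.frame (unitVec j) - Be j x • c.dir := by
    ext1 x
    rw [Finset.sum_apply]
    by_cases hx : x ∈ c.tube c.radius
    · rw [extend_of_mem hx]
      simp [Bd, Be, hx]
    · simp [Cutoffs.extend, Bd, Be, hx]
  rw [hsum]
  exact WeaklySolenoidal.sum fun j _ =>
    weaklySolenoidal_of_potential (hcB j) (hcBd j) (hcBe j) (hlined j) (hlinee j)

end GraphChart.IsPatch

/-! ### The surface measure of a graph -/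

section Comparison

/-- A measure that is locally at most another one, is so globally. -/
theorem measure_le_of_locally_le {X : Type*} [TopologicalSpace X] [SecondCountableTopology X]
    [MeasurableSpace X] [OpensMeasurableSpace X] {μ ν : Measure X}
    (h : ∀ x, ∃ U ∈ 𝓝 x, ∀ A ⊆ U, MeasurableSet A → μ A ≤ ν A) : μ ≤ ν := by
  have h' : ∀ x, ∃ U, IsOpen U ∧ x ∈ U ∧ ∀ A ⊆ U, MeasurableSet A → μ A ≤ ν A := fun x => by
    obtain ⟨U, hU, hA⟩ := h x
    obtain ⟨V, hVU, hV, hx⟩ := mem_nhds_iff.1 hU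
    exact ⟨V, hV, hx, fun A hAV => hA A (hAV.trans hVU)⟩
  choose U hUo hU hUA using h'
  rcases isEmpty_or_nonempty X with hX | hX
  · simp [Measure.eq_zero_of_isEmpty]
  obtain ⟨t, ht, htU⟩ := TopologicalSpace.countable_cover_nhds fun x => (hUo x).mem_nhds (hU x)
  have htne : t.Nonempty := by
    obtain ⟨x⟩ := hX
    have : x ∈ ⋃ x ∈ t, U x := htU ▸ Set.mem_univ x
    simp only [Set.mem_iUnion] at this
    obtain ⟨y, hy, -⟩ := this
    exact ⟨y, hy⟩
  obtain ⟨g, hg⟩ := ht.exists_eq_range htne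
  have hcov : ⋃ k, disjointed (fun k => U (g k)) k = Set.univ := by
    rw [iUnion_disjointed, ← htU, hg, Set.biUnion_range]
  have hmeas : ∀ k, MeasurableSet (disjointed (fun k => U (g k)) k) :=
    MeasurableSet.disjointed fun k => (hUo _).measurableSet
  refine Measure.le_iff.2 fun A hA => ?_
  have hAeq : A = ⋃ k, A ∩ disjointed (fun k => U (g k)) k := by
    rw [← Set.inter_iUnion, hcov, Set.inter_univ]
  have hdisj : Pairwise (Function.onFun Disjoint fun k => A ∩ disjointed (fun k => U (g k)) k) :=
    fun i j hij => (disjoint_disjointed (fun k => U (g k)) hij).mono Set.inter_subset_right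
      Set.inter_subset_right
  rw [hAeq, measure_iUnion hdisj fun k => hA.inter (hmeas k),
    measure_iUnion hdisj fun k => hA.inter (hmeas k)]
  exact ENNReal.tsum_le_tsum fun k => hUA (g k) _
    (Set.inter_subset_right.trans (disjointed_subset _ _)) (hA.inter (hmeas k))

theorem euclideanHausdorffMeasure_image_le_of_edist_le {X Y Z : Type*} [EMetricSpace X]
    [MeasurableSpace X] [BorelSpace X] [EMetricSpace Y] [MeasurableSpace Y] [BorelSpace Y]
    {f : Z → X} {g : Z → Y} {A : Set Z} {K : ℝ≥0} (d : ℕ)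
    (h : ∀ x ∈ A, ∀ y ∈ A, edist (g x) (g y) ≤ K * edist (f x) (f y)) :
    μHE[d] (g '' A) ≤ (K : ℝ≥0∞) ^ d * μHE[d] (f '' A) := by
  rcases isEmpty_or_nonempty Z with hZ | hZ
  · simp [Set.eq_empty_of_isEmpty A]
  let q : X → Y := fun x => g (Function.invFunOn f A x)
  have hq : ∀ x ∈ A, q (f x) = g x := fun x hx => by
    have h1 := Function.invFunOn_mem (f := f) ⟨x, hx, rfl⟩
    have h2 := Function.invFunOn_eq (f := f) ⟨x, hx, rfl⟩
    have h3 := h _ h1 _ hx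
    rw [h2, edist_self, mul_zero] at h3
    exact edist_le_zero.1 h3
  have hlip : LipschitzOnWith K q (f '' A) := by
    rintro _ ⟨x, hx, rfl⟩ _ ⟨y, hy, rfl⟩
    rw [hq x hx, hq y hy]
    exact h x hx y hy
  have himg : q '' (f '' A) = g '' A := by
    rw [Set.image_image]
    exact Set.image_congr hq
  have := hlip.hausdorffMeasure_image_le (d := d) (Nat.cast_nonneg d)
  rw [himg, ENNReal.rpow_natCast] at this
  simp only [Measure.euclideanHausdorffMeasure_def, Measure.smul_apply, ENNReal.smul_def,
    smul_eq_mul]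
  calc _ ≤ _ * ((K : ℝ≥0∞) ^ d * μH[d] (f '' A)) := mul_le_mul_right this _
    _ = _ := by ring

/-- The linear map `v ↦ v + k ⟪a, v⟫ a` with `k` such that its square is `v ↦ v + ⟪a, v⟫ a`. It maps
`ℝᵐ` to itself with the same distortion as `v ↦ (v, ⟪a, v⟫)` maps `ℝᵐ` to a hyperplane of `ℝᵐ⁺¹`. -/
noncomputable def slantMap {m : ℕ} (a : Euc m) : Euc m →ₗ[ℝ] Euc m :=
  LinearMap.transvection ((1 + √(1 + ‖a‖ ^ 2))⁻¹ • (innerₗ (Euc m) a)) a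

theorem norm_slantMap_sq {m : ℕ} (a v : Euc m) :
    ‖slantMap a v‖ ^ 2 = ‖v‖ ^ 2 + ⟪a, v⟫ ^ 2 := by
  have hs : √(1 + ‖a‖ ^ 2) ^ 2 = 1 + ‖a‖ ^ 2 := Real.sq_sqrt (by positivity)
  set s := √(1 + ‖a‖ ^ 2) with hs'
  have hs0 : 0 ≤ s := Real.sqrt_nonneg _
  have e : slantMap a v = v + ((1 + s)⁻¹ * ⟪a, v⟫) • a := by
    simp [slantMap, LinearMap.transvection.apply, ← hs']
  rw [e, norm_add_sq_real, inner_smul_right, norm_smul, real_inner_comm, mul_pow, Real.norm_eq_abs,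
    sq_abs]
  have ha : ‖a‖ ^ 2 = s ^ 2 - 1 := by linarith
  rw [ha]
  field_simp
  ring

theorem det_slantMap {m : ℕ} (a : Euc m) : LinearMap.det (slantMap a) = √(1 + ‖a‖ ^ 2) := by
  have hs : √(1 + ‖a‖ ^ 2) ^ 2 = 1 + ‖a‖ ^ 2 := Real.sq_sqrt (by positivity)
  rw [slantMap, LinearMap.transvection.det]
  set s := √(1 + ‖a‖ ^ 2) with hs'
  have hs0 : 0 ≤ s := Real.sqrt_nonneg _
  simp only [LinearMap.smul_apply, innerₗ_apply_apply, real_inner_self_eq_norm_sq, smul_eq_mul]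
  have ha : ‖a‖ ^ 2 = s ^ 2 - 1 := by linarith
  rw [ha]
  field_simp
  ring

end Comparison

namespace GraphChart.IsPatch

variable {n : ℕ} {c : GraphChart n} {Ω : Set (Euc n)} {δ : ℝ} {p : Euc n}

theorem inner_toDual_symm (φ : Euc (n - 1) →L[ℝ] ℝ) (v : Euc (n - 1)) :
    ⟪(InnerProductSpace.toDual ℝ (Euc (n - 1))).symm φ, v⟫ = φ v :=
  InnerProductSpace.toDual_symm_apply

/-- Near each point, the area of a piece of the graph is that of the corresponding piece of the
tangent plane, up to a factor close to one. -/
theorem exists_nhds_area (hc : c.IsPatch Ω δ p) {y₀ : Euc (n - 1)}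
    (hy₀ : ‖y₀‖ < 2 * c.radius) {t : ℝ≥0} (ht : 1 < t) :
    ∃ U ∈ 𝓝 y₀, ∀ A ⊆ U, MeasurableSet A →
      μHE[n - 1] (c.graph '' A) ≤ (t : ℝ≥0∞) ^ (n - 1 + 1) *
          ∫⁻ y in A, ENNReal.ofReal √(1 + ‖fderiv ℝ c.h y‖ ^ 2) ∧
        ∫⁻ y in A, ENNReal.ofReal √(1 + ‖fderiv ℝ c.h y‖ ^ 2) ≤
          (t : ℝ≥0∞) ^ (n - 1 + 1) * μHE[n - 1] (c.graph '' A) := by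
  have ht' : (1 : ℝ) < t := by exact_mod_cast ht
  have hball : Metric.ball (0 : Euc (n - 1)) (2 * c.radius) ∈ 𝓝 y₀ :=
    Metric.isOpen_ball.mem_nhds (by simpa using hy₀)
  set D := fderiv ℝ c.h y₀ with hD
  set a := (InnerProductSpace.toDual ℝ (Euc (n - 1))).symm D with ha
  have hna : ‖a‖ = ‖D‖ := LinearIsometryEquiv.norm_map _ _
  set s₀ := √(1 + ‖D‖ ^ 2) with hs₀
  have hs₀pos : 0 < s₀ := Real.sqrt_pos.2 (by positivity)
  -- the derivative of the parametrization
  let Lg : Euc (n - 1) →L[ℝ] Euc n := c.frame.toContinuousLinearMap + D.smulRight c.dir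
  have hstrict : HasStrictFDerivAt c.graph Lg y₀ := by
    have h1 := ((hc.contDiffOn.contDiffAt hball).hasStrictFDerivAt (by norm_num)).smul_const c.dir
    have h2 := (c.frame.toContinuousLinearMap.hasStrictFDerivAt (x := y₀)).const_add c.center
    exact h2.add h1
  have hLg : ∀ v, ‖Lg v‖ = ‖slantMap a v‖ := fun v => by
    have : ‖Lg v‖ ^ 2 = ‖slantMap a v‖ ^ 2 := by
      rw [norm_slantMap_sq, ha, inner_toDual_symm]
      change ‖c.frame v + D v • c.dir‖ ^ 2 = _
      rw [norm_add_sq_real, inner_smul_right, c.frame_orthogonal, norm_smul, c.norm_dir,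
        LinearIsometry.norm_map, Real.norm_eq_abs, mul_one, sq_abs]
      ring
    exact (pow_left_inj₀ (norm_nonneg _) (norm_nonneg _) two_ne_zero).1 this
  have hSge : ∀ v, ‖v‖ ≤ ‖slantMap a v‖ := fun v => by
    refine (pow_le_pow_iff_left₀ (norm_nonneg _) (norm_nonneg _) two_ne_zero).1 ?_
    rw [norm_slantMap_sq]
    linarith [sq_nonneg ⟪a, v⟫]
  set e : ℝ≥0 := ⟨(t - 1) / t, by have : (0 : ℝ) ≤ t - 1 := by linarith
                                  positivity⟩ with he
  have he_coe : (e : ℝ) = (t - 1) / t := rfl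
  have he0 : 0 < e := by
    rw [← NNReal.coe_pos, he_coe]
    have : (0 : ℝ) < t - 1 := by linarith
    positivity
  have he1 : 1 + (e : ℝ) ≤ t := by
    rw [he_coe]
    have : ((t : ℝ) - 1) / t ≤ t - 1 := div_le_self (by linarith) ht'.le
    linarith
  have he2 : t * (1 - (e : ℝ)) = 1 := by
    rw [he_coe]
    field_simp
    ring
  obtain ⟨U₁, hU₁, happ⟩ := hstrict.approximates_deriv_on_nhds (c := e) (Or.inr he0)
  have hJc : ContinuousAt (fun y => √(1 + ‖fderiv ℝ c.h y‖ ^ 2)) y₀ := by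
    have := (hc.contDiffOn.contDiffAt hball).continuousAt_fderiv (by norm_num)
    exact ((this.norm.pow 2).const_add 1).sqrt
  have hJ1 : ∀ᶠ y in 𝓝 y₀, √(1 + ‖fderiv ℝ c.h y‖ ^ 2) < t * s₀ :=
    hJc.eventually_lt continuousAt_const (by nlinarith)
  have hJ2 : ∀ᶠ y in 𝓝 y₀, s₀ < t * √(1 + ‖fderiv ℝ c.h y‖ ^ 2) :=
    continuousAt_const.eventually_lt (hJc.const_mul (t : ℝ)) (by
      change s₀ < t * s₀
      nlinarith)
  refine ⟨U₁ ∩ {y | √(1 + ‖fderiv ℝ c.h y‖ ^ 2) < t * s₀ ∧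
      s₀ < t * √(1 + ‖fderiv ℝ c.h y‖ ^ 2)}, Filter.inter_mem hU₁ (hJ1.and hJ2), fun A hA hAm => ?_⟩
  have hnear : ∀ x ∈ A, ∀ y ∈ A, ‖c.graph x - c.graph y - Lg (x - y)‖ ≤ e * ‖x - y‖ :=
    fun x hx y hy => happ x (hA hx).1 y (hA hy).1
  have hup : ∀ x ∈ A, ∀ y ∈ A,
      edist (c.graph x) (c.graph y) ≤ t * edist (slantMap a x) (slantMap a y) := by
    intro x hx y hy
    rw [edist_dist, edist_dist, ← ENNReal.ofReal_coe_nnreal, ← ENNReal.ofReal_mul t.coe_nonneg]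
    refine ENNReal.ofReal_le_ofReal ?_
    rw [dist_eq_norm, dist_eq_norm, ← map_sub]
    have h1 := hnear x hx y hy
    have h2 := norm_sub_norm_le (c.graph x - c.graph y) (Lg (x - y))
    have h3 := hSge (x - y)
    rw [hLg] at h2
    nlinarith [norm_nonneg (slantMap a (x - y)), e.2]
  have hlow : ∀ x ∈ A, ∀ y ∈ A,
      edist (slantMap a x) (slantMap a y) ≤ t * edist (c.graph x) (c.graph y) := by
    intro x hx y hy
    rw [edist_dist, edist_dist, ← ENNReal.ofReal_coe_nnreal, ← ENNReal.ofReal_mul t.coe_nonneg]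
    refine ENNReal.ofReal_le_ofReal ?_
    rw [dist_eq_norm, dist_eq_norm, ← map_sub]
    have h1 := hnear x hx y hy
    have h2 := norm_sub_norm_le (Lg (x - y)) (c.graph x - c.graph y)
    rw [norm_sub_rev (Lg (x - y)), hLg] at h2
    have h3 := hSge (x - y)
    have h4 : (1 - (e : ℝ)) * ‖slantMap a (x - y)‖ ≤ ‖c.graph x - c.graph y‖ := by
      nlinarith [e.2]
    calc ‖slantMap a (x - y)‖ = t * ((1 - (e : ℝ)) * ‖slantMap a (x - y)‖) := by
          rw [← mul_assoc, he2, one_mul]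
      _ ≤ _ := by gcongr
  have hvol : μHE[n - 1] (slantMap a '' A) = ENNReal.ofReal s₀ * volume A := by
    rw [EuclideanSpace.euclideanHausdorffMeasure_eq_volume, Measure.addHaar_image_linearMap,
      det_slantMap, hna, abs_of_pos hs₀pos]
  have hconst : ENNReal.ofReal s₀ * volume A = ∫⁻ _ in A, ENNReal.ofReal s₀ := by
    rw [setLIntegral_const]
  constructor
  · calc μHE[n - 1] (c.graph '' A) ≤ (t : ℝ≥0∞) ^ (n - 1) * μHE[n - 1] (slantMap a '' A) :=
          euclideanHausdorffMeasure_image_le_of_edist_le _ hup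
      _ ≤ (t : ℝ≥0∞) ^ (n - 1) *
            (t * ∫⁻ y in A, ENNReal.ofReal √(1 + ‖fderiv ℝ c.h y‖ ^ 2)) := by
          gcongr
          rw [hvol, hconst, ← lintegral_const_mul' _ _ ENNReal.coe_ne_top]
          refine setLIntegral_mono' hAm fun y hy => ?_
          rw [← ENNReal.ofReal_coe_nnreal, ← ENNReal.ofReal_mul t.coe_nonneg]
          exact ENNReal.ofReal_le_ofReal (hA hy).2.2.le
      _ = _ := by ring
  · calc ∫⁻ y in A, ENNReal.ofReal √(1 + ‖fderiv ℝ c.h y‖ ^ 2)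
        ≤ t * μHE[n - 1] (slantMap a '' A) := by
          rw [hvol, hconst, ← lintegral_const_mul' _ _ ENNReal.coe_ne_top]
          refine setLIntegral_mono' hAm fun y hy => ?_
          rw [← ENNReal.ofReal_coe_nnreal, ← ENNReal.ofReal_mul t.coe_nonneg]
          exact ENNReal.ofReal_le_ofReal (hA hy).2.1.le
      _ ≤ t * ((t : ℝ≥0∞) ^ (n - 1) * μHE[n - 1] (c.graph '' A)) := by
          gcongr
          exact euclideanHausdorffMeasure_image_le_of_edist_le _ hlow
      _ = _ := by ring

theorem measurableSet_tube (hc : c.IsPatch Ω δ p) :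
    MeasurableSet {x : frontier Ω | (x : Euc n) ∈ c.tube c.radius} :=
  ((hc.isOpen_tube (by linarith [c.radius_pos])).preimage continuous_subtype_val).measurableSet

/-- The area formula for the graph, in terms of the surface measure on `∂Ω`. -/
theorem map_surfaceMeasure (hc : c.IsPatch Ω δ p) (hn : 1 ≤ n) (hΩ : IsOpen Ω) :
    ((μHE[n - 1] : Measure (frontier Ω)).restrict {x | (x : Euc n) ∈ c.tube c.radius}).map
        (fun x : frontier Ω => c.Y x) =
      (volume.restrict (Metric.ball 0 c.radius)).withDensity
        fun y => ENNReal.ofReal √(1 + ‖fderiv ℝ c.h y‖ ^ 2) := by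
  have hr := c.radius_pos
  have hYm : Measurable fun x : frontier Ω => c.Y x :=
    (c.continuous_Y.comp continuous_subtype_val).measurable
  have hμ : ∀ A, MeasurableSet A →
      ((μHE[n - 1] : Measure (frontier Ω)).restrict {x | (x : Euc n) ∈ c.tube c.radius}).map
        (fun x : frontier Ω => c.Y x) A = μHE[n - 1] (c.graph '' (A ∩ Metric.ball 0 c.radius)) := by
    intro A hA
    rw [Measure.map_apply hYm hA, Measure.restrict_apply (hYm hA),
      ← isometry_subtype_coe.euclideanHausdorffMeasure_image]
    congr 1
    ext x
    constructor
    · rintro ⟨x, ⟨hxA, hx⟩, rfl⟩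
      have hx' : (x : Euc n) ∈ c.tube (2 * c.radius) := ⟨by linarith [hx.1], hx.2⟩
      exact ⟨c.Y x, ⟨hxA, by simpa using hx.1⟩, c.graph_Y hn (hc.σ_eq_zero hn hΩ hx' x.2)⟩
    · rintro ⟨y, ⟨hyA, hy⟩, rfl⟩
      rw [mem_ball_zero_iff] at hy
      exact ⟨⟨c.graph y, hc.graph_mem_frontier hn hΩ (by linarith)⟩,
        ⟨by simpa using hyA, graph_mem_tube hy⟩, rfl⟩
  have hν : ∀ A, MeasurableSet A → (volume.restrict (Metric.ball 0 c.radius)).withDensity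
        (fun y => ENNReal.ofReal √(1 + ‖fderiv ℝ c.h y‖ ^ 2)) A =
      ∫⁻ y in A ∩ Metric.ball 0 c.radius, ENNReal.ofReal √(1 + ‖fderiv ℝ c.h y‖ ^ 2) := by
    intro A hA
    rw [withDensity_apply _ hA, Measure.restrict_restrict hA]
  set μ := ((μHE[n - 1] : Measure (frontier Ω)).restrict {x | (x : Euc n) ∈ c.tube c.radius}).map
    (fun x : frontier Ω => c.Y x)
  set ν := (volume.restrict (Metric.ball 0 c.radius)).withDensity
    (fun y => ENNReal.ofReal √(1 + ‖fderiv ℝ c.h y‖ ^ 2))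
  have hlim : ∀ {μ ν : Measure (Euc (n - 1))},
      (∀ t : ℝ≥0, 1 < t → μ ≤ (t : ℝ≥0∞) ^ (n - 1 + 1) • ν) → μ ≤ ν := by
    intro μ ν h
    refine Measure.le_iff.2 fun A hA => ?_
    have h1 : Filter.Tendsto (fun t : ℝ≥0 => (t : ℝ≥0∞) ^ (n - 1 + 1) * ν A) (𝓝[>] 1) (𝓝 (ν A)) := by
      have h2 : Filter.Tendsto (fun t : ℝ≥0 => (t : ℝ≥0∞) ^ (n - 1 + 1)) (𝓝 1) (𝓝 1) := by
        have : Continuous fun t : ℝ≥0 => (t : ℝ≥0∞) ^ (n - 1 + 1) :=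
          (ENNReal.continuous_pow _).comp ENNReal.continuous_coe
        simpa using this.tendsto 1
      have := ENNReal.Tendsto.mul_const (b := ν A) h2 (Or.inl one_ne_zero)
      rw [one_mul] at this
      exact this.mono_left nhdsWithin_le_nhds
    refine ge_of_tendsto h1 ?_
    filter_upwards [self_mem_nhdsWithin] with t ht
    exact (Measure.le_iff.1 (h t ht) A hA)
  have hloc : ∀ t : ℝ≥0, 1 < t → ∀ y : Euc (n - 1), ∃ U ∈ 𝓝 y, ∀ A ⊆ U, MeasurableSet A →
      μ A ≤ (t : ℝ≥0∞) ^ (n - 1 + 1) * ν A ∧ ν A ≤ (t : ℝ≥0∞) ^ (n - 1 + 1) * μ A := by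
    intro t ht y
    by_cases hy : ‖y‖ < 2 * c.radius
    · obtain ⟨U, hU, h⟩ := hc.exists_nhds_area hy ht
      refine ⟨U, hU, fun A hA hAm => ?_⟩
      rw [hμ A hAm, hν A hAm]
      exact h _ (Set.inter_subset_left.trans hA) (hAm.inter measurableSet_ball)
    · have : c.radius < ‖y‖ := by linarith
      refine ⟨_, (isOpen_lt continuous_const continuous_norm).mem_nhds this, fun A hA hAm => ?_⟩
      have he : A ∩ Metric.ball 0 c.radius = ∅ := by
        ext z
        simp only [Set.mem_inter_iff, mem_ball_zero_iff, Set.mem_empty_iff_false, iff_false,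
          not_and, not_lt]
        exact fun hz => (hA hz).le
      rw [hμ A hAm, hν A hAm, he]
      simp
  refine le_antisymm (hlim fun t ht => ?_) (hlim fun t ht => ?_)
  · refine measure_le_of_locally_le fun y => ?_
    obtain ⟨U, hU, h⟩ := hloc t ht y
    exact ⟨U, hU, fun A hA hAm => (h A hA hAm).1⟩
  · refine measure_le_of_locally_le fun y => ?_
    obtain ⟨U, hU, h⟩ := hloc t ht y
    exact ⟨U, hU, fun A hA hAm => (h A hA hAm).2⟩

end GraphChart.IsPatch

/-! ### The normal and the flux -/

theorem IsUnitOuterNormal.eq {n : ℕ} {Ω : Set (Euc n)} {x ν ν' : Euc n}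
    (h : IsUnitOuterNormal Ω x ν) (h' : IsUnitOuterNormal Ω x ν') : ν = ν' := by
  by_contra hne
  have hlt : ⟪ν, ν'⟫ < 1 := by
    refine lt_of_le_of_ne ?_ fun h1 => hne ((inner_eq_one_iff_of_norm_eq_one h.1 h'.1).1 h1)
    have := real_inner_le_norm ν ν'
    rwa [h.1, h'.1, one_mul] at this
  have h1 : ⟪ν' - ν, ν⟫ < 0 := by
    rw [inner_sub_left, real_inner_self_eq_norm_sq, h.1, real_inner_comm]
    linarith
  have h2 : 0 < ⟪ν' - ν, ν'⟫ := by
    rw [inner_sub_left, real_inner_self_eq_norm_sq, h'.1]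
    linarith
  obtain ⟨t, ht1, ht2⟩ := ((h.2.1 _ h1).and (h'.2.2 _ h2)).exists
  exact ht2 (subset_closure ht1)

theorem IsUnitOuterNormal.outerNormal_eq {n : ℕ} {Ω : Set (Euc n)} {x ν : Euc n}
    (h : IsUnitOuterNormal Ω x ν) : outerNormal Ω x = ν :=
  (Classical.epsilon_spec (p := IsUnitOuterNormal Ω x) ⟨ν, h⟩).eq h

namespace GraphChart.IsPatch

variable {n : ℕ} {c : GraphChart n} {Ω : Set (Euc n)} {δ : ℝ} {p : Euc n}

/-- The unit outer normal of the region above the graph is `(Dh, -1)`, normalized. -/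
theorem inner_outerNormal (hc : c.IsPatch Ω δ p) (hn : 1 ≤ n) {y : Euc (n - 1)}
    (hy : ‖y‖ < 2 * c.radius) (v : Euc n) :
    √(1 + ‖fderiv ℝ c.h y‖ ^ 2) * ⟪v, outerNormal Ω (c.graph y)⟫ =
      fderiv ℝ c.h y (c.yL v) - c.tL v := by
  set D := fderiv ℝ c.h y with hD
  set a := (InnerProductSpace.toDual ℝ (Euc (n - 1))).symm D with ha
  have hna : ‖a‖ = ‖D‖ := LinearIsometryEquiv.norm_map _ _
  set s := √(1 + ‖D‖ ^ 2) with hs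
  have hs0 : 0 < s := Real.sqrt_pos.2 (by positivity)
  let ν : Euc n := s⁻¹ • (c.frame a - c.dir)
  have hν : ∀ v, s * ⟪v, ν⟫ = D (c.yL v) - c.tL v := by
    intro v
    have h1 : ⟪v, c.frame a⟫ = D (c.yL v) := by
      rw [← inner_toDual_symm D, ← ha, yL, ContinuousLinearMap.adjoint_inner_right,
        real_inner_comm]
      rfl
    simp only [ν]
    rw [inner_smul_right, mul_inv_cancel_left₀ hs0.ne', inner_sub_right, h1, real_inner_comm]
    rfl
  have hσd : ∀ v, HasDerivAt (fun t : ℝ => c.σ (c.graph y + t • v)) (c.tL v - D (c.yL v)) 0 := by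
    intro v
    have h1 := (hc.differentiableAt hy).hasFDerivAt.hasLineDerivAt (c.yL v)
    have h2 : HasDerivAt (fun t : ℝ => c.h y + t * c.tL v) (c.tL v) 0 := by
      simpa using ((hasDerivAt_id (0 : ℝ)).mul_const (c.tL v)).const_add (c.h y)
    refine (HasDerivAt.sub h2 h1).congr_of_eventuallyEq (Filter.Eventually.of_forall fun t => ?_)
    simp [σ, Y_add, T_add]
  have hin : ∀ v, ∀ᶠ t : ℝ in 𝓝[>] 0, c.graph y + t • v ∈ c.tube (2 * c.radius) := by
    intro v
    have : Continuous fun t : ℝ => c.graph y + t • v := by fun_prop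
    have h1 := this.tendsto 0
    simp only [zero_smul, add_zero] at h1
    exact nhdsWithin_le_nhds (h1 ((hc.isOpen_tube le_rfl).mem_nhds (graph_mem_tube hy)))
  have hslope : ∀ v, Filter.Tendsto (fun t : ℝ => t⁻¹ * c.σ (c.graph y + t • v)) (𝓝[>] 0)
      (𝓝 (c.tL v - D (c.yL v))) := by
    intro v
    have h1 := (hasDerivAt_iff_tendsto_slope.1 (hσd v)).mono_left
      (nhdsWithin_mono 0 fun t (ht : 0 < t) => ht.ne')
    refine h1.congr fun t => ?_
    simp [slope]
  have hmain : IsUnitOuterNormal Ω (c.graph y) ν := by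
    refine ⟨?_, fun v hv => ?_, fun v hv => ?_⟩
    · have h1 : ‖c.frame a - c.dir‖ ^ 2 = s ^ 2 := by
        rw [hs, Real.sq_sqrt (by positivity), norm_sub_sq_real, c.frame_orthogonal, c.norm_dir,
          LinearIsometry.norm_map, hna]
        ring
      have h2 := (pow_left_inj₀ (norm_nonneg _) hs0.le two_ne_zero).1 h1
      simp only [ν]
      rw [norm_smul, h2, norm_inv, Real.norm_eq_abs, abs_of_pos hs0, inv_mul_cancel₀ hs0.ne']
    · have h1 : 0 < c.tL v - D (c.yL v) := by
        have := hν v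
        nlinarith
      filter_upwards [hin v, (hslope v).eventually (lt_mem_nhds h1), self_mem_nhdsWithin]
        with t ht1 ht2 ht3
      exact (hc.mem_iff_of_mem_tube hn ht1).2 (pos_of_mul_pos_right ht2 (inv_pos.2 ht3).le)
    · have h1 : c.tL v - D (c.yL v) < 0 := by
        have := hν v
        nlinarith
      filter_upwards [hin v, (hslope v).eventually (gt_mem_nhds h1), self_mem_nhdsWithin]
        with t ht1 ht2 ht3 hcl
      have h3 : c.σ (c.graph y + t • v) < 0 := by
        by_contra! h
        have : 0 ≤ t⁻¹ * c.σ (c.graph y + t • v) := mul_nonneg (inv_pos.2 ht3).le h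
        linarith
      have h4 := c.le_T_of_mem_closure hcl
        (hc.continuousOn.continuousAt (Metric.isOpen_ball.mem_nhds (by simpa using ht1.1))) (by
          filter_upwards [(hc.isOpen_tube le_rfl).mem_nhds ht1] with z hz hzΩ
          exact sub_pos.1 ((hc.mem_iff_of_mem_tube hn hz).1 hzΩ))
      exact absurd h3 (not_lt.2 (sub_nonneg.2 h4))
  rw [hmain.outerNormal_eq, hν]

variable {κ : c.Cutoffs} {f : C(Euc (n - 1), Euc n)}

theorem _root_.SupportedInCube.hasCompactSupport {m : ℕ} {E : Type*} [Zero E] {R : ℝ}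
    {f : Euc m → E} (hf : SupportedInCube R f) : HasCompactSupport f := by
  refine HasCompactSupport.intro
    ((isCompact_univ_pi fun _ => isCompact_Icc (a := -R) (b := R)).image
      (EuclideanSpace.equiv (Fin m) ℝ).symm.continuous) fun y hy => hf y ?_
  by_contra! h
  exact hy ⟨fun k => y k, fun k _ => ⟨(abs_lt.1 (h k)).1.le, (abs_lt.1 (h k)).2.le⟩,
    by ext k; simp⟩

/-- The flux of data given on the graph is the surface integral of their component in the direction
of the inner normal. -/
theorem integral_inner_outerNormal (hc : c.IsPatch Ω δ p) (hn : 1 ≤ n) (hΩ : IsOpen Ω)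
    (hf : SupportedInCube c.cubeRadius f) {u : frontier Ω → Euc n}
    (hu : ∀ x : frontier Ω, (x : Euc n) ∈ c.tube c.radius → u x = f (c.Y x))
    (hu0 : ∀ x : frontier Ω, (x : Euc n) ∉ c.tube c.radius → u x = 0) :
    Integrable (fun x => ⟪u x, outerNormal Ω x⟫) (μHE[n - 1] : Measure (frontier Ω)) ∧
      ∫ x, ⟪u x, outerNormal Ω x⟫ ∂(μHE[n - 1] : Measure (frontier Ω)) = -κ.flux f := by
  have hr := c.radius_pos
  have hR := c.cubeRadius_pos hn
  set P : Set (frontier Ω) := {x | (x : Euc n) ∈ c.tube c.radius} with hP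
  have hPm : MeasurableSet P := hc.measurableSet_tube
  let Jd : Euc (n - 1) → ℝ := fun y => √(1 + ‖κ.slope y‖ ^ 2)
  have hJc : Continuous Jd := by fun_prop
  have hJ0 : ∀ y, 0 < Jd y := fun y => Real.sqrt_pos.2 (by positivity)
  let H : Euc (n - 1) → ℝ := fun y => -(κ.fluxDensity f y / Jd y)
  have hHc : Continuous H := ((κ.fluxDensity f).continuous.div hJc fun y => (hJ0 y).ne').neg
  have hflux0 : ∀ y ∉ Metric.ball (0 : Euc (n - 1)) c.radius, κ.fluxDensity f y = 0 := by
    intro y hy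
    refine Cutoffs.supported_fluxDensity hf y ?_
    by_contra! h
    exact hy (by simpa using c.norm_lt_radius hn fun k => by linarith [h k])
  have hYm : Measurable fun x : frontier Ω => c.Y x :=
    (c.continuous_Y.comp continuous_subtype_val).measurable
  have hrep : (fun x : frontier Ω => ⟪u x, outerNormal Ω x⟫) = P.indicator fun x => H (c.Y x) := by
    ext x
    by_cases hx : x ∈ P
    · have hx1 : ‖c.Y x‖ < c.radius := hx.1
      have hx2 : (x : Euc n) ∈ c.tube (2 * c.radius) := ⟨by linarith, hx.2⟩
      have hg := c.graph_Y hn (hc.σ_eq_zero hn hΩ hx2 x.2)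
      have h1 := hc.inner_outerNormal hn hx2.1 (u x)
      rw [hg, ← κ.slope_eq _ hx1] at h1
      rw [Set.indicator_of_mem hx]
      simp only [H]
      rw [Cutoffs.fluxDensity_apply, ← hu x hx, ← neg_div, eq_div_iff (hJ0 _).ne', mul_comm]
      rw [h1]
      ring
    · rw [Set.indicator_of_notMem hx, hu0 x hx, inner_zero_left]
  have hmap : ((μHE[n - 1] : Measure (frontier Ω)).restrict P).map (fun x : frontier Ω => c.Y x) =
      (volume.restrict (Metric.ball 0 c.radius)).withDensity fun y => ENNReal.ofReal (Jd y) := by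
    rw [hc.map_surfaceMeasure hn hΩ]
    refine withDensity_congr_ae ?_
    filter_upwards [ae_restrict_mem measurableSet_ball] with y hy
    simp only [Jd]
    rw [κ.slope_eq _ (by simpa using hy)]
  have hJH : (fun y => (ENNReal.ofReal (Jd y)).toReal • H y) = fun y => -κ.fluxDensity f y := by
    ext y
    rw [ENNReal.toReal_ofReal (hJ0 y).le, smul_eq_mul]
    simp only [H]
    have := (hJ0 y).ne'
    field_simp
  have hJm : Measurable fun y => ENNReal.ofReal (Jd y) := hJc.measurable.ennreal_ofReal
  have hfin : ∀ᵐ y ∂(volume.restrict (Metric.ball (0 : Euc (n - 1)) c.radius)),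
      ENNReal.ofReal (Jd y) < ⊤ := Filter.Eventually.of_forall fun _ => ENNReal.ofReal_lt_top
  have hint : Integrable H (((μHE[n - 1] : Measure (frontier Ω)).restrict P).map
      fun x : frontier Ω => c.Y x) := by
    rw [hmap, integrable_withDensity_iff_integrable_smul' hJm hfin, hJH]
    exact ((κ.fluxDensity f).continuous.integrable_of_hasCompactSupport
      (Cutoffs.supported_fluxDensity hf).hasCompactSupport).neg.restrict
  rw [hrep]
  constructor
  · rw [integrable_indicator_iff hPm]
    exact (integrable_map_measure hHc.aestronglyMeasurable hYm.aemeasurable).1 hint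
  · rw [integral_indicator hPm, ← integral_map hYm.aemeasurable hHc.aestronglyMeasurable, hmap,
      integral_withDensity_eq_integral_toReal_smul hJm hfin, hJH, integral_neg,
      setIntegral_eq_integral_of_forall_compl_eq_zero hflux0]
    rfl

end GraphChart.IsPatch

/-! ### Boundary data in the coordinates of a patch -/

namespace GraphChart

variable {n : ℕ} (c : GraphChart n)

/-- The neighbourhood of the centre over the open cube of half side `cubeRadius`, of half height
`height / 2`. Data localized to it can be extended on the patch. -/
def cell : Set (Euc n) := {x | (∀ k, |c.Y x k| < c.cubeRadius) ∧ |c.σ x| < c.height / 2}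

theorem cell_subset_core (hn : 1 ≤ n) : c.cell ⊆ c.core := fun x hx =>
  ⟨fun k => by linarith [hx.1 k, c.cubeRadius_pos hn], hx.2.le⟩

/-- Cutoff functions that localize boundary data to a patch. -/
structure IsWeight (η : Euc n → ℝ) : Prop where
  contDiff : ContDiff ℝ ∞ η
  tsupport_subset : tsupport η ⊆ c.cell

variable {c} {Ω : Set (Euc n)} {δ : ℝ} {p : Euc n} {η : Euc n → ℝ}

theorem IsWeight.eq_zero (hη : c.IsWeight η) {x : Euc n} (hx : x ∉ c.cell) : η x = 0 := by
  by_contra h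
  exact hx (hη.tsupport_subset (subset_tsupport _ h))

namespace IsPatch

theorem isOpen_cell (hc : c.IsPatch Ω δ p) (hn : 1 ≤ n) : IsOpen c.cell := by
  have hO : IsOpen (c.tube c.radius) := hc.isOpen_tube (by linarith [c.radius_pos])
  have h1 : IsOpen (c.tube c.radius ∩ (fun x => |c.σ x|) ⁻¹' Set.Iio (c.height / 2)) :=
    hc.continuousOn_σ.abs.isOpen_inter_preimage hO isOpen_Iio
  have h2 : IsOpen {x | ∀ k, |c.Y x k| < c.cubeRadius} := by
    simp only [Set.ofPred_forall]
    refine isOpen_iInter_of_finite fun k => isOpen_lt ?_ continuous_const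
    have := c.continuous_Y
    fun_prop
  convert h1.inter h2 using 1
  ext x
  constructor
  · intro hx
    exact ⟨⟨c.core_subset_tube hn (c.cell_subset_core hn hx), hx.2⟩, hx.1⟩
  · rintro ⟨⟨-, h⟩, h'⟩
    exact ⟨h', h⟩

theorem mem_cell (hc : c.IsPatch Ω δ p) (hn : 1 ≤ n) : p ∈ c.cell := by
  have := c.cubeRadius_pos hn
  have := c.height_pos
  have h0 := hc.graph_zero
  refine ⟨fun k => ?_, ?_⟩
  · rw [hc.Y_center]
    simpa
  · rw [← h0, σ_graph]
    simpa

theorem hasCompactSupport (hc : c.IsPatch Ω δ p) (hn : 1 ≤ n) (hη : c.IsWeight η) :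
    HasCompactSupport η :=
  (hc.isCompact_core hn).of_isClosed_subset (isClosed_tsupport η)
    (hη.tsupport_subset.trans (c.cell_subset_core hn))

/-- A point of the core is close to the boundary point over the same base point. -/
theorem core_subset_thickening (hc : c.IsPatch Ω δ p) (hn : 1 ≤ n) (hΩ : IsOpen Ω) :
    c.core ⊆ Metric.thickening δ (frontier Ω) := by
  intro x hx
  have hx1 := (c.core_subset_tube hn hx).1
  have hg := hc.graph_mem_frontier hn hΩ (y := c.Y x) (by linarith [c.radius_pos])
  refine Metric.mem_thickening_iff.2 ⟨_, hg, ?_⟩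
  have e : x - c.graph (c.Y x) = c.σ x • c.dir := by
    have h := c.point_Y_σ hn x
    rw [point, add_smul, ← add_assoc] at h
    exact sub_eq_of_eq_add' h.symm
  rw [dist_eq_norm, e, norm_smul, c.norm_dir, mul_one, Real.norm_eq_abs]
  linarith [hx.2, hc.height_lt, c.height_pos]

/-- Points of the boundary in the tube lie on the graph. -/
theorem graph_Y_of_mem_frontier (hc : c.IsPatch Ω δ p) (hn : 1 ≤ n) (hΩ : IsOpen Ω) {x : Euc n}
    (hx : x ∈ frontier Ω) (hxt : x ∈ c.tube c.radius) : c.graph (c.Y x) = x :=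
  c.graph_Y hn (hc.σ_eq_zero hn hΩ ⟨by linarith [hxt.1, c.radius_pos], hxt.2⟩ hx)

theorem mem_closedBall_of_graph_mem_cell (hn : 1 ≤ n) {y : Euc (n - 1)} (hy : c.graph y ∈ c.cell) :
    y ∈ Metric.closedBall 0 (c.radius / 2) := by
  have h1 : ‖(2 : ℝ) • y‖ < c.radius := c.norm_lt_radius hn fun k => by
    have := hy.1 k
    rw [Y_graph] at this
    simp only [PiLp.smul_apply, smul_eq_mul, abs_mul, abs_two]
    linarith
  rw [norm_smul, Real.norm_eq_abs, abs_two] at h1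
  rw [mem_closedBall_zero_iff]
  linarith

theorem pullback_graph (hc : c.IsPatch Ω δ p) (hn : 1 ≤ n) (hΩ : IsOpen Ω) {y : Euc (n - 1)}
    (hy : ‖y‖ < 2 * c.radius) (u : frontier Ω → Euc n) :
    c.pullback Ω u y = u ⟨c.graph y, hc.graph_mem_frontier hn hΩ hy⟩ :=
  Subtype.val_injective.extend_apply u 0 ⟨c.graph y, hc.graph_mem_frontier hn hΩ hy⟩

theorem continuousOn_pullback (hc : c.IsPatch Ω δ p) (hn : 1 ≤ n) (hΩ : IsOpen Ω)
    {u : frontier Ω → Euc n} (hu : Continuous u) :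
    ContinuousOn (c.pullback Ω u) (Metric.ball 0 (2 * c.radius)) := by
  rw [continuousOn_iff_continuous_domRestrict]
  have h1 : Continuous fun y : Metric.ball (0 : Euc (n - 1)) (2 * c.radius) => c.graph y :=
    continuousOn_iff_continuous_domRestrict.1 hc.continuousOn_graph
  convert hu.comp (h1.subtype_mk fun y =>
    hc.graph_mem_frontier hn hΩ (mem_ball_zero_iff.1 y.2)) using 1
  ext1 y
  exact hc.pullback_graph hn hΩ (mem_ball_zero_iff.1 y.2) u

open Classical in
/-- The localized boundary data `η u` in the coordinate `y` of a patch. -/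
noncomputable def data (hc : c.IsPatch Ω δ p) (hn : 1 ≤ n) (hΩ : IsOpen Ω) (hη : c.IsWeight η) :
    C(frontier Ω, Euc n) →ₗ[ℝ] C(Euc (n - 1), Euc n) where
  toFun u := ⟨fun y => if ‖y‖ < c.radius then η (c.graph y) • c.pullback Ω u y else 0, by
    have hr := c.radius_pos
    refine continuous_of_continuousOn_of_eq_zero (K := Metric.closedBall 0 (c.radius / 2))
      (O := Metric.ball 0 c.radius) Metric.isClosed_closedBall Metric.isOpen_ball
      (Metric.closedBall_subset_ball (by linarith)) (ContinuousOn.congr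
        (f := fun y => η (c.graph y) • c.pullback Ω u y) ?_ fun y hy => if_pos (by simpa using hy))
      fun y hy => ?_
    · have hsub : Metric.ball (0 : Euc (n - 1)) c.radius ⊆ Metric.ball 0 (2 * c.radius) :=
        Metric.ball_subset_ball (by linarith)
      exact (hη.contDiff.continuous.comp_continuousOn (hc.continuousOn_graph.mono hsub)).smul
        ((hc.continuousOn_pullback hn hΩ u.continuous).mono hsub)
    · rw [hη.eq_zero fun h => hy (mem_closedBall_of_graph_mem_cell hn h), zero_smul, ite_self]⟩
  map_add' u v := by
    ext1 y
    by_cases hy : ‖y‖ < c.radius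
    · have hy' : ‖y‖ < 2 * c.radius := by linarith [c.radius_pos]
      simp [hy, hc.pullback_graph hn hΩ hy']
    · simp [hy]
  map_smul' r u := by
    ext1 y
    by_cases hy : ‖y‖ < c.radius
    · have hy' : ‖y‖ < 2 * c.radius := by linarith [c.radius_pos]
      simp [hy, hc.pullback_graph hn hΩ hy', smul_comm r]
    · simp [hy]

theorem data_apply (hc : c.IsPatch Ω δ p) (hn : 1 ≤ n) (hΩ : IsOpen Ω) (hη : c.IsWeight η)
    (u : C(frontier Ω, Euc n)) {y : Euc (n - 1)} (hy : ‖y‖ < c.radius) :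
    hc.data hn hΩ hη u y = η (c.graph y) • c.pullback Ω u y := if_pos hy

theorem data_eq_zero (hc : c.IsPatch Ω δ p) (hn : 1 ≤ n) (hΩ : IsOpen Ω) (hη : c.IsWeight η)
    (u : C(frontier Ω, Euc n)) {y : Euc (n - 1)} (hy : c.graph y ∉ c.cell) :
    hc.data hn hΩ hη u y = 0 := by
  by_cases h : ‖y‖ < c.radius
  · rw [hc.data_apply hn hΩ hη u h, hη.eq_zero hy, zero_smul]
  · exact if_neg h

theorem supportedInCube_data (hc : c.IsPatch Ω δ p) (hn : 1 ≤ n) (hΩ : IsOpen Ω)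
    (hη : c.IsWeight η) (u : C(frontier Ω, Euc n)) :
    SupportedInCube c.cubeRadius (hc.data hn hΩ hη u) := by
  rintro y ⟨k, hk⟩
  refine hc.data_eq_zero hn hΩ hη u fun h => ?_
  have := h.1 k
  rw [Y_graph] at this
  linarith

theorem data_Y (hc : c.IsPatch Ω δ p) (hn : 1 ≤ n) (hΩ : IsOpen Ω) (hη : c.IsWeight η)
    (u : C(frontier Ω, Euc n)) (x : frontier Ω) (hx : (x : Euc n) ∈ c.tube c.radius) :
    hc.data hn hΩ hη u (c.Y x) = η x • u x := by
  have hg := hc.graph_Y_of_mem_frontier hn hΩ x.2 hx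
  rw [hc.data_apply hn hΩ hη u hx.1, hc.pullback_graph hn hΩ (by linarith [hx.1, c.radius_pos])]
  simp only [hg]

theorem weight_eq_zero (hn : 1 ≤ n) (hη : c.IsWeight η) {x : Euc n}
    (hx : x ∉ c.tube c.radius) : η x = 0 :=
  hη.eq_zero fun h => hx (c.core_subset_tube hn (c.cell_subset_core hn h))

/-- The flux of the localized data as a surface integral. -/
theorem integral_weight (hc : c.IsPatch Ω δ p) (hn : 1 ≤ n) (hΩ : IsOpen Ω) (hη : c.IsWeight η)
    (κ : c.Cutoffs) (u : C(frontier Ω, Euc n)) :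
    Integrable (fun x : frontier Ω => ⟪η x • u x, outerNormal Ω x⟫)
        (μHE[n - 1] : Measure (frontier Ω)) ∧
      ∫ x : frontier Ω, ⟪η x • u x, outerNormal Ω x⟫ ∂(μHE[n - 1] : Measure (frontier Ω)) =
        -κ.flux (hc.data hn hΩ hη u) :=
  hc.integral_inner_outerNormal hn hΩ (hc.supportedInCube_data hn hΩ hη u)
    (u := fun x : frontier Ω => η x • u x)
    (fun x hx => (hc.data_Y hn hΩ hη u x hx).symm)
    (fun x hx => by rw [weight_eq_zero hn hη hx, zero_smul])

/-- The boundary values of the extension on a patch: the localized data, up to a multiple of the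
field of unit flux. -/
theorem extend_data_boundary (hc : c.IsPatch Ω δ p) (hn : 1 ≤ n) (hΩ : IsOpen Ω)
    (hη : c.IsWeight η) (κ : c.Cutoffs) (u : C(frontier Ω, Euc n)) (x : frontier Ω) :
    κ.extend (hc.data hn hΩ hη u) x =
      η x • u x - κ.flux (hc.data hn hΩ hη u) • κ.unitFluxField x := by
  by_cases hx : (x : Euc n) ∈ c.tube c.radius
  · rw [← hc.data_Y hn hΩ hη u x hx]
    conv_lhs => rw [← hc.graph_Y_of_mem_frontier hn hΩ x.2 hx]
    rw [Cutoffs.extend_graph hn (hc.supportedInCube_data hn hΩ hη u) hx.1, Cutoffs.unitFluxField,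
      if_pos hx]
  · rw [Cutoffs.extend, if_neg hx, Cutoffs.unitFluxField, if_neg hx, weight_eq_zero hn hη hx]
    simp

/-- Part of the boundary in a patch is contained in one connected component. -/
theorem mem_connectedComponent (hc : c.IsPatch Ω δ p) (hn : 1 ≤ n) (hΩ : IsOpen Ω)
    (hp : p ∈ frontier Ω) (x : frontier Ω) (hx : (x : Euc n) ∈ c.tube c.radius) :
    x ∈ connectedComponent (⟨p, hp⟩ : frontier Ω) := by
  have hr := c.radius_pos
  let g : Metric.ball (0 : Euc (n - 1)) c.radius → frontier Ω := fun y =>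
    ⟨c.graph y, hc.graph_mem_frontier hn hΩ (by
      have : ‖(y : Euc (n - 1))‖ < c.radius := mem_ball_zero_iff.1 y.2
      linarith)⟩
  have hg : Continuous g := by
    refine Continuous.subtype_mk ?_ _
    exact continuousOn_iff_continuous_domRestrict.1
      (hc.continuousOn_graph.mono (Metric.ball_subset_ball (by linarith)))
  have : PreconnectedSpace (Metric.ball (0 : Euc (n - 1)) c.radius) :=
    Subtype.preconnectedSpace (convex_ball _ _).isPreconnected
  refine (isPreconnected_range hg).subset_connectedComponent ?_ ?_
  · exact ⟨⟨0, by simpa using hr⟩, Subtype.ext hc.graph_zero⟩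
  · exact ⟨⟨c.Y x, by simpa using hx.1⟩, Subtype.ext (hc.graph_Y_of_mem_frontier hn hΩ x.2 hx)⟩

variable {l J : ℕ} {α : ℝ≥0} {e : Fin J → GraphChart n}

theorem unifCHolder_comp_graph (hc : c.IsPatch Ω δ p) (hn : 1 ≤ n) (hΩ : IsOpen Ω) (hα : α ≤ 1)
    (he : IsBoundaryAtlas e Ω (l + 1) α) {ι W : Type} [NormedAddCommGroup W] [NormedSpace ℝ W]
    {N : ι → ℝ} (hN : ∀ i, 0 ≤ N i) {G : ι → Euc n → W} (hG : UnifCHolder l α Set.univ N G) :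
    UnifCHolder l α (Metric.ball 0 c.radius) N fun i y => G i (c.graph y) := by
  have hr := c.radius_pos
  have hB : IsOpen (Metric.ball (0 : Euc (n - 1)) c.radius) := Metric.isOpen_ball
  have hD := hc.unifCHolder_fderiv hn hΩ hα he
  have hd : ∀ y ∈ Metric.ball (0 : Euc (n - 1)) c.radius, HasFDerivAt c.graph
      (c.frame.toContinuousLinearMap + (fderiv ℝ c.h y).smulRight c.dir) y := fun y hy =>
    hc.hasFDerivAt_graph (by
      have : ‖y‖ < c.radius := by simpa using hy
      linarith)
  have hgc : ∀ j ≤ l, UnifCHolder j α (Metric.ball 0 c.radius) (fun _ : Unit => 1)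
      fun _ => fderiv ℝ c.graph := by
    intro j hj
    have h1 := (hD.of_le hj).clm_comp hB (fun _ => zero_le_one)
      ((ContinuousLinearMap.smulRightL ℝ (Euc (n - 1)) (Euc n)).flip c.dir)
    exact ((UnifCHolder.const hB c.frame.toContinuousLinearMap).add hB h1).congr hB
      fun _ y hy => (hd y hy).fderiv.symm
  obtain ⟨K, hK, hKb⟩ := hgc 0 (Nat.zero_le l)
  have hb := (hKb ()).holderBound.norm_le
  refine UnifCHolder.comp hB isOpen_univ hα hN (Set.mapsTo_univ _ _) (K := K) (fun y hy z hz => ?_)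
    (fun _ y hy => (hd y hy).differentiableAt.differentiableWithinAt) (fun j hj => hgc j hj.le) hG
  exact (convex_ball (0 : Euc (n - 1)) c.radius).norm_image_sub_le_of_norm_fderiv_le (𝕜 := ℝ)
    (fun w hw => (hd w hw).differentiableAt) (fun w hw => by simpa using hb w hw) hz hy

theorem unifCHolder_data (hc : c.IsPatch Ω δ p) (hn : 1 ≤ n) (hΩ : IsOpen Ω) (hα : α ≤ 1)
    (he : IsBoundaryAtlas e Ω (l + 1) α) (hη : c.IsWeight η) {ι : Type} {N : ι → ℝ}
    (hN : ∀ i, 0 ≤ N i) {u : ι → C(frontier Ω, Euc n)}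
    (hu : UnifCHolder l α (Metric.ball 0 c.radius) N fun i => c.pullback Ω (u i)) :
    UnifCHolder l α Set.univ N fun i => ⇑(hc.data hn hΩ hη (u i)) := by
  have hr := c.radius_pos
  refine UnifCHolder.of_support (isCompact_closedBall 0 (c.radius / 2)) Metric.isOpen_ball
    (Metric.closedBall_subset_ball (by linarith)) hN (fun i y hy => hc.data_eq_zero hn hΩ hη (u i)
      fun h => hy (mem_closedBall_of_graph_mem_cell hn h))
    (UnifCHolder.congr Metric.isOpen_ball (UnifCHolder.smul_fixed Metric.isOpen_ball hN ?_ hu)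
      fun i y hy => (hc.data_apply hn hΩ hη (u i) (by simpa using hy)).symm)
  exact hc.unifCHolder_comp_graph hn hΩ hα he (fun _ => zero_le_one)
    (UnifCHolder.of_hasCompactSupport hα hη.contDiff (hc.hasCompactSupport hn hη))

theorem exists_flux_bound (κ : c.Cutoffs) (hn : 1 ≤ n) : ∃ C, 0 ≤ C ∧
    ∀ f : C(Euc (n - 1), Euc n), SupportedInCube c.cubeRadius f → ∀ M, (∀ y, ‖f y‖ ≤ M) →
      |κ.flux f| ≤ C * M := by
  have hR := c.cubeRadius_pos hn
  obtain ⟨S, hS⟩ := (isCompact_closedBall (0 : Euc (n - 1)) c.radius).exists_bound_of_continuousOn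
    κ.slope.continuous.continuousOn
  have hS0 : 0 ≤ S := (norm_nonneg _).trans (hS 0 (by simpa using c.radius_pos.le))
  refine ⟨(1 + S) * volume.real (Metric.closedBall (0 : Euc (n - 1)) c.radius), by positivity,
    fun f hf M hM => ?_⟩
  have h0 : ∀ y ∉ Metric.closedBall (0 : Euc (n - 1)) c.radius, κ.fluxDensity f y = 0 := by
    intro y hy
    refine Cutoffs.supported_fluxDensity hf y ?_
    by_contra! h
    exact hy (by simpa using (c.norm_lt_radius hn fun k => by linarith [h k]).le)
  rw [Cutoffs.flux, ← setIntegral_eq_integral_of_forall_compl_eq_zero h0, ← Real.norm_eq_abs]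
  refine (norm_setIntegral_le_of_norm_le_const (C := (1 + S) * M) measure_closedBall_lt_top
    fun y hy => ?_).trans_eq (by ring)
  rw [Cutoffs.fluxDensity_apply]
  have h1 : ‖c.tL (f y)‖ ≤ M := (c.norm_tL_le _).trans (hM y)
  have h2 : ‖κ.slope y (c.yL (f y))‖ ≤ S * M :=
    (κ.slope y).le_of_opNorm_le_of_le (hS y hy) ((c.norm_yL_le _).trans (hM y))
  exact (norm_sub_le _ _).trans (by linarith)

end IsPatch

end GraphChart

/-! ### Transport of flux along the boundary -/

section Transport

variable {n : ℕ} {Ω : Set (Euc n)} {δ : ℝ}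

/-- A divergence-free field supported in the `δ`-neighbourhood of `∂Ω` that is as regular as the
boundary permits. -/
structure IsCollarField (Ω : Set (Euc n)) (δ : ℝ) (U : Euc n → Euc n) : Prop where
  weaklySolenoidal : WeaklySolenoidal U
  eq_zero : ∀ x ∉ Metric.thickening δ (frontier Ω), U x = 0
  unifCHolder : ∀ (l : ℕ) (α : ℝ≥0), α ≤ 1 → ∀ (J : ℕ) (e : Fin J → GraphChart n),
    IsBoundaryAtlas e Ω (l + 1) α → UnifCHolder l α Set.univ (fun _ : Unit => 1) fun _ => U

namespace IsCollarField

variable {U U' : Euc n → Euc n}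

theorem add (h : IsCollarField Ω δ U) (h' : IsCollarField Ω δ U') : IsCollarField Ω δ (U + U') :=
  ⟨h.1.add h'.1, fun x hx => by simp [h.2 x hx, h'.2 x hx], fun l α hα J e he =>
    (h.3 l α hα J e he).add isOpen_univ (h'.3 l α hα J e he)⟩

theorem smul (h : IsCollarField Ω δ U) (r : ℝ) : IsCollarField Ω δ (r • U) :=
  ⟨h.1.smul r, fun x hx => by simp [h.2 x hx], fun l α hα J e he =>
    (h.3 l α hα J e he).clm_comp isOpen_univ (fun _ => zero_le_one)
      (r • ContinuousLinearMap.id ℝ (Euc n))⟩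

end IsCollarField

/-- A patch around `p` together with the auxiliary functions used there. -/
structure BoundaryPatch (Ω : Set (Euc n)) (δ : ℝ) (p : Euc n) where
  chart : GraphChart n
  isPatch : chart.IsPatch Ω δ p
  κ : chart.Cutoffs

namespace BoundaryPatch

open GraphChart

variable {p q : Euc n} (P : BoundaryPatch Ω δ p) (Q : BoundaryPatch Ω δ q)

/-- The flux through the graph of the data `η u` localized to a patch. -/
noncomputable def weightedFlux (hn : 1 ≤ n) (hΩ : IsOpen Ω) {η : Euc n → ℝ}
    (hη : P.chart.IsWeight η) (u : C(frontier Ω, Euc n)) : ℝ :=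
  P.κ.flux (P.isPatch.data hn hΩ hη u)

/-- The divergence-free extension of the data `η u` localized to a patch. -/
noncomputable def weightedExtend (hn : 1 ≤ n) (hΩ : IsOpen Ω) {η : Euc n → ℝ}
    (hη : P.chart.IsWeight η) (u : C(frontier Ω, Euc n)) : Euc n → Euc n :=
  P.κ.extend (P.isPatch.data hn hΩ hη u)

theorem weightedExtend_eq_zero (hn : 1 ≤ n) (hΩ : IsOpen Ω) {η : Euc n → ℝ}
    (hη : P.chart.IsWeight η) (u : C(frontier Ω, Euc n)) {x : Euc n}
    (hx : x ∉ Metric.thickening δ (frontier Ω)) : P.weightedExtend hn hΩ hη u x = 0 :=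
  P.isPatch.extend_eq_zero hn (P.isPatch.supportedInCube_data hn hΩ hη u) fun h =>
    hx (P.isPatch.core_subset_thickening hn hΩ h)

theorem weaklySolenoidal_weightedExtend (hn : 1 ≤ n) (hΩ : IsOpen Ω) {η : Euc n → ℝ}
    (hη : P.chart.IsWeight η) (u : C(frontier Ω, Euc n)) :
    WeaklySolenoidal (P.weightedExtend hn hΩ hη u) :=
  P.isPatch.weaklySolenoidal_extend hn (P.isPatch.supportedInCube_data hn hΩ hη u)

theorem isCollarField_weightedExtend_const (hn : 1 ≤ n) (hΩ : IsOpen Ω) {η : Euc n → ℝ}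
    (hη : P.chart.IsWeight η) (v : Euc n) :
    IsCollarField Ω δ (P.weightedExtend hn hΩ hη (ContinuousMap.const _ v)) := by
  refine ⟨P.weaklySolenoidal_weightedExtend hn hΩ hη _,
    fun x hx => P.weightedExtend_eq_zero hn hΩ hη _ hx, fun l α hα J e he => ?_⟩
  refine P.isPatch.unifCHolder_extend hn hΩ hα he (fun _ => zero_le_one)
    (F := fun _ : Unit => P.isPatch.data hn hΩ hη (ContinuousMap.const _ v))
    (fun _ => P.isPatch.supportedInCube_data hn hΩ hη _)
    (P.isPatch.unifCHolder_data hn hΩ hα he hη (fun _ => zero_le_one) ?_)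
  refine (UnifCHolder.const Metric.isOpen_ball v).congr Metric.isOpen_ball fun _ y hy => ?_
  have hy' : ‖y‖ < P.chart.radius := by simpa using hy
  rw [P.isPatch.pullback_graph hn hΩ (by linarith [P.chart.radius_pos])]
  rfl

/-- The fields of unit flux of two patches differ by the boundary values of a collar field. -/
def FluxEquiv : Prop := ∃ U, IsCollarField Ω δ U ∧
  ∀ x : frontier Ω, U x = P.κ.unitFluxField x - Q.κ.unitFluxField x

variable {P Q}

theorem FluxEquiv.symm (h : P.FluxEquiv Q) : Q.FluxEquiv P := by
  obtain ⟨U, hU, hb⟩ := h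
  exact ⟨(-1 : ℝ) • U, hU.smul _, fun x => by simp [hb x]⟩

theorem FluxEquiv.trans {r : Euc n} {R : BoundaryPatch Ω δ r} (h : P.FluxEquiv Q)
    (h' : Q.FluxEquiv R) : P.FluxEquiv R := by
  obtain ⟨U, hU, hb⟩ := h
  obtain ⟨U', hU', hb'⟩ := h'
  exact ⟨U + U', hU.add hU', fun x => by simp [hb x, hb' x]⟩

/-- If the centre of `Q` lies in the patch `P`, then both patches can extend the same small bump of
data near that centre, and the extensions differ on the boundary by multiples, with the same factor,
of the fields of unit flux. -/
theorem fluxEquiv_of_mem_cell (hn : 1 ≤ n) (hΩ : IsOpen Ω)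
    (hqP : q ∈ P.chart.cell) : P.FluxEquiv Q := by
  have hr := Q.chart.radius_pos
  have hnhds : P.chart.cell ∩ Q.chart.cell ∈ 𝓝 q :=
    Filter.inter_mem ((P.isPatch.isOpen_cell hn).mem_nhds hqP)
      ((Q.isPatch.isOpen_cell hn).mem_nhds (Q.isPatch.mem_cell hn))
  obtain ⟨Ψ, hΨt, -, hΨ, hΨr, hΨ1⟩ := exists_contDiff_tsupport_subset (n := ⊤) hnhds
  have hP : P.chart.IsWeight Ψ := ⟨hΨ, hΨt.trans Set.inter_subset_left⟩
  have hQ : Q.chart.IsWeight Ψ := ⟨hΨ, hΨt.trans Set.inter_subset_right⟩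
  set v : C(frontier Ω, Euc n) := ContinuousMap.const _ Q.chart.dir with hv
  -- both fluxes are the same surface integral
  have hflux : P.weightedFlux hn hΩ hP v = Q.weightedFlux hn hΩ hQ v := by
    have h1 := (P.isPatch.integral_weight hn hΩ hP P.κ v).2
    have h2 := (Q.isPatch.integral_weight hn hΩ hQ Q.κ v).2
    rw [h1] at h2
    exact neg_injective h2
  have hpos : 0 < Q.weightedFlux hn hΩ hQ v := by
    set f := Q.isPatch.data hn hΩ hQ v with hf
    have hsupp := Q.isPatch.supportedInCube_data hn hΩ hQ v
    have hval : ∀ y, ‖y‖ < Q.chart.radius → Q.κ.fluxDensity f y = Ψ (Q.chart.graph y) := by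
      intro y hy
      rw [Cutoffs.fluxDensity_apply, hf, Q.isPatch.data_apply hn hΩ hQ v hy,
        Q.isPatch.pullback_graph hn hΩ (by linarith)]
      simp [hv]
    refine (Q.κ.fluxDensity f).continuous.integral_pos_of_hasCompactSupport_nonneg_nonzero
      (Cutoffs.supported_fluxDensity hsupp).hasCompactSupport (fun y => ?_) (x := 0) ?_
    · by_cases hy : ‖y‖ < Q.chart.radius
      · rw [hval y hy]
        exact (hΨr (Set.mem_range_self _)).1
      · rw [Cutoffs.fluxDensity_apply, show f y = 0 from if_neg hy]
        simp
    · rw [hval 0 (by simpa using hr), Q.isPatch.graph_zero, hΨ1]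
      exact one_ne_zero
  set a := Q.weightedFlux hn hΩ hQ v with ha
  refine ⟨a⁻¹ • (Q.weightedExtend hn hΩ hQ v + (-1 : ℝ) • P.weightedExtend hn hΩ hP v),
    ((Q.isCollarField_weightedExtend_const hn hΩ hQ _).add
      ((P.isCollarField_weightedExtend_const hn hΩ hP _).smul _)).smul _, fun x => ?_⟩
  have h1 : P.weightedExtend hn hΩ hP v x = _ :=
    P.isPatch.extend_data_boundary hn hΩ hP P.κ v x
  have h2 : Q.weightedExtend hn hΩ hQ v x = _ :=
    Q.isPatch.extend_data_boundary hn hΩ hQ Q.κ v x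
  change _ = _ - P.weightedFlux hn hΩ hP v • _ at h1
  change _ = _ - Q.weightedFlux hn hΩ hQ v • _ at h2
  rw [hflux] at h1
  simp only [Pi.smul_apply, Pi.add_apply, h1, h2]
  rw [inv_smul_eq_iff₀ hpos.ne']
  module

/-- Flux can be moved between any two patches centred in the same component of the boundary. -/
theorem fluxEquiv_of_mem_connectedComponent (hn : 1 ≤ n) (hΩ : IsOpen Ω)
    (P : ∀ p : frontier Ω, BoundaryPatch Ω δ p) {p q : frontier Ω}
    (hq : connectedComponent p = connectedComponent q) : (P p).FluxEquiv (P q) := by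
  refine isPreconnected_connectedComponent.induction₂ (fun p q => (P p).FluxEquiv (P q))
    (fun p _ => ?_) (fun _ _ _ _ _ _ => FluxEquiv.trans) (fun _ _ _ _ => FluxEquiv.symm)
    (mem_connectedComponent (x := p)) (hq ▸ mem_connectedComponent)
  refine nhdsWithin_le_nhds ?_
  filter_upwards [(((P p).isPatch.isOpen_cell hn).preimage continuous_subtype_val).mem_nhds
    ((P p).isPatch.mem_cell hn)] with q hq
  exact fluxEquiv_of_mem_cell hn hΩ hq

end BoundaryPatch

end Transport

/-! ### The extension operator -/

section Gluing

variable {n : ℕ} {Ω : Set (Euc n)} {δ : ℝ}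

theorem exists_weights (hn : 1 ≤ n) (hΩ_bdry : IsCompact (frontier Ω))
    (P : ∀ p : frontier Ω, BoundaryPatch Ω δ p) :
    ∃ (t : Finset (frontier Ω)) (η : t → Euc n → ℝ), (∀ i : t, (P i).chart.IsWeight (η i)) ∧
      ∀ x ∈ frontier Ω, ∑ i, η i x = 1 := by
  have hopen : ∀ p, IsOpen (P p).chart.cell := fun p => (P p).isPatch.isOpen_cell hn
  obtain ⟨t, ht⟩ := hΩ_bdry.elim_finite_subcover (fun p => (P p).chart.cell) hopen fun x hx =>
    Set.mem_iUnion.2 ⟨⟨x, hx⟩, (P ⟨x, hx⟩).isPatch.mem_cell hn⟩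
  obtain ⟨f, hf⟩ := SmoothPartitionOfUnity.exists_isSubordinate (modelWithCornersSelf ℝ (Euc n))
    hΩ_bdry.isClosed (fun i : t => (P i).chart.cell) (fun i => hopen i) fun x hx => by
      obtain ⟨i, hi, hxi⟩ := Set.mem_iUnion₂.1 (ht hx)
      exact Set.mem_iUnion.2 ⟨⟨i, hi⟩, hxi⟩
  refine ⟨t, fun i => f i, fun i : t => ⟨(f i).contMDiff.contDiff, hf i⟩, fun x hx => ?_⟩
  rw [← finsum_eq_sum_of_fintype]
  exact f.sum_eq_one hx

theorem BoundaryHolderClass.continuous {J l : ℕ} {α : ℝ≥0} (hn : 1 ≤ n) (hΩ : IsOpen Ω)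
    (hα : α ≤ 1) {e : Fin J → GraphChart n} (he : IsBoundaryAtlas e Ω (l + 1) α)
    (P : ∀ p : frontier Ω, BoundaryPatch Ω δ p) {u : frontier Ω → Euc n}
    (hu : BoundaryHolderClass e Ω l α u) : Continuous u := by
  rw [continuous_iff_continuousAt]
  intro x
  obtain ⟨C, -, hC⟩ := (P x).isPatch.unifCHolder_boundary hn hΩ hα he
  have hr := (P x).chart.radius_pos
  have hcont := (hC ⟨u, hu⟩).continuousOn
  have htube : ∀ᶠ z : frontier Ω in 𝓝 x, (z : Euc n) ∈ (P x).chart.tube (P x).chart.radius :=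
    (((P x).isPatch.isOpen_tube (by linarith)).preimage continuous_subtype_val).mem_nhds
      ((P x).chart.core_subset_tube hn ((P x).chart.cell_subset_core hn ((P x).isPatch.mem_cell hn)))
  have h1 : ContinuousAt (fun z : frontier Ω => (P x).chart.pullback Ω u ((P x).chart.Y z)) x := by
    refine ContinuousAt.comp (g := (P x).chart.pullback Ω u)
      (f := fun z : frontier Ω => (P x).chart.Y z) (hcont.continuousAt
        (Metric.isOpen_ball.mem_nhds ?_))
      ((P x).chart.continuous_Y.comp continuous_subtype_val).continuousAt
    simpa using htube.self_of_nhds.1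
  refine h1.congr ?_
  filter_upwards [htube] with z hz
  have hg := (P x).isPatch.graph_Y_of_mem_frontier hn hΩ z.2 hz
  rw [(P x).isPatch.pullback_graph hn hΩ (by linarith [hz.1])]
  simp only [hg]

/-- If `u` has zero flux through each boundary component, then so has the sum of the localized
fluxes over the patches centred in a given component. -/
theorem sum_weightedFlux_eq_zero (hn : 1 ≤ n) (hΩ : IsOpen Ω)
    (P : ∀ p : frontier Ω, BoundaryPatch Ω δ p) {t : Finset (frontier Ω)} {η : t → Euc n → ℝ}
    (hη : ∀ i : t, (P i).chart.IsWeight (η i)) (hsum : ∀ x ∈ frontier Ω, ∑ i, η i x = 1)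
    {u : C(frontier Ω, Euc n)} (hu : ZeroFlux Ω u) (p : frontier Ω) [DecidablePred fun i : t =>
      connectedComponent (i : frontier Ω) = connectedComponent p] :
    ∑ i ∈ Finset.univ.filter
        (fun i : t => connectedComponent (i : frontier Ω) = connectedComponent p),
      (P i).weightedFlux hn hΩ (hη i) u = 0 := by
  have hm : MeasurableSet (connectedComponent p) := isClosed_connectedComponent.measurableSet
  have hint := fun i : t => ((P i).isPatch.integral_weight hn hΩ (hη i) (P i).κ u)
  -- a localized field does not meet boundary components other than that of its patch
  have hcomp : ∀ (i : t) (x : frontier Ω), η i x ≠ 0 →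
      connectedComponent x = connectedComponent (i : frontier Ω) := by
    intro i x hx
    refine (connectedComponent_eq ((P i).isPatch.mem_connectedComponent hn hΩ i.1.2 x ?_)).symm
    by_contra h
    exact hx (GraphChart.IsPatch.weight_eq_zero hn (hη i) h)
  have hset : ∀ i : t, ∫ x in connectedComponent p, ⟪η i x • u x, outerNormal Ω x⟫ ∂μHE[n - 1] =
      if connectedComponent (i : frontier Ω) = connectedComponent p then
        -(P i).weightedFlux hn hΩ (hη i) u else 0 := by
    intro i
    split_ifs with h
    · rw [setIntegral_eq_integral_of_forall_compl_eq_zero fun x hx => ?_]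
      · exact (hint i).2
      · by_cases h0 : η i x = 0
        · simp [h0]
        · exact absurd (h ▸ hcomp i x h0 ▸ mem_connectedComponent) hx
    · refine setIntegral_eq_zero_of_forall_eq_zero fun x hx => ?_
      have h0 : η i x = 0 := by
        by_contra h0
        exact h ((hcomp i x h0).symm.trans (connectedComponent_eq hx).symm)
      simp [h0]
  have h1 : ∑ i : t, ∫ x in connectedComponent p, ⟪η i x • u x, outerNormal Ω x⟫ ∂μHE[n - 1] =
      0 := by
    rw [← integral_finsetSum _ fun i _ => (hint i).1.integrableOn]
    refine Eq.trans (integral_congr_ae (Filter.Eventually.of_forall fun x => ?_)) (hu p)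
    simp only
    rw [← sum_inner, ← Finset.sum_smul, hsum x x.2, one_smul]
  simp only [hset, ← Finset.sum_filter, Finset.sum_neg_distrib, neg_eq_zero] at h1
  exact h1

end Gluing

section Gluing

variable {n : ℕ} {Ω : Set (Euc n)} {δ : ℝ}

/-- The sum of the local extensions of `η i u`, corrected by fields `U i` that carry the fluxes
which the local extensions leave behind. -/
noncomputable def gluedExtension (hn : 1 ≤ n) (hΩ : IsOpen Ω)
    (P : ∀ p : frontier Ω, BoundaryPatch Ω δ p) {t : Finset (frontier Ω)} {η : t → Euc n → ℝ}
    (hη : ∀ i : t, (P i).chart.IsWeight (η i)) (U : t → Euc n → Euc n) :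
    C(frontier Ω, Euc n) →ₗ[ℝ] (Euc n → Euc n) where
  toFun u := ∑ i : t, ((P i).weightedExtend hn hΩ (hη i) u +
    (P i).weightedFlux hn hΩ (hη i) u • U i)
  map_add' u v := by
    rw [← Finset.sum_add_distrib]
    refine Finset.sum_congr rfl fun i _ => ?_
    simp only [BoundaryPatch.weightedExtend, BoundaryPatch.weightedFlux, map_add,
      GraphChart.Cutoffs.extend_add]
    rw [GraphChart.Cutoffs.flux_add ((P i).isPatch.supportedInCube_data hn hΩ (hη i) u)
      ((P i).isPatch.supportedInCube_data hn hΩ (hη i) v), add_smul]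
    abel
  map_smul' r u := by
    rw [RingHom.id_apply, Finset.smul_sum]
    refine Finset.sum_congr rfl fun i _ => ?_
    simp only [BoundaryPatch.weightedExtend, BoundaryPatch.weightedFlux, map_smul,
      GraphChart.Cutoffs.extend_smul, GraphChart.Cutoffs.flux_smul]
    rw [smul_add, smul_smul]

variable {P : ∀ p : frontier Ω, BoundaryPatch Ω δ p} {t : Finset (frontier Ω)}
  {η : t → Euc n → ℝ} {U : t → Euc n → Euc n}

theorem gluedExtension_apply (hn : 1 ≤ n) (hΩ : IsOpen Ω)
    (hη : ∀ i : t, (P i).chart.IsWeight (η i)) (u : C(frontier Ω, Euc n)) :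
    gluedExtension hn hΩ P hη U u = ∑ i : t, ((P i).weightedExtend hn hΩ (hη i) u +
      (P i).weightedFlux hn hΩ (hη i) u • U i) := rfl

theorem weaklySolenoidal_gluedExtension (hn : 1 ≤ n) (hΩ : IsOpen Ω)
    (hη : ∀ i : t, (P i).chart.IsWeight (η i)) (hU : ∀ i, IsCollarField Ω δ (U i))
    (u : C(frontier Ω, Euc n)) : WeaklySolenoidal (gluedExtension hn hΩ P hη U u) := by
  rw [gluedExtension_apply]
  exact WeaklySolenoidal.sum fun i _ =>
    ((P i).weaklySolenoidal_weightedExtend hn hΩ (hη i) u).add ((hU i).weaklySolenoidal.smul _)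

theorem gluedExtension_eq_zero (hn : 1 ≤ n) (hΩ : IsOpen Ω)
    (hη : ∀ i : t, (P i).chart.IsWeight (η i)) (hU : ∀ i, IsCollarField Ω δ (U i))
    (u : C(frontier Ω, Euc n)) {x : Euc n} (hx : x ∉ Metric.thickening δ (frontier Ω)) :
    gluedExtension hn hΩ P hη U u x = 0 := by
  rw [gluedExtension_apply, Finset.sum_apply]
  refine Finset.sum_eq_zero fun i _ => ?_
  simp [(P i).weightedExtend_eq_zero hn hΩ (hη i) u hx, (hU i).eq_zero x hx]

/-- The boundary values of the glued extension: if the fields `U i` move the fluxes to one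
representative `ρ` of each boundary component, then they cancel there. -/
theorem gluedExtension_boundary (hn : 1 ≤ n) (hΩ : IsOpen Ω)
    (hη : ∀ i : t, (P i).chart.IsWeight (η i)) (hsum : ∀ x ∈ frontier Ω, ∑ i, η i x = 1)
    {ρ : ConnectedComponents (frontier Ω) → frontier Ω}
    (hU : ∀ i : t, ∀ x : frontier Ω, U i x = (P i).κ.unitFluxField x -
      (P (ρ (ConnectedComponents.mk (i : frontier Ω)))).κ.unitFluxField x)
    {u : C(frontier Ω, Euc n)} (hu : ZeroFlux Ω u) (x : frontier Ω) :
    gluedExtension hn hΩ P hη U u x = u x := by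
  classical
  have h1 : ∀ i : t, (P i).weightedExtend hn hΩ (hη i) u x =
      η i x • u x - (P i).weightedFlux hn hΩ (hη i) u • (P i).κ.unitFluxField x := fun i =>
    (P i).isPatch.extend_data_boundary hn hΩ (hη i) (P i).κ u x
  rw [gluedExtension_apply, Finset.sum_apply]
  simp only [Pi.add_apply, Pi.smul_apply, h1, hU, smul_sub]
  have h2 : ∑ i : t, (P i).weightedFlux hn hΩ (hη i) u •
      (P (ρ (ConnectedComponents.mk (i : frontier Ω)))).κ.unitFluxField (x : Euc n) = 0 := by
    rw [← Finset.sum_fiberwise_of_maps_to (t := Finset.univ.image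
      fun i : t => ConnectedComponents.mk (i : frontier Ω))
      (g := fun i : t => ConnectedComponents.mk (i : frontier Ω))
      fun i hi => Finset.mem_image_of_mem _ hi]
    refine Finset.sum_eq_zero fun C hC => ?_
    obtain ⟨p, -, rfl⟩ := Finset.mem_image.1 hC
    have h3 := sum_weightedFlux_eq_zero hn hΩ P hη hsum hu p
    simp only [ConnectedComponents.coe_eq_coe]
    calc _ = ∑ i ∈ Finset.univ.filter (fun i : t =>
            connectedComponent (i : frontier Ω) = connectedComponent (p : frontier Ω)),
          (P i).weightedFlux hn hΩ (hη i) u •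
            (P (ρ (ConnectedComponents.mk (p : frontier Ω)))).κ.unitFluxField (x : Euc n) := by
          refine Finset.sum_congr rfl fun i hi => ?_
          rw [ConnectedComponents.coe_eq_coe.2 (Finset.mem_filter.1 hi).2]
      _ = 0 := by rw [← Finset.sum_smul, h3, zero_smul]
  have h4 : ∑ i : t, η i x • u x = u x := by
    rw [← Finset.sum_smul, hsum x x.2, one_smul]
  calc _ = ∑ i : t, (η i x • u x - (P i).weightedFlux hn hΩ (hη i) u •
        (P (ρ (ConnectedComponents.mk (i : frontier Ω)))).κ.unitFluxField (x : Euc n)) :=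
        Finset.sum_congr rfl fun i _ => by abel
    _ = u x := by rw [Finset.sum_sub_distrib, h4, h2, sub_zero]

theorem unifCHolder_gluedExtension {l J : ℕ} {α : ℝ≥0} {e : Fin J → GraphChart n} (hn : 1 ≤ n)
    (hΩ : IsOpen Ω) (hα : α ≤ 1) (he : IsBoundaryAtlas e Ω (l + 1) α)
    (hη : ∀ i : t, (P i).chart.IsWeight (η i)) (hU : ∀ i, IsCollarField Ω δ (U i))
    {ι : Type} {N : ι → ℝ} (hN : ∀ i, 0 ≤ N i) {u : ι → C(frontier Ω, Euc n)}
    (hu : ∀ p : frontier Ω, UnifCHolder l α (Metric.ball 0 (P p).chart.radius) N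
      fun i => (P p).chart.pullback Ω (u i)) :
    UnifCHolder l α Set.univ N fun i => gluedExtension hn hΩ P hη U (u i) := by
  have hdata := fun i : t => (P i).isPatch.unifCHolder_data hn hΩ hα he (hη i) hN (hu i)
  have hsupp := fun (i : t) u => (P i).isPatch.supportedInCube_data hn hΩ (hη i) u
  have hflux : ∀ i : t, UnifCHolder l α Set.univ N
      fun j (_ : Euc n) => (P i).weightedFlux hn hΩ (hη i) (u j) := by
    intro i
    obtain ⟨C, hC, hdata⟩ := hdata i
    obtain ⟨D, hD, hF⟩ := GraphChart.IsPatch.exists_flux_bound (P i).κ hn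
    refine ⟨D * C, by positivity, fun j => (CHolder.const isOpen_univ _).mono ?_⟩
    rw [mul_assoc]
    exact hF _ (hsupp i _) _ fun y => (hdata j).holderBound.norm_le y (Set.mem_univ y)
  refine UnifCHolder.congr isOpen_univ (UnifCHolder.sum isOpen_univ hN Finset.univ
    (F := fun (i : t) j x => (P i).weightedExtend hn hΩ (hη i) (u j) x +
      (P i).weightedFlux hn hΩ (hη i) (u j) • U i x) fun i _ => ?_) fun j x _ => ?_
  · refine UnifCHolder.add isOpen_univ
      ((P i).isPatch.unifCHolder_extend hn hΩ hα he hN (fun j => hsupp i _) (hdata i)) ?_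
    have hUi : UnifCHolder l α Set.univ (fun _ : ι => 1) fun _ => U i := by
      obtain ⟨C, hC, h⟩ := (hU i).unifCHolder l α hα J e he
      exact UnifCHolder.of_const hC (by simpa using h ())
    simpa using UnifCHolder.smul isOpen_univ hN (fun _ => zero_le_one) (hflux i) hUi
  · rw [gluedExtension_apply, Finset.sum_apply]
    rfl

theorem BoundaryHolderClass.norm_lt_top {J l : ℕ} {α : ℝ≥0} {e : Fin J → GraphChart n}
    {u : frontier Ω → Euc n} (hu : BoundaryHolderClass e Ω l α u) :
    boundaryHolderNorm e Ω l α u < ⊤ :=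
  ENNReal.sum_lt_top.2 fun i _ => (hu i).2.2.2

end Gluing

theorem lemma2p3 (n : ℕ) (hn : 2 ≤ n) (Ω : Set (Euc n)) (hΩ_open : IsOpen Ω)
    (hΩ_conn : IsConnected Ω) (hΩ_bdry : IsCompact (frontier Ω)) (δ : ℝ) (hδ : 0 < δ) :
    ∃ ext : (frontier Ω → Euc n) →ₗ[ℝ] (Euc n → Euc n),
      ∀ (l : ℕ) (α : ℝ≥0), α ≤ 1 →
      ∀ (J : ℕ) (c : Fin J → GraphChart n), IsBoundaryAtlas c Ω (l + 1) α →
      ∃ C : ℝ≥0, ∀ u : frontier Ω → Euc n, BoundaryHolderClass c Ω l α u → ZeroFlux Ω u →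
        HolderClass l α Ω (ext u) ∧
        WeaklyDivergenceFree Ω (ext u) ∧
        (1 ≤ l → ∀ x ∈ Ω, divergence (ext u) x = 0) ∧
        (∀ x : frontier Ω, ext u x = u x) ∧
        closure {x ∈ closure Ω | ext u x ≠ 0} ⊆ closure (boundaryCollar Ω δ) ∧
        holderNorm l α Ω (ext u) ≤ C * boundaryHolderNorm c Ω l α u := by
  have hn' : 1 ≤ n := by omega
  by_cases hatlas : ∃ (l : ℕ) (α : ℝ≥0) (J : ℕ) (c : Fin J → GraphChart n),
      IsBoundaryAtlas c Ω (l + 1) α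
  swap
  · exact ⟨0, fun l α _ J c hc => absurd ⟨l, α, J, c, hc⟩ hatlas⟩
  have hpatch : ∀ p : frontier Ω, Nonempty (BoundaryPatch Ω δ p) := by
    intro p
    obtain ⟨l, α, J, c, hc⟩ := hatlas
    obtain ⟨i, hi⟩ := Set.mem_iUnion.1 (hc.2 p.2)
    obtain ⟨d, hd⟩ := (hc.1 i).exists_isPatch hn' hΩ_open p.2 hi hδ
    obtain ⟨κ⟩ := hd.nonempty_cutoffs hn'
    exact ⟨⟨d, hd, κ⟩⟩
  let P : ∀ p : frontier Ω, BoundaryPatch Ω δ p := fun p => (hpatch p).some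
  obtain ⟨t, η, hη, hsum⟩ := exists_weights hn' hΩ_bdry P
  let ρ : ConnectedComponents (frontier Ω) → frontier Ω := Quotient.out
  have hρ : ∀ p : frontier Ω, (P p).FluxEquiv (P (ρ (ConnectedComponents.mk p))) := fun p =>
    BoundaryPatch.fluxEquiv_of_mem_connectedComponent hn' hΩ_open P
      (ConnectedComponents.coe_eq_coe.1 (Quotient.out_eq (ConnectedComponents.mk p)).symm)
  choose U hU hUb using fun i : t => hρ i
  -- extend the operator from continuous functions to all functions
  obtain ⟨g, hg⟩ := (ContinuousMap.coeFnLinearMap ℝ :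
    C(frontier Ω, Euc n) →ₗ[ℝ] (frontier Ω → Euc n)).exists_leftInverse_of_injective
      (LinearMap.ker_eq_bot.2 DFunLike.coe_injective)
  have hg' : ∀ u : C(frontier Ω, Euc n), g u = u := fun u => LinearMap.congr_fun hg u
  refine ⟨gluedExtension hn' hΩ_open P hη U ∘ₗ g, fun l α hα J c hc => ?_⟩
  let A : {u // BoundaryHolderClass c Ω l α u} → C(frontier Ω, Euc n) := fun u =>
    ⟨u.1, u.2.continuous hn' hΩ_open hα hc P⟩
  obtain ⟨D, hD, hE⟩ := unifCHolder_gluedExtension hn' hΩ_open hα hc hη hU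
    (N := fun u : {u // BoundaryHolderClass c Ω l α u} => (boundaryHolderNorm c Ω l α u.1).toReal)
    (fun _ => ENNReal.toReal_nonneg) (u := A) fun p =>
      (P p).isPatch.unifCHolder_boundary hn' hΩ_open hα hc
  refine ⟨⟨(l + 2) * D, by positivity⟩, fun u hu hu0 => ?_⟩
  have hEu := hE ⟨u, hu⟩
  set v : C(frontier Ω, Euc n) := A ⟨u, hu⟩ with hv
  have hvu : (v : frontier Ω → Euc n) = u := rfl
  have hext : (gluedExtension hn' hΩ_open P hη U ∘ₗ g) u = gluedExtension hn' hΩ_open P hη U v := by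
    rw [LinearMap.comp_apply, ← hvu, hg']
  rw [hext]
  set E := gluedExtension hn' hΩ_open P hη U v with hEdef
  have hM : 0 ≤ D * (boundaryHolderNorm c Ω l α u).toReal :=
    mul_nonneg hD ENNReal.toReal_nonneg
  have hsol : WeaklySolenoidal E := weaklySolenoidal_gluedExtension hn' hΩ_open hη hU v
  refine ⟨hEu.holderClass hM, hsol.weaklyDivergenceFree Ω, fun hl x _ => ?_, fun x => ?_, ?_, ?_⟩
  · exact hsol.divergence_eq_zero
      ((contDiffOn_univ.1 hEu.1).of_le (by exact_mod_cast hl)) x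
  · exact gluedExtension_boundary hn' hΩ_open hη hsum hUb (u := v) hu0 x
  · refine closure_minimal (fun x hx => ?_) isClosed_closure
    have hxt : x ∈ Metric.thickening δ (frontier Ω) := by
      by_contra h
      exact hx.2 (gluedExtension_eq_zero hn' hΩ_open hη hU v h)
    have := Metric.isOpen_thickening.inter_closure (s := Metric.thickening δ (frontier Ω)) (t := Ω)
      ⟨hxt, hx.1⟩
    rwa [Set.inter_comm] at this
  · refine ((hEu.mono_set (Set.subset_univ Ω)).holderNorm_le hM).trans_eq ?_
    have hfin := hu.norm_lt_top
    rw [← mul_assoc, ENNReal.ofReal_mul (by positivity), ENNReal.ofReal_toReal hfin.ne]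
    congr 1
    exact ENNReal.ofReal_eq_coe_nnreal _
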